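/- Let $K(x) = -\frac{1}{2\pi}\frac{x^\perp}{|x|^2}$ with $x^\perp = (x_2,-x_1)$ be the Biot–Savart kernel on $\mathbb{R}^2$. Let $h : \mathbb{R}^2 \to \mathbb{R}$ be continuously differentiable on $\mathbb{R}^2\setminus\{0\}$ (a singularity at the origin is allowed), with $h \in W^{1,1}(\mathbb{R}^2)$ and $\chi_1^+ h \in L^1(\mathbb{R}^2)$, where $\chi_1^+(x) = |x|$ for $|x|>1$ and $\chi_1^+(x)=0$ for $|x|\le 1$. Suppose also that $$\chi_{\log}^- h \in L^\infty(\mathbb{R}^2), \qquad |x|\,\nabla h \in L^\infty(\mathbb{R}^2),$$ where $\chi_{\log}^-(x) = (1-\log|x|)^{-1}$ for $|x|\le 1$ and $\chi_{\log}^-(x) = 0$ for $|x|>1$. Put $K_h = K * h$. Let $\mathcal{M}(\mathbb{R}^2)$ be the space of finite (signed) Radon measures on $\mathbb{R}^2$ with the weak-* topology of the dual of $C_0(\mathbb{R}^2)$, and let $\mathscr{G}$ be the group of all homeomorphisms of $\mathbb{R}^2$ that preserve the Lebesgue measure. A global weak solution with initial vorticity $q_0 \in \mathcal{M}(\mathbb{R}^2)$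 is a triple $(\eta_h, u_h, q)$ such that $q \in C(\mathbb{R};\mathcal{M}(\mathbb{R}^2))$ and $q(0)=q_0$; $u_h = K_h * q \in C(\mathbb{R}; C(\mathbb{R}^2;\mathbb{R}^2))$; $\eta_h(\cdot,t) \in \mathscr{G}$ for all $t$, $\eta_h$ and $\partial_t \eta_h$ are continuous in time for locally uniform convergence in space, and $$\partial_t \eta_h(x,t) = u_h(\eta_h(x,t),t), \qquad \eta_h(x,0) = x;$$ and the equation $\partial_t q + (u_h\cdot\nabla) q = 0$ holds weakly: $$\int_{\mathbb{R}}\int_{\mathbb{R}^2} \left(\partial_t\psi + u_h\cdot\nabla\psi\right) dq(t)\,dt = 0 \qquad \text{for all } \psi \in C_c^\infty(\mathbb{R}\times\mathbb{R}^2).$$ Then for every $q_0 \in \mathcal{M}(\mathbb{R}^2)$ there is exactly one global weak solution $(\eta_h,u_h,q)$ with initial vorticity $q_0$. Moreover, in this solution $\eta_h \in C^1(\mathbb{R};\mathscr{G})$ and $u_h \in C(\mathbb{R};C(\mathbb{R}^2;\mathbb{R}^2))$ also for uniform convergence on $\mathbb{R}^2$, and $q(t)$ is the image of $q_0$ under $\eta_h(\cdot,t)$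 for every $t\in\mathbb{R}$. -/

import Mathlib

open MeasureTheory Filter Topology
open scoped ContDiff

namespace EulerPoincare

noncomputable section

/-- The Euclidean plane `ℝ²`. -/
abbrev Plane : Type := EuclideanSpace ℝ (Fin 2)

/-- `x^⊥ = (x₂, -x₁)`. -/
def perp (x : Plane) : Plane := !₂[x 1, -x 0]

/-- The Biot-Savart kernel `K(x) = -(1 / 2π) x^⊥ / |x|²` (with value `0` at the origin). -/
def biotSavart (x : Plane) : Plane := (-(1 / (2 * Real.pi)) / ‖x‖ ^ 2) • perp x

/-- The regularized kernel `K_h = K * h`, that is `K_h(x) = ∫ K(x - y) h(y) dy`. -/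
def regKernel (h : Plane → ℝ) (x : Plane) : Plane := ∫ y, h y • biotSavart (x - y)

/-- The weight `χ_log^-`, equal to `(1 - log |x|)⁻¹` for `|x| ≤ 1` and to `0` for `|x| > 1`. -/
def chiLogMinus (x : Plane) : ℝ := if ‖x‖ ≤ 1 then (1 - Real.log ‖x‖)⁻¹ else 0

/-- The weight `χ_1^+`, equal to `0` for `|x| ≤ 1` and to `|x|` for `|x| > 1`. -/
def chiOnePlus (x : Plane) : ℝ := if ‖x‖ ≤ 1 then 0 else ‖x‖

/-- `h ∈ W^{1,1}(ℝ²)`: `h` is integrable and has an integrable weak gradient `g` on all of `ℝ²`. -/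
def MemW11 (h : Plane → ℝ) : Prop :=
  Integrable h volume ∧ ∃ g : Plane → Plane, Integrable g volume ∧
    ∀ φ : Plane → ℝ, ContDiff ℝ ∞ φ → HasCompactSupport φ → ∀ v : Plane,
      ∫ x, h x * fderiv ℝ φ x v = -∫ x, inner ℝ (g x) v * φ x

/-- The hypotheses on the smoothing function `h`. It may be singular at the origin, so it is
continuously differentiable on `ℝ² \ {0}`; the value `h 0` is irrelevant. -/
structure IsSmoothingFunction (h : Plane → ℝ) : Prop where
  contDiffOn : ContDiffOn ℝ 1 h {0}ᶜ
  memW11 : MemW11 h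
  integrable_chiOnePlus : Integrable (fun x => chiOnePlus x * h x) volume
  bounded_chiLogMinus : MemLp (fun x => chiLogMinus x * h x) ⊤ volume
  bounded_gradient : MemLp (fun x => ‖x‖ • gradient h x) ⊤ volume

/-- A global weak solution of the vorticity equation `∂ₜ q + (u · ∇) q = 0`, `u = K_h * q`, with
initial vorticity `q₀`: the flow map `η`, the velocity `u` and the vorticity `q`.
Finite Radon measures on `ℝ²` are signed Borel measures (the notation `∫ᵛ x, f x ∂<•μ` is the
integral of `f` against the signed measure `μ`). -/
structure IsGlobalWeakSolution (h : Plane → ℝ) (q₀ : SignedMeasure Plane)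
    (η : ℝ → Plane ≃ₜ Plane) (u : ℝ → Plane → Plane) (q : ℝ → SignedMeasure Plane) : Prop where
  /-- `q` is continuous in time for the weak-* topology of `M(ℝ²) = C₀(ℝ²)*`. -/
  vorticity_continuous : ∀ f : ZeroAtInftyContinuousMap Plane ℝ,
    Continuous fun t => ∫ᵛ x, f x ∂<•(q t)
  /-- The velocity is `u = K_h * q`. -/
  velocity_eq : ∀ t x, u t x = ∫ᵛ y, regKernel h (x - y) ∂<•(q t)
  /-- `u ∈ C(ℝ; C(ℝ²; ℝ²))`, for locally uniform convergence on `C(ℝ²; ℝ²)`. -/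
  velocity_continuous : Continuous fun p : ℝ × Plane => u p.1 p.2
  /-- Every `η t` preserves the Lebesgue measure. -/
  flow_measurePreserving : ∀ t, MeasurePreserving (η t) volume volume
  /-- `η` is jointly continuous, that is, continuous in time for locally uniform convergence.
  With the next field and `velocity_continuous`, so is `∂ₜ η`. -/
  flow_continuous : Continuous fun p : ℝ × Plane => η p.1 p.2
  /-- `∂ₜ η(x, t) = u(η(x, t), t)`. -/
  flow_hasDerivAt : ∀ t x, HasDerivAt (fun s => η s x) (u t (η t x)) t
  /-- `η(x, 0) = x`. -/
  flow_zero : ∀ x, η 0 x = x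
  /-- `q(0) = q₀`. -/
  initial : q 0 = q₀
  /-- `∫∫ (∂ₜ ψ + u · ∇ψ) dq dt = 0` for all test functions `ψ`; the derivative of `ψ` at `(t, x)`
  in the direction `(1, u)` is `∂ₜ ψ + u · ∇ψ`. -/
  weak_equation : ∀ ψ : ℝ × Plane → ℝ, ContDiff ℝ ∞ ψ → HasCompactSupport ψ →
    ∫ t, (∫ᵛ x, fderiv ℝ ψ (t, x) (1, u t x) ∂<•(q t)) = 0

/-- `η ∈ C¹(ℝ; 𝒢)`, where `𝒢` is the group of the homeomorphisms of `ℝ²` that preserve the Lebesgue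
measure, with uniform convergence: the difference quotients in time converge uniformly in space to
a continuous field, which is continuous in time for uniform convergence. -/
def IsC1Flow (η : ℝ → Plane ≃ₜ Plane) : Prop :=
  (∀ t, MeasurePreserving (η t) volume volume) ∧
    ∃ v : ℝ → Plane → Plane, (∀ t, Continuous (v t)) ∧
      (∀ t, TendstoUniformly (fun s x => (s - t)⁻¹ • (η s x - η t x)) (v t) (𝓝[≠] t)) ∧
      ∀ t, TendstoUniformly v (v t) (𝓝 t)

end

end EulerPoincare

/-! The proof rests on the fact that `K_h` is bounded and log-Lipschitz: its increments over a
distance `r` are at most a constant times `r (1 + log⁻ r)`. To see this, `K` is split into a smooth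
kernel and a remainder that is singular like `|x|⁻¹` but decays like `|x|⁻³`. In the convolution
with the remainder, the translation is moved onto `h`; the bound on `|x| ∇h` controls its increments
away from the origin and the logarithmic bound controls them near it. The condition is used in the
linearised form `A (ℓ r + exp (-ℓ))` for all `ℓ ≥ 1`, which Gronwall's lemma accepts directly. On a
time interval of length `1 / (2A)` the growth factor is at most `exp (ℓ / 2)`, so the error `exp
(-ℓ)` stays small. Iterating over such intervals gives stability under small errors, uniqueness, and
Hölder dependence on the data.

Existence is Lagrangian. If `q t` is the image of `q₀` under `η t`, then `u t x = ∫ K_h(x - η t y)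
dq₀(y)`, and the displacement `ξ = η - id` solves an autonomous equation `ξ' = F(ξ)` in the Banach
space of bounded continuous fields. The field `F` (`vortexField`) is bounded and log-Lipschitz for
the uniform norm, so Euler polygons converge (`exists_tendsto_eulerNode`) and the solution is
global. Euler steps are taken with smoothed divergence-free kernels: the Jacobian of a step is `1 +
τ tr D + τ² det D` with zero trace, so the area distortion is of second order and disappears in the
limit. Reversal of time makes the flow injective, and a measure preserving injection at bounded
distance from the identity is a homeomorphism.

Uniqueness needs that the weak equation forces `q t` to be the image of `q₀`
(`map_eq_of_weak_equation`). The natural test function `f ∘ (η t)⁻¹` is only Hölder continuous, so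
it is replaced by the average `g(t, x) = ∫ f(z) ρ_ε(x - η t z) dz`, which is of class `C¹`. Its
material derivative is `∫ f(z) ∇ρ_ε(x - η t z) · (u(t, x) - u(t, η t z)) dz`. Since `η t` preserves
area, a constant may be subtracted from `f` at no cost. With `ε = exp (-ℓ)`, the three factors are
then the oscillation of `f`, of order `ε ^ c`, the increment of `u`, of order `(ℓ + 1) ε`, and the
gradient of `ρ_ε`, of order `1 / ε`. The product `(ℓ + 1) exp (-c ℓ)` tends to `0`. Every weak
solution therefore solves the same equation `ξ' = F(ξ)`, whose solutions are unique. -/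

namespace EulerPoincare

open Set
open scoped BoundedContinuousFunction ZeroAtInfty

noncomputable section

/-! ### Log-Lipschitz maps -/

section LogLipschitz

variable {E G : Type*} [NormedAddCommGroup E] [NormedAddCommGroup G]

/-- A linearised form of the log-Lipschitz condition `‖F x - F y‖ ≲ r (1 + log⁻ r)`, `r = ‖x - y‖`. -/
def LogLip (A : ℝ) (F : E → G) : Prop :=
  ∀ ℓ : ℝ, 1 ≤ ℓ → ∀ x y, ‖F x - F y‖ ≤ A * (ℓ * ‖x - y‖ + Real.exp (-ℓ))

theorem LogLip.mono {A B : ℝ} {F : E → G} (h : LogLip A F) (hAB : A ≤ B) : LogLip B F := by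
  intro ℓ hℓ x y
  refine (h ℓ hℓ x y).trans ?_
  gcongr

/-- A fixed large `ℓ` makes the exponential term at most `κ / 2`, and what remains is a Lipschitz
bound. The modulus `δ` precedes `F`, so it serves whole families of fields. -/
theorem LogLip.uniform {A : ℝ} (hA : 0 < A) {κ : ℝ} (hκ : 0 < κ) :
    ∃ δ > 0, ∀ F : E → G, LogLip A F → ∀ x y, ‖x - y‖ ≤ δ → ‖F x - F y‖ ≤ κ := by
  have h1 : Tendsto (fun ℓ : ℝ => Real.exp (-ℓ)) atTop (𝓝 0) := Real.tendsto_exp_neg_atTop_nhds_zero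
  have hpos : 0 < κ / (2 * A) := by positivity
  obtain ⟨ℓ, hℓ, hℓ1⟩ := ((h1.eventually (gt_mem_nhds hpos)).and (eventually_ge_atTop 1)).exists
  have hℓ0 : 0 < ℓ := by linarith
  refine ⟨κ / (2 * A * ℓ), by positivity, fun F hF x y hxy => (hF ℓ hℓ1 x y).trans ?_⟩
  calc A * (ℓ * ‖x - y‖ + Real.exp (-ℓ)) ≤ A * (ℓ * (κ / (2 * A * ℓ)) + κ / (2 * A)) := by gcongr
    _ = κ := by field_simp; ring

theorem LogLip.uniformContinuous {A : ℝ} (hA : 0 < A) {F : E → G} (h : LogLip A F) :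
    UniformContinuous F := by
  rw [Metric.uniformContinuous_iff]
  intro κ hκ
  obtain ⟨δ, hδ, H⟩ := LogLip.uniform (E := E) (G := G) hA (half_pos hκ)
  refine ⟨δ, hδ, fun x y hxy => ?_⟩
  rw [dist_eq_norm] at hxy ⊢
  linarith [H F h x y hxy.le]

end LogLipschitz

/-! ### Stability of trajectories of log-Lipschitz fields -/

section ODE

variable {E : Type*} [NormedAddCommGroup E] [NormedSpace ℝ E]

/-- `f` solves `f' = v t f` on `[0, T]` up to an error `ε`. -/
structure IsApproxTrajectory (v : ℝ → E → E) (ε T : ℝ) (f : ℝ → E) : Prop where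
  continuousOn : ContinuousOn f (Icc 0 T)
  deriv : ∀ t ∈ Ico 0 T, ∃ f' : E, HasDerivWithinAt f f' (Ici t) t ∧ ‖f' - v t (f t)‖ ≤ ε

theorem IsApproxTrajectory.mono {v : ℝ → E → E} {ε ε' T T' : ℝ} {f : ℝ → E}
    (h : IsApproxTrajectory v ε T f) (hε : ε ≤ ε') (hT : T' ≤ T) :
    IsApproxTrajectory v ε' T' f where
  continuousOn := h.continuousOn.mono (Icc_subset_Icc_right hT)
  deriv t ht := by
    obtain ⟨f', h1, h2⟩ := h.deriv t ⟨ht.1, ht.2.trans_le hT⟩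
    exact ⟨f', h1, h2.trans hε⟩

theorem isApproxTrajectory_of_hasDerivAt {v : ℝ → E → E} {T : ℝ} {f : ℝ → E}
    (h : ∀ t ∈ Icc 0 T, HasDerivAt f (v t (f t)) t) : IsApproxTrajectory v 0 T f where
  continuousOn t ht := (h t ht).continuousAt.continuousWithinAt
  deriv t ht := ⟨_, (h t ⟨ht.1, ht.2.le⟩).hasDerivWithinAt, by simp⟩

/-- Gronwall's lemma with rate `A ℓ` and forcing `A exp (-ℓ) + 2 ε`. Over a time at most `1 / (2A)`
the growth factor is at most `exp (ℓ / 2)`, so only half of the decay `exp (-ℓ)` is lost. -/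
theorem IsApproxTrajectory.norm_sub_le_short {v : ℝ → E → E} {ε T A : ℝ} {f g : ℝ → E} (hA : 0 < A)
    (hε : 0 ≤ ε)
    (hv : ∀ t ∈ Ico 0 T, LogLip A (v t)) (hf : IsApproxTrajectory v ε T f)
    (hg : IsApproxTrajectory v ε T g) {a b : ℝ} (ha : 0 ≤ a) (hb : b ≤ T)
    (hab : A * (b - a) ≤ 1 / 2) {ℓ : ℝ} (hℓ : 1 ≤ ℓ) {t : ℝ} (ht : t ∈ Icc a b) :
    ‖f t - g t‖ ≤ (‖f a - g a‖ + 2 * ε / A) * Real.exp (ℓ / 2) + Real.exp (-ℓ / 2) := by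
  have hsub : Icc a b ⊆ Icc 0 T := Icc_subset_Icc ha hb
  have hsub' : ∀ s ∈ Ico a b, s ∈ Ico 0 T := fun s hs => ⟨ha.trans hs.1, hs.2.trans_le hb⟩
  choose! f' hf1 hf2 using hf.deriv
  choose! g' hg1 hg2 using hg.deriv
  have key := norm_le_gronwallBound_of_norm_deriv_right_le (f := fun t => f t - g t)
    (f' := fun t => f' t - g' t) (δ := ‖f a - g a‖) (K := A * ℓ)
    (ε := A * Real.exp (-ℓ) + 2 * ε) (a := a) (b := b)
    ((hf.continuousOn.mono hsub).sub (hg.continuousOn.mono hsub))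
    (fun s hs => (hf1 s (hsub' s hs)).sub (hg1 s (hsub' s hs))) le_rfl
    (fun s hs => by
      have h1 := hv s (hsub' s hs) ℓ hℓ (f s) (g s)
      have h2 : f' s - g' s = (f' s - v s (f s)) - (g' s - v s (g s)) + (v s (f s) - v s (g s)) := by
        abel
      have h3 : ‖f' s - g' s‖ ≤ ‖f' s - v s (f s)‖ + ‖g' s - v s (g s)‖ + ‖v s (f s) - v s (g s)‖ := by
        rw [h2]; exact (norm_add_le _ _).trans (by gcongr; exact norm_sub_le _ _)
      have h4 := hf2 s (hsub' s hs)
      have h5 := hg2 s (hsub' s hs)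
      calc ‖f' s - g' s‖ ≤ ε + ε + A * (ℓ * ‖f s - g s‖ + Real.exp (-ℓ)) := h3.trans (by gcongr)
        _ = _ := by ring) t ht
  have hℓ0 : 0 < ℓ := by linarith
  have hAℓ : A * ℓ ≠ 0 := by positivity
  rw [gronwallBound_of_K_ne_0 hAℓ] at key
  have hexp : Real.exp (A * ℓ * (t - a)) ≤ Real.exp (ℓ / 2) := by
    apply Real.exp_le_exp.mpr
    have : A * (t - a) ≤ 1 / 2 := le_trans (by gcongr; exact ht.2) hab
    nlinarith
  have hq : (A * Real.exp (-ℓ) + 2 * ε) / (A * ℓ) ≤ Real.exp (-ℓ) + 2 * ε / A := by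
    have h6 : (A * Real.exp (-ℓ) + 2 * ε) / (A * ℓ) ≤ (A * Real.exp (-ℓ) + 2 * ε) / (A * 1) := by
      gcongr
    refine h6.trans (le_of_eq ?_)
    field_simp
  have hm : Real.exp (-ℓ) * Real.exp (ℓ / 2) = Real.exp (-ℓ / 2) := by
    rw [← Real.exp_add]; ring_nf
  calc ‖f t - g t‖ ≤ ‖f a - g a‖ * Real.exp (A * ℓ * (t - a)) +
        (A * Real.exp (-ℓ) + 2 * ε) / (A * ℓ) * (Real.exp (A * ℓ * (t - a)) - 1) := key
    _ ≤ ‖f a - g a‖ * Real.exp (ℓ / 2) + (Real.exp (-ℓ) + 2 * ε / A) * Real.exp (ℓ / 2) := by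
        have : Real.exp (A * ℓ * (t - a)) - 1 ≤ Real.exp (ℓ / 2) := by linarith
        have h0 : 0 ≤ (A * Real.exp (-ℓ) + 2 * ε) / (A * ℓ) := by positivity
        have h1 : 0 ≤ Real.exp (A * ℓ * (t - a)) - 1 := by
          rw [sub_nonneg, Real.one_le_exp_iff]
          exact mul_nonneg (by positivity) (by linarith [ht.1])
        gcongr
    _ = _ := by rw [add_mul, hm]; ring

/-- Induction over intervals of length `1 / (2A)`: `ℓ` is fixed first from the target `κ`, then the
previous interval is asked for an accuracy that survives the amplification by `exp (ℓ / 2)`. The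
resulting `δ` does not depend on the field, which is what the convergence of approximation schemes
needs. -/
theorem exists_delta_norm_sub_le {A : ℝ} (hA : 0 < A) (T : ℝ) {κ : ℝ} (hκ : 0 < κ) :
    ∃ δ > 0, ∀ (v : ℝ → E → E), (∀ t ∈ Ico 0 T, LogLip A (v t)) → ∀ f g : ℝ → E,
      IsApproxTrajectory v δ T f → IsApproxTrajectory v δ T g → ‖f 0 - g 0‖ ≤ δ →
      ∀ t ∈ Icc 0 T, ‖f t - g t‖ ≤ κ := by
  have main : ∀ k : ℕ, ∀ κ : ℝ, 0 < κ → ∃ δ > 0, ∀ (v : ℝ → E → E),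
      (∀ t ∈ Ico 0 T, LogLip A (v t)) → ∀ f g : ℝ → E,
      IsApproxTrajectory v δ T f → IsApproxTrajectory v δ T g → ‖f 0 - g 0‖ ≤ δ →
      ∀ t ∈ Icc 0 T, t ≤ k / (2 * A) → ‖f t - g t‖ ≤ κ := by
    intro k
    induction k with
    | zero =>
      intro κ hκ
      refine ⟨κ, hκ, fun v _ f g _ _ h0 t ht htk => ?_⟩
      have : t = 0 := le_antisymm (by simpa using htk) ht.1
      rwa [this]
    | succ k ih =>
      intro κ hκ
      have h1 : Tendsto (fun ℓ : ℝ => Real.exp (-ℓ / 2)) atTop (𝓝 0) := by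
        have := Real.tendsto_exp_neg_atTop_nhds_zero.comp
          (tendsto_id.atTop_div_const (show (0 : ℝ) < 2 by norm_num))
        refine this.congr fun x => ?_
        simp [neg_div]
      obtain ⟨ℓ, hℓ, hℓ1⟩ :=
        ((h1.eventually (gt_mem_nhds (half_pos hκ))).and (eventually_ge_atTop 1)).exists
      have he : Real.exp (-ℓ / 2) * Real.exp (ℓ / 2) = 1 := by
        rw [← Real.exp_add]; simp [neg_div]
      have he1 : Real.exp (-ℓ / 2) ≤ 1 := Real.exp_le_one_iff.mpr (by linarith)
      -- After amplification by `exp (ℓ / 2)`, the old discrepancy and the errors of the two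
      -- trajectories contribute `κ / 4` each; the term `exp (-ℓ / 2)` contributes at most `κ / 2`.
      obtain ⟨δ, hδ, H⟩ := ih (κ * Real.exp (-ℓ / 2) / 4) (by positivity)
      set δ' := min δ (A * κ * Real.exp (-ℓ / 2) / 8) with hδ'
      have hδ'0 : 0 < δ' := lt_min hδ (by positivity)
      refine ⟨δ', hδ'0, fun v hv f g hf hg h0 t ht htk => ?_⟩
      have IH := H v hv f g (hf.mono (min_le_left _ _) le_rfl) (hg.mono (min_le_left _ _) le_rfl)
        (h0.trans (min_le_left _ _))
      by_cases hc : t ≤ k / (2 * A)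
      · refine (IH t ht hc).trans ?_
        nlinarith
      · push Not at hc
        have ha : (0 : ℝ) ≤ k / (2 * A) := by positivity
        have := hf.norm_sub_le_short hA hδ'0.le hv hg ha ht.2 (b := t) (by
          push_cast at htk
          have h3 : t - k / (2 * A) ≤ 1 / (2 * A) := by
            rw [add_div] at htk; linarith
          calc A * (t - k / (2 * A)) ≤ A * (1 / (2 * A)) := by gcongr
            _ = 1 / 2 := by field_simp) hℓ1 (t := t) ⟨hc.le, le_rfl⟩
        have h2 := IH (k / (2 * A)) ⟨ha, hc.le.trans ht.2⟩ le_rfl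
        have h3 : 2 * δ' / A ≤ κ * Real.exp (-ℓ / 2) / 4 := by
          rw [div_le_iff₀ hA]
          have := min_le_right δ (A * κ * Real.exp (-ℓ / 2) / 8)
          rw [← hδ'] at this
          linarith
        calc ‖f t - g t‖ ≤ _ := this
          _ ≤ (κ * Real.exp (-ℓ / 2) / 4 + κ * Real.exp (-ℓ / 2) / 4) * Real.exp (ℓ / 2) + κ / 2 := by
              gcongr
          _ = κ / 2 * (Real.exp (-ℓ / 2) * Real.exp (ℓ / 2)) + κ / 2 := by ring
          _ = κ := by rw [he]; ring
  obtain ⟨k, hk⟩ := exists_nat_ge (T * (2 * A))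
  obtain ⟨δ, hδ, H⟩ := main k κ hκ
  refine ⟨δ, hδ, fun v hv f g hf hg h0 t ht => H v hv f g hf hg h0 t ht (ht.2.trans ?_)⟩
  rw [le_div_iff₀ (by positivity)]
  exact hk

theorem eqOn_of_trajectories {A : ℝ} (hA : 0 < A) {T : ℝ} {v : ℝ → E → E}
    (hv : ∀ t ∈ Ico 0 T, LogLip A (v t)) {f g : ℝ → E} (hf : IsApproxTrajectory v 0 T f)
    (hg : IsApproxTrajectory v 0 T g) (h0 : f 0 = g 0) {t : ℝ} (ht : t ∈ Icc 0 T) : f t = g t := by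
  rw [← sub_eq_zero, ← norm_le_zero_iff]
  refine le_of_forall_pos_le_add fun κ hκ => ?_
  obtain ⟨δ, hδ, H⟩ := exists_delta_norm_sub_le (E := E) hA T hκ
  simpa using H v hv f g (hf.mono hδ.le le_rfl) (hg.mono hδ.le le_rfl) (by simp [h0, hδ.le]) t ht

/-- Trajectories of a log-Lipschitz field depend Hölder continuously on their initial values. -/
theorem exists_holder_norm_sub_le {A : ℝ} (hA : 0 < A) (T : ℝ) :
    ∃ C > 0, ∃ c > 0, ∀ (v : ℝ → E → E), (∀ t ∈ Ico 0 T, LogLip A (v t)) → ∀ f g : ℝ → E,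
      IsApproxTrajectory v 0 T f → IsApproxTrajectory v 0 T g → ∀ ℓ : ℝ, 1 ≤ ℓ →
      ‖f 0 - g 0‖ ≤ Real.exp (-ℓ) → ∀ t ∈ Icc 0 T, ‖f t - g t‖ ≤ C * Real.exp (-(c * ℓ)) := by
  have main : ∀ k : ℕ, ∃ C > 0, ∃ c > 0, ∀ (v : ℝ → E → E), (∀ t ∈ Ico 0 T, LogLip A (v t)) →
      ∀ f g : ℝ → E, IsApproxTrajectory v 0 T f → IsApproxTrajectory v 0 T g → ∀ ℓ : ℝ, 1 ≤ ℓ →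
      ‖f 0 - g 0‖ ≤ Real.exp (-ℓ) → ∀ t ∈ Icc 0 T, t ≤ k / (2 * A) →
      ‖f t - g t‖ ≤ C * Real.exp (-(c * ℓ)) := by
    intro k
    induction k with
    | zero =>
      refine ⟨1, one_pos, 1, one_pos, fun v _ f g _ _ ℓ _ h0 t ht htk => ?_⟩
      have : t = 0 := le_antisymm (by simpa using htk) ht.1
      rw [this]; simpa using h0
    | succ k ih =>
      obtain ⟨C, hC, c, hc, H⟩ := ih
      refine ⟨C * Real.exp (1 / 2) + 1 + C, by positivity, c / 2, by positivity,
        fun v hv f g hf hg ℓ hℓ h0 t ht htk => ?_⟩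
      have IH := H v hv f g hf hg ℓ hℓ h0
      have hle : Real.exp (-(c * ℓ)) ≤ Real.exp (-(c / 2 * ℓ)) := by
        apply Real.exp_le_exp.mpr
        nlinarith [mul_pos hc (by linarith : 0 < ℓ)]
      by_cases hcase : t ≤ k / (2 * A)
      · refine (IH t ht hcase).trans ?_
        calc C * Real.exp (-(c * ℓ)) ≤ C * Real.exp (-(c / 2 * ℓ)) := by gcongr
          _ ≤ _ := by gcongr; nlinarith [Real.exp_pos (1 / 2)]
      · push Not at hcase
        have ha : (0 : ℝ) ≤ k / (2 * A) := by positivity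
        -- The short-time bound is used at level `1 + c ℓ`, admissible because it is at least `1`.
        -- The discrepancy `exp (-c ℓ)` becomes `exp (1 / 2) exp (-c ℓ / 2)`, so the Hölder exponent
        -- halves on each interval.
        have hs := hf.norm_sub_le_short hA le_rfl hv hg ha ht.2 (b := t) (by
          push_cast at htk
          have h3 : t - k / (2 * A) ≤ 1 / (2 * A) := by
            rw [add_div] at htk; linarith
          calc A * (t - k / (2 * A)) ≤ A * (1 / (2 * A)) := by gcongr
            _ = 1 / 2 := by field_simp) (ℓ := 1 + c * ℓ)
            (by nlinarith [mul_pos hc (by linarith : 0 < ℓ)]) (t := t) ⟨hcase.le, le_rfl⟩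
        have h2 := IH (k / (2 * A)) ⟨ha, hcase.le.trans ht.2⟩ le_rfl
        have e1 : Real.exp (-(c * ℓ)) * Real.exp ((1 + c * ℓ) / 2) =
            Real.exp (1 / 2) * Real.exp (-(c / 2 * ℓ)) := by
          rw [← Real.exp_add, ← Real.exp_add]; ring_nf
        have e2 : Real.exp (-(1 + c * ℓ) / 2) ≤ Real.exp (-(c / 2 * ℓ)) :=
          Real.exp_le_exp.mpr (by linarith)
        calc ‖f t - g t‖ ≤ _ := hs
          _ ≤ C * Real.exp (-(c * ℓ)) * Real.exp ((1 + c * ℓ) / 2) + Real.exp (-(c / 2 * ℓ)) := by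
              simp only [mul_zero, zero_div, add_zero]
              gcongr
          _ = (C * Real.exp (1 / 2) + 1) * Real.exp (-(c / 2 * ℓ)) := by
              rw [mul_assoc, e1]; ring
          _ ≤ _ := mul_le_mul_of_nonneg_right (by linarith) (Real.exp_pos _).le
  obtain ⟨k, hk⟩ := exists_nat_ge (T * (2 * A))
  obtain ⟨C, hC, c, hc, H⟩ := main k
  refine ⟨C, hC, c, hc, fun v hv f g hf hg ℓ hℓ h0 t ht => H v hv f g hf hg ℓ hℓ h0 t ht (ht.2.trans ?_)⟩
  rw [le_div_iff₀ (by positivity)]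
  exact hk

end ODE

/-! ### Convergence of the explicit Euler scheme in a Banach space -/

section Euler

variable {E : Type*} [NormedAddCommGroup E] [NormedSpace ℝ E]

/-- The nodes of the explicit Euler scheme of step `τ`. -/
def eulerNode (G : E → E) (τ : ℝ) (x₀ : E) : ℕ → E
  | 0 => x₀
  | n + 1 => eulerNode G τ x₀ n + τ • G (eulerNode G τ x₀ n)

/-- The piecewise constant velocity of the Euler scheme. -/
def eulerVelocity (G : E → E) (τ : ℝ) (x₀ : E) (t : ℝ) : E :=
  G (eulerNode G τ x₀ ⌊t / τ⌋.toNat)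

/-- The Euler polygon. -/
def eulerPath (G : E → E) (τ : ℝ) (x₀ : E) (t : ℝ) : E :=
  x₀ + ∫ r in (0 : ℝ)..t, eulerVelocity G τ x₀ r

/-- The velocity factors through the integer `⌊t / τ⌋`, so its range is countable. This gives strong
measurability even when `E` is not separable, as for bounded continuous fields, and needs no
regularity of `G`. -/
theorem stronglyMeasurable_eulerVelocity (G : E → E) (τ : ℝ) (x₀ : E) :
    StronglyMeasurable (eulerVelocity G τ x₀) := by
  have h : StronglyMeasurable fun n : ℤ => G (eulerNode G τ x₀ n.toNat) :=
    StronglyMeasurable.of_discrete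
  exact h.comp_measurable (Int.measurable_floor.comp (measurable_id.div_const τ))

variable {G : E → E} {τ M : ℝ} {x₀ : E}

theorem intervalIntegrable_eulerVelocity (hM : ∀ x, ‖G x‖ ≤ M) (a b : ℝ) :
    IntervalIntegrable (eulerVelocity G τ x₀) volume a b := by
  refine (intervalIntegrable_const (c := M)).mono_fun
    (stronglyMeasurable_eulerVelocity G τ x₀).aestronglyMeasurable ?_
  refine Eventually.of_forall fun x => ?_
  exact (hM _).trans (le_abs_self M)

theorem norm_eulerPath_sub_le (hM : ∀ x, ‖G x‖ ≤ M) (s t : ℝ) :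
    ‖eulerPath G τ x₀ t - eulerPath G τ x₀ s‖ ≤ M * |t - s| := by
  have : eulerPath G τ x₀ t - eulerPath G τ x₀ s = ∫ r in s..t, eulerVelocity G τ x₀ r := by
    rw [eulerPath, eulerPath, add_sub_add_left_eq_sub, intervalIntegral.integral_interval_sub_left
      (intervalIntegrable_eulerVelocity hM _ _) (intervalIntegrable_eulerVelocity hM _ _)]
  rw [this]
  exact intervalIntegral.norm_integral_le_of_norm_le_const fun x _ => hM _

theorem eulerPath_node [CompleteSpace E] (hτ : 0 < τ) (hM : ∀ x, ‖G x‖ ≤ M) (n : ℕ) :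
    eulerPath G τ x₀ (n * τ) = eulerNode G τ x₀ n := by
  induction n with
  | zero => simp [eulerPath, eulerNode]
  | succ n ih =>
    have h1 : eulerPath G τ x₀ ((n + 1 : ℕ) * τ) - eulerPath G τ x₀ (n * τ) =
        ∫ r in (n * τ)..((n + 1 : ℕ) * τ), eulerVelocity G τ x₀ r := by
      rw [eulerPath, eulerPath, add_sub_add_left_eq_sub,
        intervalIntegral.integral_interval_sub_left
        (intervalIntegrable_eulerVelocity hM _ _) (intervalIntegrable_eulerVelocity hM _ _)]
    have h2 : ∫ r in (n * τ)..((n + 1 : ℕ) * τ), eulerVelocity G τ x₀ r =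
        ∫ r in (n * τ)..((n + 1 : ℕ) * τ), G (eulerNode G τ x₀ n) := by
      apply intervalIntegral.integral_congr_ae
      -- At the right endpoint the floor has already jumped to the next node; this single point is
      -- negligible.
      have : ∀ᵐ r : ℝ, r ≠ (n + 1 : ℕ) * τ := by simp [ae_iff]
      filter_upwards [this] with r hr hr'
      rw [uIoc_of_le (by push_cast; nlinarith)] at hr'
      have hlt : r < (n + 1 : ℕ) * τ := lt_of_le_of_ne hr'.2 hr
      have hfl : ⌊r / τ⌋ = (n : ℤ) := by
        rw [Int.floor_eq_iff]
        constructor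
        · rw [le_div_iff₀ hτ]; simpa using hr'.1.le
        · rw [div_lt_iff₀ hτ]; simpa using hlt
      simp [eulerVelocity, hfl]
    rw [h2, intervalIntegral.integral_const, ih] at h1
    rw [sub_eq_iff_eq_add'] at h1
    rw [h1, eulerNode]
    congr 2
    push_cast; ring

theorem norm_eulerPath_sub_node_le [CompleteSpace E] (hτ : 0 < τ) (hM : ∀ x, ‖G x‖ ≤ M) {t : ℝ}
    (ht : 0 ≤ t) :
    ‖eulerPath G τ x₀ t - eulerNode G τ x₀ ⌊t / τ⌋.toNat‖ ≤ M * τ := by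
  rw [← eulerPath_node hτ hM]
  refine (norm_eulerPath_sub_le hM _ _).trans ?_
  have hM0 : 0 ≤ M := (norm_nonneg _).trans (hM 0)
  gcongr
  have h0 : (0 : ℤ) ≤ ⌊t / τ⌋ := Int.floor_nonneg.mpr (by positivity)
  have h1 : ((⌊t / τ⌋.toNat : ℕ) : ℝ) = (⌊t / τ⌋ : ℝ) := by
    exact_mod_cast Int.toNat_of_nonneg h0
  rw [h1]
  have h2 := Int.floor_le (t / τ)
  have h3 := Int.lt_floor_add_one (t / τ)
  rw [le_div_iff₀ hτ] at h2
  rw [div_lt_iff₀ hτ] at h3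
  rw [abs_le]; constructor <;> linarith

/-- The floor is right-continuous, hence so is the velocity. At the nodes only the right derivative
is available, and Gronwall's lemma asks for no more. -/
theorem hasDerivWithinAt_eulerPath [CompleteSpace E] (hτ : 0 < τ) (hM : ∀ x, ‖G x‖ ≤ M) (t : ℝ) :
    HasDerivWithinAt (eulerPath G τ x₀) (eulerVelocity G τ x₀ t) (Ici t) t := by
  have hc : ContinuousWithinAt (eulerVelocity G τ x₀) (Ioi t) t := by
    have h1 : Tendsto (fun r => r / τ) (𝓝[>] t) (𝓝[≥] (t / τ)) := by
      refine tendsto_nhdsWithin_iff.mpr ⟨?_, ?_⟩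
      · exact ((continuous_id.div_const τ).tendsto t).mono_left nhdsWithin_le_nhds
      · filter_upwards [self_mem_nhdsWithin] with r hr
        exact div_le_div_of_nonneg_right (le_of_lt hr) hτ.le
    have h2 := (tendsto_floor_right_pure_floor (t / τ)).comp h1
    rw [tendsto_pure] at h2
    refine tendsto_const_nhds.congr' ?_
    filter_upwards [h2] with r hr
    simp only [Function.comp] at hr
    simp [eulerVelocity, hr]
  exact (intervalIntegral.integral_hasDerivWithinAt_right (intervalIntegrable_eulerVelocity hM _ _)
    ((stronglyMeasurable_eulerVelocity G τ x₀).stronglyMeasurableAtFilter) hc).const_add x₀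

/-- The Euler schemes of uniform approximations `G j` of a bounded log-Lipschitz field `F` converge
to a trajectory of `F`. -/
theorem exists_tendsto_eulerNode [CompleteSpace E] {F : E → E} {A : ℝ} (hA : 0 < A)
    (hF : LogLip A F) {G : ℕ → E → E} {τ δ : ℕ → ℝ}
    (hM : ∀ j x, ‖G j x‖ ≤ M) (hτ : ∀ j, 0 < τ j) (hτ0 : Tendsto τ atTop (𝓝 0))
    (hG : ∀ j x, ‖G j x - F x‖ ≤ δ j) (hδ : Tendsto δ atTop (𝓝 0)) (x₀ : E) :
    ∃ p : ℝ → E, p 0 = x₀ ∧ (∀ t, 0 ≤ t → HasDerivAt p (F (p t)) t) ∧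
      ∀ t, 0 ≤ t → Tendsto (fun j => eulerNode (G j) (τ j) x₀ ⌊t / τ j⌋.toNat) atTop (𝓝 (p t)) := by
  have hM0 : 0 ≤ M := (norm_nonneg _).trans (hM 0 0)
  have hFc : Continuous F := (hF.uniformContinuous hA).continuous
  have hMτ : Tendsto (fun j => M * τ j) atTop (𝓝 0) := by simpa using hτ0.const_mul M
  have hFM : ∀ x, ‖F x‖ ≤ M := fun x => by
    have h1 : Tendsto (fun j => M + δ j) atTop (𝓝 (M + 0)) := hδ.const_add M
    rw [add_zero] at h1
    refine ge_of_tendsto' h1 fun j => ?_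
    calc ‖F x‖ = ‖G j x - (G j x - F x)‖ := by congr 1; abel
      _ ≤ ‖G j x‖ + ‖G j x - F x‖ := norm_sub_le _ _
      _ ≤ _ := add_le_add (hM j x) (hG j x)
  -- The error of the polygon has two parts: the distance of `G j` from `F` at the last node, and
  -- the oscillation of `F` over the distance at most `M τ j` from that node.
  have happ : ∀ T : ℝ, ∀ ε > 0, ∀ᶠ j in atTop,
      IsApproxTrajectory (fun _ => F) ε T (eulerPath (G j) (τ j) x₀) := by
    intro T ε hε
    obtain ⟨d, hd, H⟩ := LogLip.uniform (E := E) (G := E) hA (half_pos hε)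
    filter_upwards [hMτ.eventually (ge_mem_nhds hd), hδ.eventually (ge_mem_nhds (half_pos hε))]
      with j hj1 hj2
    refine ⟨?_, fun t ht => ⟨_, hasDerivWithinAt_eulerPath (hτ j) (hM j) t, ?_⟩⟩
    · refine Continuous.continuousOn ?_
      exact continuous_const.add (intervalIntegral.continuous_primitive
        (intervalIntegrable_eulerVelocity (hM j)) 0)
    · set n := eulerNode (G j) (τ j) x₀ ⌊t / τ j⌋.toNat
      have h1 := (norm_eulerPath_sub_node_le (x₀ := x₀) (hτ j) (hM j) ht.1)
      rw [norm_sub_rev] at h1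
      have h2 := H F hF _ _ (h1.trans hj1)
      calc ‖G j n - F (eulerPath (G j) (τ j) x₀ t)‖
          = ‖(G j n - F n) + (F n - F (eulerPath (G j) (τ j) x₀ t))‖ := by congr 1; abel
        _ ≤ ε / 2 + ε / 2 := (norm_add_le _ _).trans (add_le_add ((hG j n).trans hj2) h2)
        _ = ε := by ring
  -- Two approximate trajectories with the same initial value are close by stability, so the
  -- polygons form a Cauchy sequence; no compactness is involved.
  have hcau : ∀ t, 0 ≤ t → ∃ y, Tendsto (fun j => eulerPath (G j) (τ j) x₀ t) atTop (𝓝 y) := by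
    intro t ht
    apply cauchySeq_tendsto_of_complete
    rw [Metric.cauchySeq_iff]
    intro κ hκ
    obtain ⟨d, hd, H⟩ := exists_delta_norm_sub_le (E := E) hA t (half_pos hκ)
    obtain ⟨N, hN⟩ := eventually_atTop.mp (happ t d hd)
    refine ⟨N, fun m hm n hn => ?_⟩
    rw [dist_eq_norm]
    have := H (fun _ => F) (fun _ _ => hF) _ _ (hN m hm) (hN n hn) (by simp [eulerPath, hd.le]) t
      ⟨ht, le_rfl⟩
    linarith
  choose! q hq using hcau
  set p : ℝ → E := fun t => q (max t 0) with hp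
  have hpl : ∀ t, 0 ≤ t → Tendsto (fun j => eulerPath (G j) (τ j) x₀ t) atTop (𝓝 (p t)) := by
    intro t ht
    simpa [hp, max_eq_left ht] using hq t ht
  have hplip : ∀ s t, ‖p t - p s‖ ≤ M * |t - s| := by
    intro s t
    have h1 := ((hq (max t 0) (le_max_right _ _)).sub (hq (max s 0) (le_max_right _ _))).norm
    refine (le_of_tendsto' h1 fun j => norm_eulerPath_sub_le (hM j) _ _).trans ?_
    exact mul_le_mul_of_nonneg_left (abs_max_sub_max_le_abs t s 0) hM0
  have hpc : Continuous p := by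
    refine (LipschitzWith.of_dist_le_mul (K := M.toNNReal) fun s t => ?_).continuous
    rw [dist_eq_norm, dist_eq_norm, Real.coe_toNNReal M hM0]
    exact hplip t s
  have hnode : ∀ t, 0 ≤ t →
      Tendsto (fun j => eulerNode (G j) (τ j) x₀ ⌊t / τ j⌋.toNat) atTop (𝓝 (p t)) := by
    intro t ht
    have h1 : Tendsto (fun j => eulerPath (G j) (τ j) x₀ t -
        eulerNode (G j) (τ j) x₀ ⌊t / τ j⌋.toNat) atTop (𝓝 0) :=
      squeeze_zero_norm (fun j => norm_eulerPath_sub_node_le (hτ j) (hM j) ht) hMτ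
    simpa using (hpl t ht).sub h1
  have hvel : ∀ t, 0 ≤ t →
      Tendsto (fun j => eulerVelocity (G j) (τ j) x₀ t) atTop (𝓝 (F (p t))) := by
    intro t ht
    have h1 := (hFc.tendsto _).comp (hnode t ht)
    have h2 : Tendsto (fun j => eulerVelocity (G j) (τ j) x₀ t -
        F (eulerNode (G j) (τ j) x₀ ⌊t / τ j⌋.toNat)) atTop (𝓝 0) :=
      squeeze_zero_norm (fun j => hG j _) hδ
    simpa using h2.add h1
  have hint : ∀ t, 0 ≤ t → p t = x₀ + ∫ r in (0 : ℝ)..t, F (p r) := by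
    intro t ht
    refine tendsto_nhds_unique (hpl t ht) (tendsto_const_nhds.add ?_)
    refine intervalIntegral.tendsto_integral_filter_of_dominated_convergence (fun _ => M)
      (Eventually.of_forall fun j =>
        (stronglyMeasurable_eulerVelocity _ _ _).aestronglyMeasurable)
      (Eventually.of_forall fun j => Eventually.of_forall fun r _ => hM j _)
      intervalIntegrable_const (Eventually.of_forall fun r hr => ?_)
    rw [uIoc_of_le ht] at hr
    exact hvel r hr.1.le
  -- The integral formula, not `p`, is the witness: `p` is constant for negative times, while the
  -- formula has a two-sided derivative at `0`.
  refine ⟨fun t => x₀ + ∫ r in (0 : ℝ)..t, F (p r), by simp, fun t ht => ?_, fun t ht => ?_⟩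
  · have h1 : HasDerivAt (fun t => x₀ + ∫ r in (0 : ℝ)..t, F (p r)) (F (p t)) t :=
      (intervalIntegral.integral_hasDerivAt_right ((hFc.comp hpc).intervalIntegrable _ _)
        (hFc.comp hpc).stronglyMeasurable.stronglyMeasurableAtFilter
        (hFc.comp hpc).continuousAt).const_add x₀
    simpa only [← hint t ht] using h1
  · simpa only [← hint t ht] using hnode t ht

end Euler

/-! ### Divergence-free fields and their averages -/

section DivFree

/-- The standard basis of the plane. -/
def basisVec (i : Fin 2) : Plane := EuclideanSpace.single i 1

/-- The trace of an endomorphism of the plane. -/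
def planeTrace (D : Plane →L[ℝ] Plane) : ℝ := D (basisVec 0) 0 + D (basisVec 1) 1

/-- Divergence-free fields, with differential bounded by `L`. -/
structure IsDivFree (L : ℝ) (k : Plane → Plane) : Prop where
  differentiable : Differentiable ℝ k
  norm_fderiv_le : ∀ x, ‖fderiv ℝ k x‖ ≤ L
  trace_eq_zero : ∀ x, planeTrace (fderiv ℝ k x) = 0

theorem IsDivFree.norm_sub_le {L : ℝ} {k : Plane → Plane} (hk : IsDivFree L k) (x y : Plane) :
    ‖k x - k y‖ ≤ L * ‖x - y‖ :=
  Convex.norm_image_sub_le_of_norm_fderiv_le (𝕜 := ℝ) (fun z _ => hk.differentiable z)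
    (fun z _ => hk.norm_fderiv_le z) convex_univ (mem_univ y) (mem_univ x)

theorem integral_planeTrace {Ω : Type*} [MeasurableSpace Ω] {μ : Measure Ω}
    {D : Ω → Plane →L[ℝ] Plane} (hD : Integrable D μ) :
    planeTrace (∫ a, D a ∂μ) = ∫ a, planeTrace (D a) ∂μ := by
  have h : ∀ i : Fin 2, Integrable (fun a => D a (basisVec i) i) μ := fun i =>
    (EuclideanSpace.proj (𝕜 := ℝ) i).integrable_comp (hD.apply_continuousLinearMap (basisVec i))
  have h2 : ∀ i : Fin 2, (∫ a, D a ∂μ) (basisVec i) i = ∫ a, D a (basisVec i) i ∂μ := fun i => by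
    rw [ContinuousLinearMap.integral_apply hD]
    exact ((EuclideanSpace.proj (𝕜 := ℝ) i).integral_comp_comm
      (hD.apply_continuousLinearMap (basisVec i))).symm
  simp only [planeTrace]
  rw [integral_add (h 0) (h 1), h2, h2]

theorem planeTrace_smul (c : ℝ) (D : Plane →L[ℝ] Plane) : planeTrace (c • D) = c * planeTrace D := by
  simp [planeTrace, mul_add]

/-- Weighted averages of translates of a bounded divergence-free field are divergence-free. -/
theorem IsDivFree.average {Ω : Type*} [MeasurableSpace Ω] {μ : Measure Ω} {L B : ℝ}
    {k : Plane → Plane} (hk : IsDivFree L k) (hB : ∀ x, ‖k x‖ ≤ B) {f : Ω → ℝ}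
    (hf : Integrable f μ) {p : Ω → Plane} (hp : AEMeasurable p μ) :
    IsDivFree (L * ∫ a, |f a| ∂μ) fun x => ∫ a, f a • k (x - p a) ∂μ := by
  have hm : ∀ x, AEStronglyMeasurable (fun a => f a • k (x - p a)) μ := fun x =>
    hf.aestronglyMeasurable.smul
      (hk.differentiable.continuous.measurable.comp_aemeasurable
        (hp.const_sub x)).aestronglyMeasurable
  have hm' : ∀ x, AEStronglyMeasurable (fun a => f a • fderiv ℝ k (x - p a)) μ := fun x =>
    hf.aestronglyMeasurable.smul ((measurable_fderiv ℝ k).comp_aemeasurable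
        (hp.const_sub x)).aestronglyMeasurable
  have hi : ∀ x, Integrable (fun a => f a • k (x - p a)) μ := fun x => by
    refine (hf.norm.mul_const B).mono' (hm x) (Eventually.of_forall fun a => ?_)
    rw [norm_smul]
    gcongr
    exact hB _
  have hi' : ∀ x, Integrable (fun a => f a • fderiv ℝ k (x - p a)) μ := fun x => by
    refine (hf.norm.mul_const L).mono' (hm' x) (Eventually.of_forall fun a => ?_)
    rw [norm_smul]
    gcongr
    exact hk.norm_fderiv_le _
  have hd : ∀ x, HasFDerivAt (fun x => ∫ a, f a • k (x - p a) ∂μ)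
      (∫ a, f a • fderiv ℝ k (x - p a) ∂μ) x := fun x => by
    refine hasFDerivAt_integral_of_dominated_of_fderiv_le (s := univ) univ_mem
      (F' := fun x a => f a • fderiv ℝ k (x - p a))
      (bound := fun a => ‖f a‖ * L)
      (Eventually.of_forall hm) (hi x) (hm' x) (Eventually.of_forall fun a y _ => ?_)
      (hf.norm.mul_const L) (Eventually.of_forall fun a y _ => ?_)
    · rw [norm_smul]
      gcongr
      exact hk.norm_fderiv_le _
    · have h1 : HasFDerivAt (fun y : Plane => y - p a) (ContinuousLinearMap.id ℝ Plane) y :=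
        (hasFDerivAt_id y).sub_const (p a)
      have h2 := ((hk.differentiable (y - p a)).hasFDerivAt.comp y h1).const_smul (f a)
      rw [ContinuousLinearMap.comp_id] at h2
      exact h2
  refine ⟨fun x => (hd x).differentiableAt, fun x => ?_, fun x => ?_⟩
  · rw [(hd x).fderiv, mul_comm, ← integral_mul_const]
    refine norm_integral_le_of_norm_le (hf.norm.mul_const L) (Eventually.of_forall fun a => ?_)
    rw [norm_smul]
    exact mul_le_mul_of_nonneg_left (hk.norm_fderiv_le _) (abs_nonneg _)
  · rw [(hd x).fderiv, integral_planeTrace (hi' x)]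
    simp [planeTrace_smul, hk.trace_eq_zero]

end DivFree

/-! ### The smoothed Biot-Savart kernel -/

section SmoothKernel

/-- `perp` as a continuous linear map. -/
def perpCLM : Plane →L[ℝ] Plane :=
  LinearMap.toContinuousLinearMap
    { toFun := perp
      map_add' := fun x y => by ext i; fin_cases i <;> simp [perp]; ring
      map_smul' := fun c x => by ext i; fin_cases i <;> simp [perp] }

theorem perpCLM_apply (x : Plane) : perpCLM x = perp x := rfl

theorem norm_perp (x : Plane) : ‖perp x‖ = ‖x‖ := by
  rw [EuclideanSpace.norm_eq, EuclideanSpace.norm_eq]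
  simp [perp, Fin.sum_univ_two, add_comm]

/-- The Biot-Savart kernel with its singularity smoothed at scale `ε`. -/
def smoothKernel (ε : ℝ) (x : Plane) : Plane := (-(1 / (2 * Real.pi)) / (‖x‖ ^ 2 + ε ^ 2)) • perp x

theorem inv_two_pi_le_one : 1 / (2 * Real.pi) ≤ 1 := by
  rw [div_le_one (by positivity)]
  linarith [Real.pi_gt_three]

theorem norm_neg_inv_two_pi : |-(1 / (2 * Real.pi))| = 1 / (2 * Real.pi) := by
  rw [abs_neg, abs_of_nonneg (by positivity)]

theorem norm_smoothKernel_le {ε : ℝ} (hε : 0 < ε) (x : Plane) : ‖smoothKernel ε x‖ ≤ 1 / ε := by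
  rw [smoothKernel, norm_smul, norm_perp, Real.norm_eq_abs, abs_div, norm_neg_inv_two_pi,
    abs_of_pos (by positivity : 0 < ‖x‖ ^ 2 + ε ^ 2)]
  calc 1 / (2 * Real.pi) / (‖x‖ ^ 2 + ε ^ 2) * ‖x‖ ≤ 1 / (‖x‖ ^ 2 + ε ^ 2) * ‖x‖ := by
        gcongr; exact inv_two_pi_le_one
    _ ≤ 1 / ε := by
        rw [one_div_mul_eq_div, div_le_div_iff₀ (by positivity) hε]
        nlinarith [sq_nonneg (‖x‖ - ε), norm_nonneg x]

/-- From `1/s - 1/(s + ε²) = ε² / (s (s + ε²))` with `s = |x|²`. The bound is radially decreasing,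
singular like `|x|⁻¹` and of decay `|x|⁻³`, hence integrable on the plane. -/
theorem norm_biotSavart_sub_smoothKernel_le {ε : ℝ} (hε : 0 < ε) (x : Plane) :
    ‖biotSavart x - smoothKernel ε x‖ ≤ ε ^ 2 / (‖x‖ * (‖x‖ ^ 2 + ε ^ 2)) := by
  rcases eq_or_ne ‖x‖ 0 with h | h
  · simp only [norm_eq_zero] at h
    have h0 : perp 0 = 0 := perpCLM.map_zero
    simp [h, biotSavart, smoothKernel, h0]
  have hx : 0 < ‖x‖ := lt_of_le_of_ne (norm_nonneg x) h.symm
  have h1 : -(1 / (2 * Real.pi)) / ‖x‖ ^ 2 - -(1 / (2 * Real.pi)) / (‖x‖ ^ 2 + ε ^ 2) =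
      -(1 / (2 * Real.pi)) * (ε ^ 2 / (‖x‖ ^ 2 * (‖x‖ ^ 2 + ε ^ 2))) := by
    have : ‖x‖ ^ 2 + ε ^ 2 ≠ 0 := by positivity
    have : Real.pi ≠ 0 := Real.pi_ne_zero
    field_simp
    ring
  rw [biotSavart, smoothKernel, ← sub_smul, h1, norm_smul, norm_perp, norm_mul, Real.norm_eq_abs,
    norm_neg_inv_two_pi, Real.norm_eq_abs,
    abs_of_nonneg (by positivity : 0 ≤ ε ^ 2 / (‖x‖ ^ 2 * (‖x‖ ^ 2 + ε ^ 2)))]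
  calc 1 / (2 * Real.pi) * (ε ^ 2 / (‖x‖ ^ 2 * (‖x‖ ^ 2 + ε ^ 2))) * ‖x‖
      ≤ 1 * (ε ^ 2 / (‖x‖ ^ 2 * (‖x‖ ^ 2 + ε ^ 2))) * ‖x‖ := by gcongr; exact inv_two_pi_le_one
    _ = ε ^ 2 / (‖x‖ * (‖x‖ ^ 2 + ε ^ 2)) := by field_simp

theorem measurable_biotSavart : Measurable biotSavart := by
  have h1 : Measurable fun x : Plane => -(1 / (2 * Real.pi)) / ‖x‖ ^ 2 := by fun_prop
  exact h1.smul (perpCLM.continuous.measurable)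

theorem continuous_smoothKernel {ε : ℝ} (hε : 0 < ε) : Continuous (smoothKernel ε) := by
  have h1 : Continuous fun x : Plane => -(1 / (2 * Real.pi)) / (‖x‖ ^ 2 + ε ^ 2) :=
    continuous_const.div (by fun_prop) fun x => by positivity
  exact h1.smul perpCLM.continuous

/-- The differential is a multiple of the rotation `perpCLM` plus a multiple of `⟨x, ·⟩ x^⊥`. Both
have zero trace, the second because `x^⊥` is orthogonal to `x`. They contribute `1 / ε²` and `2 /
ε²` to the norm. -/
theorem isDivFree_smoothKernel {ε : ℝ} (hε : 0 < ε) : IsDivFree (3 / ε ^ 2) (smoothKernel ε) := by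
  set c : ℝ := -(1 / (2 * Real.pi)) with hc
  have hc1 : |c| ≤ 1 := by rw [hc, norm_neg_inv_two_pi]; exact inv_two_pi_le_one
  have hd : ∀ x, HasFDerivAt (smoothKernel ε)
      ((c / (‖x‖ ^ 2 + ε ^ 2)) • perpCLM +
        ((-(c / (‖x‖ ^ 2 + ε ^ 2) ^ 2)) • (2 • innerSL ℝ x)).smulRight (perp x)) x := by
    intro x
    have hne : ‖x‖ ^ 2 + ε ^ 2 ≠ 0 := by positivity
    have h1 : HasFDerivAt (fun y : Plane => ‖y‖ ^ 2 + ε ^ 2) (2 • innerSL ℝ x) x :=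
      (hasStrictFDerivAt_norm_sq x).hasFDerivAt.add_const (ε ^ 2)
    have h2 : HasDerivAt (fun s : ℝ => c / s) (-(c / (‖x‖ ^ 2 + ε ^ 2) ^ 2)) (‖x‖ ^ 2 + ε ^ 2) := by
      have := (hasDerivAt_inv hne).const_mul c
      simpa [div_eq_mul_inv] using this
    have h3 := h2.comp_hasFDerivAt x h1
    exact h3.smul (perpCLM.hasFDerivAt (x := x))
  refine ⟨fun x => (hd x).differentiableAt, fun x => ?_, fun x => ?_⟩
  · rw [(hd x).fderiv]
    refine ContinuousLinearMap.opNorm_le_bound _ (by positivity) fun v => ?_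
    have hpos : 0 < ‖x‖ ^ 2 + ε ^ 2 := by positivity
    simp only [add_apply, smul_apply, ContinuousLinearMap.smulRight_apply,
      innerSL_apply_apply, perpCLM_apply]
    have e1 : ‖(c / (‖x‖ ^ 2 + ε ^ 2)) • perp v‖ ≤ 1 / ε ^ 2 * ‖v‖ := by
      rw [norm_smul, norm_perp, Real.norm_eq_abs, abs_div, abs_of_pos hpos]
      gcongr
      nlinarith [sq_nonneg ‖x‖]
    have e2 : ‖((-(c / (‖x‖ ^ 2 + ε ^ 2) ^ 2)) • (2 • inner ℝ x v)) • perp x‖ ≤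
        2 / ε ^ 2 * ‖v‖ := by
      rw [norm_smul, norm_perp, norm_smul, norm_neg, Real.norm_eq_abs, abs_div,
        abs_of_pos (by positivity : 0 < (‖x‖ ^ 2 + ε ^ 2) ^ 2)]
      have e3 : ‖2 • inner ℝ x v‖ ≤ 2 * (‖x‖ * ‖v‖) := by
        rw [nsmul_eq_mul, norm_mul]
        have := norm_inner_le_norm (𝕜 := ℝ) x v
        simpa using this
      calc |c| / (‖x‖ ^ 2 + ε ^ 2) ^ 2 * ‖2 • inner ℝ x v‖ * ‖x‖
          ≤ 1 / (‖x‖ ^ 2 + ε ^ 2) ^ 2 * (2 * (‖x‖ * ‖v‖)) * ‖x‖ := by gcongr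
        _ = 2 * (‖x‖ ^ 2 / (‖x‖ ^ 2 + ε ^ 2) ^ 2) * ‖v‖ := by ring
        _ ≤ 2 * (1 / ε ^ 2) * ‖v‖ := by
            have e4 : ‖x‖ ^ 2 / (‖x‖ ^ 2 + ε ^ 2) ^ 2 ≤ 1 / ε ^ 2 := by
              rw [div_le_div_iff₀ (by positivity) (by positivity)]
              nlinarith [mul_nonneg (sq_nonneg ‖x‖) (sq_nonneg ε), sq_nonneg (‖x‖ ^ 2),
                sq_nonneg (ε ^ 2)]
            exact mul_le_mul_of_nonneg_right (mul_le_mul_of_nonneg_left e4 zero_le_two)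
              (norm_nonneg v)
        _ = _ := by ring
    calc _ ≤ _ := norm_add_le _ _
      _ ≤ 1 / ε ^ 2 * ‖v‖ + 2 / ε ^ 2 * ‖v‖ := add_le_add e1 e2
      _ = _ := by ring
  · rw [(hd x).fderiv]
    simp [planeTrace, basisVec, perpCLM_apply, perp, PiLp.inner_apply]
    ring

end SmoothKernel

/-! ### Radial integrals and convolutions of radial profiles -/

section Radial

/-- The length of the unit circle. -/
def circleLength : ℝ := 2 * volume.real (Metric.ball (0 : Plane) 1)

theorem circleLength_nonneg : 0 ≤ circleLength := by unfold circleLength; positivity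

theorem integrable_radial {f : ℝ → ℝ} (hf : IntegrableOn (fun ρ => ρ * f ρ) (Ioi 0)) :
    Integrable (fun x : Plane => f ‖x‖) := by
  rw [integrable_fun_norm_addHaar (volume : Measure Plane) (f := f)]
  simpa using hf

theorem integral_radial (f : ℝ → ℝ) :
    ∫ x : Plane, f ‖x‖ = circleLength * ∫ ρ in Ioi (0 : ℝ), ρ * f ρ := by
  rw [integral_fun_norm_addHaar (volume : Measure Plane) f]
  simp [circleLength]
  ring

/-- A rearrangement estimate for the convolution of two radially decreasing functions. -/
theorem integral_antitone_mul_le {a b H : ℝ → ℝ} (ha : AntitoneOn a (Ioi 0))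
    (hb : AntitoneOn b (Ioi 0)) (ha0 : ∀ ρ, 0 < ρ → 0 ≤ a ρ) (hb0 : ∀ ρ, 0 < ρ → 0 ≤ b ρ)
    (ham : Measurable a) (hbm : Measurable b) (hH : IntegrableOn H (Ioi 0))
    (hle : ∀ ρ, 0 < ρ → ρ * (a ρ * b ρ) ≤ H ρ) (x : Plane) :
    Integrable (fun w : Plane => a ‖x - w‖ * b ‖w‖) ∧
      ∫ w : Plane, a ‖x - w‖ * b ‖w‖ ≤ 2 * circleLength * ∫ ρ in Ioi (0 : ℝ), H ρ := by
  have h1 : IntegrableOn (fun ρ => ρ * (a ρ * b ρ)) (Ioi 0) := by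
    refine Integrable.mono' hH (by fun_prop) ?_
    filter_upwards [ae_restrict_mem measurableSet_Ioi] with ρ hρ
    have hρ' : 0 < ρ := hρ
    rw [Real.norm_of_nonneg (mul_nonneg hρ'.le (mul_nonneg (ha0 ρ hρ') (hb0 ρ hρ')))]
    exact hle ρ hρ'
  have h2 : Integrable (fun w : Plane => a ‖w‖ * b ‖w‖) :=
    integrable_radial (f := fun ρ => a ρ * b ρ) h1
  have h3 : Integrable (fun w : Plane => a ‖x - w‖ * b ‖x - w‖) := h2.comp_sub_left x
  have h4 : ∀ᵐ w : Plane, w ≠ 0 ∧ w ≠ x := by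
    have e1 : ∀ᵐ w : Plane, w ≠ 0 := by simp [ae_iff]
    have e2 : ∀ᵐ w : Plane, w ≠ x := by simp [ae_iff]
    exact e1.and e2
  -- Where `|w| ≤ |x - w|`, the factor `a` may be moved to `|w|`; elsewhere `b` may be moved to `|x
  -- - w|`. Both diagonal products have the same integral, whence the factor `2`.
  have h5 : ∀ᵐ w : Plane, 0 ≤ a ‖x - w‖ * b ‖w‖ ∧
      a ‖x - w‖ * b ‖w‖ ≤ a ‖x - w‖ * b ‖x - w‖ + a ‖w‖ * b ‖w‖ := by
    filter_upwards [h4] with w hw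
    have hw1 : 0 < ‖w‖ := norm_pos_iff.mpr hw.1
    have hw2 : 0 < ‖x - w‖ := norm_pos_iff.mpr (sub_ne_zero.mpr hw.2.symm)
    have p1 := ha0 _ hw1
    have p2 := ha0 _ hw2
    have p3 := hb0 _ hw1
    have p4 := hb0 _ hw2
    refine ⟨by positivity, ?_⟩
    rcases le_total ‖w‖ ‖x - w‖ with h | h
    · have := ha hw1 hw2 h
      nlinarith [mul_nonneg p2 p4]
    · have := hb hw2 hw1 h
      nlinarith [mul_nonneg p1 p3]
  have hm : Measurable fun w : Plane => a ‖x - w‖ * b ‖w‖ := by fun_prop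
  have h6 : Integrable (fun w : Plane => a ‖x - w‖ * b ‖w‖) := by
    refine (h3.add h2).mono' hm.aestronglyMeasurable ?_
    filter_upwards [h5] with w hw
    rw [Real.norm_of_nonneg hw.1]
    exact hw.2
  refine ⟨h6, ?_⟩
  have h7 : ∫ w : Plane, a ‖w‖ * b ‖w‖ ≤ circleLength * ∫ ρ in Ioi (0 : ℝ), H ρ := by
    rw [integral_radial (fun ρ => a ρ * b ρ)]
    refine mul_le_mul_of_nonneg_left ?_ circleLength_nonneg
    exact setIntegral_mono_on h1 hH measurableSet_Ioi fun ρ hρ => hle ρ hρ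
  calc ∫ w : Plane, a ‖x - w‖ * b ‖w‖
      ≤ ∫ w : Plane, (a ‖x - w‖ * b ‖x - w‖ + a ‖w‖ * b ‖w‖) :=
        integral_mono_ae h6 (h3.add h2) (h5.mono fun w hw => hw.2)
    _ = (∫ w : Plane, a ‖w‖ * b ‖w‖) + ∫ w : Plane, a ‖w‖ * b ‖w‖ := by
        rw [integral_add h3 h2]
        congr 1
        exact integral_sub_left_eq_self (fun w : Plane => a ‖w‖ * b ‖w‖) volume x
    _ ≤ _ := by linarith

theorem integrableOn_rpow_neg_half (R : ℝ) :
    IntegrableOn (fun ρ : ℝ => ρ ^ (-(1 / 2) : ℝ)) (Ioc 0 R) := by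
  rcases le_total 0 R with h | h
  · rw [← intervalIntegrable_iff_integrableOn_Ioc_of_le h]
    exact intervalIntegral.intervalIntegrable_rpow' (by norm_num)
  · simp [Ioc_eq_empty_of_le h]

theorem setIntegral_rpow_neg_half {R : ℝ} (hR : 0 ≤ R) :
    ∫ ρ in Ioc 0 R, ρ ^ (-(1 / 2) : ℝ) = 2 * R ^ (1 / 2 : ℝ) := by
  rw [← intervalIntegral.integral_of_le hR, integral_rpow (Or.inl (by norm_num))]
  norm_num
  ring

theorem setIntegral_Ioi_indicator_Ioc {c d : ℝ} (hc : 0 ≤ c) (f : ℝ → ℝ) :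
    ∫ ρ in Ioi (0 : ℝ), (Ioc c d).indicator f ρ = ∫ ρ in Ioc c d, f ρ := by
  rw [setIntegral_indicator measurableSet_Ioc]
  congr 2
  exact inter_eq_right.mpr fun x hx => hc.trans_lt hx.1

theorem integrableOn_Ioi_indicator_Ioc {c d : ℝ} {f : ℝ → ℝ} (hf : IntegrableOn f (Ioc c d)) :
    IntegrableOn ((Ioc c d).indicator f) (Ioi 0) :=
  ((integrable_indicator_iff measurableSet_Ioc).mpr hf).integrableOn

/-- This function dominates `ρ * (kernelProfile ε ρ * logProfile 0 ρ)` for all `ε ≤ 1` at once, as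
needed for the limit `ε → 0`. -/
theorem integrable_singular_profile :
    IntegrableOn (fun ρ : ℝ => (Ioc 0 1).indicator (fun ρ : ℝ => 2 * ρ ^ (-(1 / 2) : ℝ)) ρ +
      3 * (1 + ρ ^ 2)⁻¹) (Ioi 0) :=
  (integrableOn_Ioi_indicator_Ioc ((integrableOn_rpow_neg_half 1).const_mul 2)).add
    (integrable_inv_one_add_sq.integrableOn.const_mul 3)

/-- The logarithmic profile in the linearised form `log⁻ ρ ≤ ℓ + 2 exp (-ℓ / 2) ρ ^ (-1/2)`. -/
def logProfile (ℓ ρ : ℝ) : ℝ := 1 + ℓ + 2 * Real.exp (-ℓ / 2) * ρ ^ (-(1 / 2) : ℝ)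

theorem logProfile_nonneg {ℓ ρ : ℝ} (hℓ : 0 ≤ ℓ) (hρ : 0 ≤ ρ) : 0 ≤ logProfile ℓ ρ := by
  unfold logProfile; positivity

theorem antitoneOn_logProfile (ℓ : ℝ) : AntitoneOn (logProfile ℓ) (Ioi 0) := by
  intro x hx y hy hxy
  unfold logProfile
  have := Real.rpow_le_rpow_of_nonpos (z := -(1 / 2)) hx hxy (by norm_num)
  gcongr

theorem measurable_logProfile (ℓ : ℝ) : Measurable (logProfile ℓ) := by
  unfold logProfile; fun_prop

/-- The inequality `log y ≤ y - 1` at `y = exp (-ℓ / 2) ρ ^ (-1/2)`. -/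
theorem one_sub_log_le_logProfile {ℓ ρ : ℝ} (hρ : 0 < ρ) : 1 - Real.log ρ ≤ logProfile ℓ ρ := by
  have h1 : Real.log (Real.exp (-ℓ / 2) * ρ ^ (-(1 / 2) : ℝ)) ≤
      Real.exp (-ℓ / 2) * ρ ^ (-(1 / 2) : ℝ) - 1 := Real.log_le_sub_one_of_pos (by positivity)
  rw [Real.log_mul (by positivity) (by positivity), Real.log_exp, Real.log_rpow hρ] at h1
  unfold logProfile
  linarith

/-- The difference of the singular and the smoothed kernel. -/
def kernelProfile (ε ρ : ℝ) : ℝ := ε ^ 2 / (ρ * (ρ ^ 2 + ε ^ 2))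

theorem kernelProfile_nonneg {ε ρ : ℝ} (hρ : 0 ≤ ρ) : 0 ≤ kernelProfile ε ρ := by
  unfold kernelProfile; positivity

theorem antitoneOn_kernelProfile (ε : ℝ) : AntitoneOn (kernelProfile ε) (Ioi 0) := by
  intro x hx y hy hxy
  have hx' : 0 < x := hx
  have hy' : 0 < y := hy
  unfold kernelProfile
  gcongr

theorem measurable_kernelProfile (ε : ℝ) : Measurable (kernelProfile ε) := by
  unfold kernelProfile; fun_prop

theorem mul_kernelProfile {ε ρ : ℝ} (hρ : 0 < ρ) :
    ρ * kernelProfile ε ρ = ε ^ 2 / (ρ ^ 2 + ε ^ 2) := by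
  unfold kernelProfile
  field_simp

theorem kernelProfile_mul_logProfile_le {ε ρ : ℝ} (hε : 0 < ε) (hε1 : ε ≤ 1) (hρ : 0 < ρ) :
    ρ * (kernelProfile ε ρ * logProfile 0 ρ) ≤
      (Ioc 0 1).indicator (fun ρ : ℝ => 2 * ρ ^ (-(1 / 2) : ℝ)) ρ + 3 * (1 + ρ ^ 2)⁻¹ := by
  have hl : logProfile 0 ρ = 1 + 2 * ρ ^ (-(1 / 2) : ℝ) := by simp [logProfile]
  rw [← mul_assoc, mul_kernelProfile hρ, hl]
  have h1 : ε ^ 2 / (ρ ^ 2 + ε ^ 2) ≤ (1 + ρ ^ 2)⁻¹ := by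
    rw [← one_div, div_le_div_iff₀ (by positivity) (by positivity)]
    have : ε ^ 2 ≤ 1 := by nlinarith
    nlinarith [sq_nonneg ρ]
  have h2 : (1 + ρ ^ 2)⁻¹ ≤ 1 := inv_le_one_of_one_le₀ (by nlinarith [sq_nonneg ρ])
  have h3 : (0 : ℝ) < ρ ^ (-(1 / 2) : ℝ) := by positivity
  have h4 : (0 : ℝ) < (1 + ρ ^ 2)⁻¹ := by positivity
  by_cases hc : ρ ≤ 1
  · rw [indicator_of_mem (show ρ ∈ Ioc 0 1 from ⟨hρ, hc⟩)]
    nlinarith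
  · rw [indicator_of_notMem (fun h => hc h.2)]
    have h5 : ρ ^ (-(1 / 2) : ℝ) ≤ 1 :=
      Real.rpow_le_one_of_one_le_of_nonpos (le_of_not_ge hc) (by norm_num)
    nlinarith

/-- Dominated convergence. These integrals bound the uniform distance between `K_h` and its smooth
approximations. -/
theorem tendsto_integral_kernelProfile_mul_logProfile {ε : ℕ → ℝ} (hε : ∀ j, 0 < ε j)
    (hε1 : ∀ j, ε j ≤ 1) (hε0 : Tendsto ε atTop (𝓝 0)) :
    Tendsto (fun j => ∫ ρ in Ioi (0 : ℝ), ρ * (kernelProfile (ε j) ρ * logProfile 0 ρ)) atTop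
      (𝓝 0) := by
  suffices h : Tendsto (fun j => ∫ ρ in Ioi (0 : ℝ), ρ * (kernelProfile (ε j) ρ * logProfile 0 ρ))
      atTop (𝓝 (∫ ρ in Ioi (0 : ℝ), (fun _ : ℝ => (0 : ℝ)) ρ)) by
    rwa [integral_zero] at h
  refine tendsto_integral_of_dominated_convergence (f := fun _ => (0 : ℝ)) _ (fun j => ?_)
    integrable_singular_profile (fun j => ?_) ?_
  · have := measurable_kernelProfile (ε j)
    have := measurable_logProfile 0
    fun_prop
  · filter_upwards [ae_restrict_mem measurableSet_Ioi] with ρ hρ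
    have hρ' : 0 < ρ := hρ
    rw [Real.norm_of_nonneg (mul_nonneg hρ'.le (mul_nonneg (kernelProfile_nonneg hρ'.le)
      (logProfile_nonneg le_rfl hρ'.le)))]
    exact kernelProfile_mul_logProfile_le (hε j) (hε1 j) hρ'
  · filter_upwards [ae_restrict_mem measurableSet_Ioi] with ρ hρ
    have hρ' : 0 < ρ := hρ
    have h1 : Tendsto (fun j => ε j ^ 2 / (ρ ^ 2 + ε j ^ 2) * logProfile 0 ρ) atTop
        (𝓝 (0 ^ 2 / (ρ ^ 2 + 0 ^ 2) * logProfile 0 ρ)) :=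
      ((hε0.pow 2).div (tendsto_const_nhds.add (hε0.pow 2)) (by positivity)).mul_const _
    simpa [← mul_assoc, mul_kernelProfile hρ'] using h1

/-- The profile of the increments of `h` far from its singularity. -/
def farProfile (r ρ : ℝ) : ℝ := r / max ρ r

theorem farProfile_nonneg {r ρ : ℝ} (hr : 0 ≤ r) : 0 ≤ farProfile r ρ :=
  div_nonneg hr (hr.trans (le_max_right _ _))

theorem antitoneOn_farProfile {r : ℝ} (hr : 0 ≤ r) : AntitoneOn (farProfile r) (Ioi 0) := by
  intro x hx y hy hxy
  have hx' : 0 < max x r := lt_max_of_lt_left hx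
  unfold farProfile
  exact div_le_div_of_nonneg_left hr hx' (max_le_max_right r hxy)

theorem measurable_farProfile (r : ℝ) : Measurable (farProfile r) := by
  unfold farProfile; fun_prop

theorem kernelProfile_one_le {ρ : ℝ} (hρ : 0 < ρ) : ρ * kernelProfile 1 ρ = (1 + ρ ^ 2)⁻¹ := by
  rw [mul_kernelProfile hρ]; simp [add_comm]

/-- The radial integrand is at most `(1 + ρ²)⁻¹ min(1, r / ρ)`. It is cut at `ρ = exp (-ℓ)` and `ρ =
1`, and the pieces give `exp (-ℓ)`, `r ℓ` and `r π / 2`. Cutting at `exp (-ℓ)` rather than at `r`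
yields the linearised form for every `ℓ ≥ 1`. -/
theorem integral_far {r ℓ : ℝ} (hr : 0 ≤ r) (hℓ : 1 ≤ ℓ) (x : Plane) :
    Integrable (fun w : Plane => kernelProfile 1 ‖x - w‖ * farProfile r ‖w‖) ∧
      ∫ w : Plane, kernelProfile 1 ‖x - w‖ * farProfile r ‖w‖ ≤
        2 * circleLength * (3 * ℓ * r + Real.exp (-ℓ)) := by
  have hℓ0 : 0 ≤ ℓ := by linarith
  have he1 : Real.exp (-ℓ) ≤ 1 := Real.exp_le_one_iff.mpr (by linarith)
  set H : ℝ → ℝ := fun ρ => ((Ioc 0 (Real.exp (-ℓ))).indicator (fun _ => (1 : ℝ)) ρ +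
    (Ioc (Real.exp (-ℓ)) 1).indicator (fun ρ => r * ρ⁻¹) ρ) + r * (1 + ρ ^ 2)⁻¹ with hH
  have i1 : IntegrableOn ((Ioc 0 (Real.exp (-ℓ))).indicator (fun _ => (1 : ℝ))) (Ioi 0) :=
    integrableOn_Ioi_indicator_Ioc (by simp)
  have hni : (0 : ℝ) ∉ uIcc (Real.exp (-ℓ)) 1 := by
    rw [uIcc_of_le he1]
    exact fun h => absurd h.1 (not_le.mpr (Real.exp_pos _))
  have i2 : IntegrableOn ((Ioc (Real.exp (-ℓ)) 1).indicator (fun ρ : ℝ => r * ρ⁻¹)) (Ioi 0) := by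
    refine integrableOn_Ioi_indicator_Ioc (Integrable.const_mul ?_ r)
    have := (intervalIntegrable_iff_integrableOn_Ioc_of_le he1).mp
      (intervalIntegral.intervalIntegrable_inv (μ := volume) (f := fun x : ℝ => x)
        (fun x hx h => hni (h ▸ hx)) continuousOn_id)
    exact this
  have i3 : IntegrableOn (fun ρ : ℝ => r * (1 + ρ ^ 2)⁻¹) (Ioi 0) :=
    integrable_inv_one_add_sq.integrableOn.const_mul r
  have hHi : IntegrableOn H (Ioi 0) := (i1.add i2).add i3
  have hHe : ∫ ρ in Ioi (0 : ℝ), H ρ = Real.exp (-ℓ) + r * ℓ + r * (Real.pi / 2) := by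
    have i12 : IntegrableOn (fun ρ => (Ioc 0 (Real.exp (-ℓ))).indicator (fun _ => (1 : ℝ)) ρ +
      (Ioc (Real.exp (-ℓ)) 1).indicator (fun ρ => r * ρ⁻¹) ρ) (Ioi 0) := i1.add i2
    simp only [hH]
    rw [integral_add i12 i3, integral_add i1 i2, setIntegral_Ioi_indicator_Ioc le_rfl,
      setIntegral_Ioi_indicator_Ioc (Real.exp_pos _).le, integral_const_mul, integral_const_mul,
      integral_Ioi_inv_one_add_sq, ← intervalIntegral.integral_of_le he1, integral_inv hni]
    simp [Real.exp_nonneg]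
  obtain ⟨k1, k2⟩ := integral_antitone_mul_le (antitoneOn_kernelProfile 1)
    (antitoneOn_farProfile hr) (fun ρ h => kernelProfile_nonneg h.le)
    (fun ρ _ => farProfile_nonneg hr) (measurable_kernelProfile 1) (measurable_farProfile r) hHi
    (fun ρ hρ => by
      rw [← mul_assoc, kernelProfile_one_le hρ]
      have h2 : (1 + ρ ^ 2)⁻¹ ≤ 1 := inv_le_one_of_one_le₀ (by nlinarith [sq_nonneg ρ])
      have h4 : (0 : ℝ) < (1 + ρ ^ 2)⁻¹ := by positivity
      have h5 : farProfile r ρ ≤ 1 := div_le_one_of_le₀ (le_max_right _ _) (hr.trans (le_max_right _ _))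
      have h6 : farProfile r ρ ≤ r * ρ⁻¹ := by
        rw [← div_eq_mul_inv]
        exact div_le_div_of_nonneg_left hr hρ (le_max_left _ _)
      have h7 := farProfile_nonneg (ρ := ρ) hr
      have h8 : 0 ≤ r * (1 + ρ ^ 2)⁻¹ := by positivity
      have h9 : 0 ≤ r * ρ⁻¹ := by positivity
      simp only [hH]
      rcases le_or_gt ρ (Real.exp (-ℓ)) with hc | hc
      · rw [indicator_of_mem (show ρ ∈ Ioc 0 (Real.exp (-ℓ)) from ⟨hρ, hc⟩)]
        have := indicator_nonneg (s := Ioc (Real.exp (-ℓ)) 1) (f := fun ρ : ℝ => r * ρ⁻¹)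
          (fun x hx => mul_nonneg hr (inv_nonneg.mpr ((Real.exp_pos _).trans hx.1).le)) ρ
        nlinarith
      · rw [indicator_of_notMem (fun h => absurd h.2 (not_le.mpr hc))]
        rcases le_or_gt ρ 1 with hd | hd
        · rw [indicator_of_mem (show ρ ∈ Ioc (Real.exp (-ℓ)) 1 from ⟨hc, hd⟩)]
          nlinarith
        · rw [indicator_of_notMem (fun h => absurd h.2 (not_le.mpr hd))]
          have : r * ρ⁻¹ ≤ r := mul_le_of_le_one_right hr (inv_le_one_of_one_le₀ hd.le)
          nlinarith) x
  refine ⟨k1, k2.trans ?_⟩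
  rw [hHe]
  refine mul_le_mul_of_nonneg_left ?_ (mul_nonneg zero_le_two circleLength_nonneg)
  nlinarith [Real.pi_le_four, mul_nonneg hr (sub_nonneg.mpr hℓ)]

/-- The profile of `h` close to its singularity. -/
def nearProfile (ℓ R ρ : ℝ) : ℝ := (Iic R).indicator (logProfile ℓ) ρ

/-- The logarithmic profile integrates over `(0, R]` to `R (1 + ℓ) + 4 exp (-ℓ / 2) R ^ (1/2)`, and
`2ab ≤ a² + b²` turns the last term into at most `2 R + 2 exp (-ℓ)`. -/
theorem integral_near {R ℓ : ℝ} (hR : 0 ≤ R) (hℓ : 1 ≤ ℓ) (x : Plane) :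
    Integrable (fun w : Plane => kernelProfile 1 ‖x - w‖ * nearProfile ℓ R ‖w‖) ∧
      ∫ w : Plane, kernelProfile 1 ‖x - w‖ * nearProfile ℓ R ‖w‖ ≤
        2 * circleLength * (4 * ℓ * R + 2 * Real.exp (-ℓ)) := by
  have hℓ0 : 0 ≤ ℓ := by linarith
  set H : ℝ → ℝ := (Ioc 0 R).indicator (logProfile ℓ) with hH
  have hI : IntegrableOn (logProfile ℓ) (Ioc 0 R) := by
    unfold logProfile
    exact (integrable_const _).add ((integrableOn_rpow_neg_half R).const_mul _)
  have hHi : IntegrableOn H (Ioi 0) := integrableOn_Ioi_indicator_Ioc hI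
  have hHe : ∫ ρ in Ioi (0 : ℝ), H ρ =
      R * (1 + ℓ) + 2 * Real.exp (-ℓ / 2) * (2 * R ^ (1 / 2 : ℝ)) := by
    rw [hH, setIntegral_Ioi_indicator_Ioc le_rfl]
    unfold logProfile
    rw [integral_add (integrable_const _) ((integrableOn_rpow_neg_half R).const_mul _),
      integral_const_mul, setIntegral_rpow_neg_half hR]
    simp [hR]
  obtain ⟨k1, k2⟩ := integral_antitone_mul_le (b := nearProfile ℓ R) (antitoneOn_kernelProfile 1)
    (fun x hx y hy hxy => by
      unfold nearProfile
      by_cases hy' : y ≤ R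
      · rw [indicator_of_mem (show y ∈ Iic R from hy'),
          indicator_of_mem (show x ∈ Iic R from hxy.trans hy')]
        exact antitoneOn_logProfile ℓ hx hy hxy
      · rw [indicator_of_notMem (show y ∉ Iic R from hy')]
        exact indicator_apply_nonneg fun _ => logProfile_nonneg hℓ0 (le_of_lt hx))
    (fun ρ h => kernelProfile_nonneg h.le)
    (fun ρ h => indicator_apply_nonneg fun _ => logProfile_nonneg hℓ0 h.le)
    (measurable_kernelProfile 1)
    ((measurable_logProfile ℓ).indicator measurableSet_Iic) hHi
    (fun ρ hρ => by
      rw [← mul_assoc, kernelProfile_one_le hρ]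
      have h2 : (1 + ρ ^ 2)⁻¹ ≤ 1 := inv_le_one_of_one_le₀ (by nlinarith [sq_nonneg ρ])
      have h4 : nearProfile ℓ R ρ = H ρ := by
        simp only [hH, nearProfile, indicator_apply]
        simp [hρ]
      rw [h4]
      exact mul_le_of_le_one_left (indicator_apply_nonneg fun _ => logProfile_nonneg hℓ0 hρ.le) h2) x
  refine ⟨k1, k2.trans ?_⟩
  rw [hHe]
  refine mul_le_mul_of_nonneg_left ?_ (mul_nonneg zero_le_two circleLength_nonneg)
  have e1 : R ^ (1 / 2 : ℝ) ^ 1 * R ^ (1 / 2 : ℝ) = R := by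
    rw [pow_one, ← Real.rpow_add' hR (by norm_num)]; norm_num
  have e2 : Real.exp (-ℓ / 2) * Real.exp (-ℓ / 2) = Real.exp (-ℓ) := by
    rw [← Real.exp_add]; ring_nf
  rw [pow_one] at e1
  nlinarith [sq_nonneg (Real.exp (-ℓ / 2) - R ^ (1 / 2 : ℝ)), mul_nonneg hR (sub_nonneg.mpr hℓ)]

end Radial

/-! ### Pointwise bounds on `h` and on its increments -/

section LogSingularity

/-- Integrable functions with a logarithmic singularity at the origin. -/
structure HasLogSingularity (M : ℝ) (h : Plane → ℝ) : Prop where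
  integrable : Integrable h
  nonneg : 0 ≤ M
  abs_le : ∀ w, w ≠ 0 → ∀ ℓ, 0 ≤ ℓ → |h w| ≤ M * logProfile ℓ ‖w‖
  differentiableAt : ∀ w, w ≠ 0 → DifferentiableAt ℝ h w
  norm_fderiv_le : ∀ w, w ≠ 0 → ‖fderiv ℝ h w‖ ≤ M / ‖w‖

/-- The set of `U` where `f > C` is open and null, hence empty. This turns the `L^∞` hypotheses on
`h` into pointwise bounds off the origin. -/
theorem le_of_ae_le_of_continuousOn {X : Type*} [TopologicalSpace X] [MeasurableSpace X]
    {μ : Measure X} [μ.IsOpenPosMeasure] {U : Set X} (hU : IsOpen U) {f : X → ℝ}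
    (hf : ContinuousOn f U) {C : ℝ} (h : ∀ᵐ x ∂μ, f x ≤ C) : ∀ x ∈ U, f x ≤ C := by
  by_contra! hne
  obtain ⟨x, hx, hC⟩ := hne
  have ho : IsOpen (U ∩ f ⁻¹' Ioi C) := hf.isOpen_inter_preimage hU isOpen_Ioi
  have h0 : μ (U ∩ f ⁻¹' Ioi C) = 0 := by
    refine measure_mono_null (fun y hy => ?_) (ae_iff.mp h)
    exact not_le.mpr hy.2
  exact (ho.measure_pos μ ⟨x, hx, hC⟩).ne' h0

theorem exists_ae_norm_le_of_memLp_top {X F : Type*} [MeasurableSpace X] [NormedAddCommGroup F]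
    {μ : Measure X} {f : X → F} (hf : MemLp f ⊤ μ) : ∃ C : ℝ, 0 ≤ C ∧ ∀ᵐ x ∂μ, ‖f x‖ ≤ C := by
  refine ⟨(eLpNorm f ⊤ μ).toReal, ENNReal.toReal_nonneg, ?_⟩
  have h1 := hf.2
  rw [eLpNorm_exponent_top] at h1 ⊢
  filter_upwards [ae_le_eLpNormEssSup (f := f) (μ := μ)] with x hx
  have := ENNReal.toReal_mono h1.ne hx
  simpa using this

theorem one_le_logProfile {ℓ ρ : ℝ} (hℓ : 0 ≤ ℓ) (hρ : 0 ≤ ρ) : 1 ≤ logProfile ℓ ρ := by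
  unfold logProfile
  have : 0 ≤ 2 * Real.exp (-ℓ / 2) * ρ ^ (-(1 / 2) : ℝ) := by positivity
  linarith

/-- The ball of radius `|w| / 2` about `w` is convex, avoids the origin and carries the gradient
bound `2C / |w|`; the mean value inequality applies there. -/
theorem norm_sub_le_of_fderiv_le {h : Plane → ℝ} {C : ℝ} (hC : 0 ≤ C)
    (hd : ∀ w, w ≠ 0 → DifferentiableAt ℝ h w) (hC' : ∀ w, w ≠ 0 → ‖fderiv ℝ h w‖ ≤ C / ‖w‖)
    {w v : Plane} (hv : 2 * ‖v‖ ≤ ‖w‖) (hw : w ≠ 0) : |h (w + v) - h w| ≤ 2 * C / ‖w‖ * ‖v‖ := by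
  have hw0 : 0 < ‖w‖ := norm_pos_iff.mpr hw
  have hball : ∀ z ∈ Metric.closedBall w (‖w‖ / 2), ‖w‖ / 2 ≤ ‖z‖ := by
    intro z hz
    rw [Metric.mem_closedBall, dist_eq_norm] at hz
    have := norm_sub_norm_le w z
    rw [norm_sub_rev] at this
    linarith
  have hne : ∀ z ∈ Metric.closedBall w (‖w‖ / 2), z ≠ 0 := fun z hz h0 => by
    have := hball z hz
    rw [h0, norm_zero] at this
    linarith
  have := Convex.norm_image_sub_le_of_norm_fderiv_le (𝕜 := ℝ) (f := h) (C := 2 * C / ‖w‖)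
    (s := Metric.closedBall w (‖w‖ / 2)) (x := w) (y := w + v)
    (fun z hz => hd z (hne z hz))
    (fun z hz => (hC' z (hne z hz)).trans (by
      rw [show 2 * C / ‖w‖ = C / (‖w‖ / 2) by field_simp]
      exact div_le_div_of_nonneg_left hC (by positivity) (hball z hz)))
    (convex_closedBall _ _) (Metric.mem_closedBall_self (by positivity))
    (by rw [Metric.mem_closedBall, dist_eq_norm]; simp; linarith)
  simpa using this

/-- Near the origin the weight `χ_log^-` bounds `h`. For `|w| ≥ 1` the gradient bound lets `h` vary
by at most `C₂` on the ball of radius `1/2` about `w`, so `|h w|` is at most `C₂` plus the mean of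
`|h|` on that ball, which integrability controls. -/
theorem IsSmoothingFunction.exists_hasLogSingularity {h : Plane → ℝ} (hh : IsSmoothingFunction h) :
    ∃ M, HasLogSingularity M h := by
  have hopen : IsOpen ({0}ᶜ : Set Plane) := isOpen_compl_singleton
  have hd : ∀ w : Plane, w ≠ 0 → DifferentiableAt ℝ h w := fun w hw =>
    (hh.contDiffOn.differentiableOn (by norm_num)).differentiableAt (hopen.mem_nhds hw)
  have hint : Integrable h := hh.memW11.1
  obtain ⟨C₁, hC₁, h1⟩ := exists_ae_norm_le_of_memLp_top hh.bounded_chiLogMinus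
  obtain ⟨C₂, hC₂, h2⟩ := exists_ae_norm_le_of_memLp_top hh.bounded_gradient
  have hg : ∀ w : Plane, w ≠ 0 → ‖fderiv ℝ h w‖ ≤ C₂ / ‖w‖ := by
    have hc : ContinuousOn (fun w : Plane => ‖w‖ * ‖fderiv ℝ h w‖) {0}ᶜ :=
      continuous_norm.continuousOn.mul
        (hh.contDiffOn.continuousOn_fderiv_of_isOpen hopen (by norm_num)).norm
    intro w hw
    rw [le_div_iff₀ (norm_pos_iff.mpr hw), mul_comm]
    refine le_of_ae_le_of_continuousOn hopen hc (h2.mono fun x hx => ?_) w hw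
    simpa [norm_smul, gradient] using hx
  have hnear : ∀ w : Plane, w ≠ 0 → ‖w‖ < 1 → |h w| ≤ C₁ * (1 - Real.log ‖w‖) := by
    have hU : IsOpen ({0}ᶜ ∩ Metric.ball (0 : Plane) 1) := hopen.inter Metric.isOpen_ball
    have hlog : ∀ w ∈ ({0}ᶜ ∩ Metric.ball (0 : Plane) 1), 0 < 1 - Real.log ‖w‖ := by
      intro w hw
      have := Real.log_neg (norm_pos_iff.mpr hw.1) (by simpa using hw.2)
      linarith
    have hc : ContinuousOn (fun w : Plane => ‖chiLogMinus w * h w‖)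
        ({0}ᶜ ∩ Metric.ball (0 : Plane) 1) := by
      have h3 : ContinuousOn (fun w : Plane => ‖(1 - Real.log ‖w‖)⁻¹ * h w‖)
          ({0}ᶜ ∩ Metric.ball (0 : Plane) 1) := by
        refine ((ContinuousOn.inv₀ (continuousOn_const.sub ?_) fun w hw => (hlog w hw).ne').mul
          (hh.contDiffOn.continuousOn.mono inter_subset_left)).norm
        exact continuous_norm.continuousOn.log fun w hw => norm_ne_zero_iff.mpr hw.1
      refine h3.congr fun w hw => ?_
      have : ‖w‖ ≤ 1 := by simpa using (Metric.mem_ball.mp hw.2).le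
      simp [chiLogMinus, this]
    intro w hw hw1
    have hm : w ∈ ({0}ᶜ ∩ Metric.ball (0 : Plane) 1) := ⟨hw, by simpa using hw1⟩
    have h4 := le_of_ae_le_of_continuousOn hU hc h1 w hm
    have h5 := hlog w hm
    simp only [chiLogMinus, hw1.le, if_true, norm_mul, norm_inv] at h4
    rw [Real.norm_of_nonneg h5.le, inv_mul_le_iff₀ h5, Real.norm_eq_abs] at h4
    linarith
  set V : ℝ := volume.real (Metric.ball (0 : Plane) (1 / 2)) with hV
  have hVpos : 0 < V := by
    rw [hV, measureReal_def]
    exact ENNReal.toReal_pos (Metric.measure_ball_pos _ _ (by norm_num)).ne'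
      measure_ball_lt_top.ne
  have hfar : ∀ w : Plane, 1 ≤ ‖w‖ → |h w| ≤ C₂ + (∫ y, |h y|) / V := by
    intro w hw
    have hw0 : w ≠ 0 := fun h0 => by rw [h0, norm_zero] at hw; linarith
    have hVw : volume.real (Metric.ball w (1 / 2)) = V := by
      rw [hV, measureReal_def, measureReal_def, Measure.addHaar_ball_center]
    have h6 : ∀ y ∈ Metric.ball w (1 / 2), |h w| - C₂ ≤ |h y| := by
      intro y hy
      rw [Metric.mem_ball, dist_eq_norm] at hy
      have h7 := norm_sub_le_of_fderiv_le hC₂ hd hg (w := w) (v := y - w) (by linarith) hw0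
      rw [add_sub_cancel] at h7
      have h8 : 2 * C₂ / ‖w‖ * ‖y - w‖ ≤ C₂ := by
        calc 2 * C₂ / ‖w‖ * ‖y - w‖ ≤ 2 * C₂ / 1 * (1 / 2) := by gcongr
          _ = C₂ := by ring
      have h9 := abs_sub_abs_le_abs_sub (h w) (h y)
      rw [abs_sub_comm] at h9
      linarith
    have h10 : (|h w| - C₂) * V ≤ ∫ y, |h y| := by
      calc (|h w| - C₂) * V = ∫ _ in Metric.ball w (1 / 2), (|h w| - C₂) := by
            rw [setIntegral_const, hVw, smul_eq_mul, mul_comm]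
        _ ≤ ∫ y in Metric.ball w (1 / 2), |h y| :=
            setIntegral_mono_on (integrableOn_const measure_ball_lt_top.ne) hint.abs.integrableOn
              measurableSet_ball h6
        _ ≤ ∫ y, |h y| := setIntegral_le_integral hint.abs (Eventually.of_forall fun y => abs_nonneg _)
    rw [← le_div_iff₀ hVpos] at h10
    linarith
  have hI : 0 ≤ (∫ y, |h y|) / V := div_nonneg (integral_nonneg fun y => abs_nonneg _) hVpos.le
  refine ⟨C₁ + C₂ + (∫ y, |h y|) / V, hint, by positivity, fun w hw ℓ hℓ => ?_, hd, fun w hw => ?_⟩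
  · have hp := one_le_logProfile hℓ (norm_nonneg w)
    rcases lt_or_ge ‖w‖ 1 with hc | hc
    · have := one_sub_log_le_logProfile (ℓ := ℓ) (norm_pos_iff.mpr hw)
      calc |h w| ≤ C₁ * (1 - Real.log ‖w‖) := hnear w hw hc
        _ ≤ C₁ * logProfile ℓ ‖w‖ := by gcongr
        _ ≤ _ := by gcongr; linarith
    · calc |h w| ≤ (C₂ + (∫ y, |h y|) / V) * 1 := by rw [mul_one]; exact hfar w hc
        _ ≤ _ := by gcongr; linarith
  · exact (hg w hw).trans (by gcongr; linarith)

/-- If `2|v| ≤ |w|`, the mean value inequality gives the far profile. Otherwise `w` and `w + v` both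
lie within `3|v|` of the origin, and the logarithmic bound is applied to each value separately. -/
theorem HasLogSingularity.abs_sub_le {M : ℝ} {h : Plane → ℝ} (hh : HasLogSingularity M h) {ℓ : ℝ}
    (hℓ : 0 ≤ ℓ) {w v : Plane} (hw : w ≠ 0) (hwv : w + v ≠ 0) :
    |h (w + v) - h w| ≤ M * (2 * farProfile ‖v‖ ‖w‖ + nearProfile ℓ (3 * ‖v‖) ‖w‖ +
      nearProfile ℓ (3 * ‖v‖) ‖w + v‖) := by
  have n1 : 0 ≤ nearProfile ℓ (3 * ‖v‖) ‖w‖ :=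
    indicator_apply_nonneg fun _ => logProfile_nonneg hℓ (norm_nonneg _)
  have n2 : 0 ≤ nearProfile ℓ (3 * ‖v‖) ‖w + v‖ :=
    indicator_apply_nonneg fun _ => logProfile_nonneg hℓ (norm_nonneg _)
  have n3 : 0 ≤ farProfile ‖v‖ ‖w‖ := farProfile_nonneg (norm_nonneg v)
  have hM := hh.nonneg
  rcases le_or_gt (2 * ‖v‖) ‖w‖ with hc | hc
  · have h1 := norm_sub_le_of_fderiv_le hM hh.differentiableAt hh.norm_fderiv_le hc hw
    have h2 : 2 * M / ‖w‖ * ‖v‖ = M * (2 * farProfile ‖v‖ ‖w‖) := by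
      rw [farProfile, max_eq_left (by linarith [norm_nonneg v])]
      ring
    calc |h (w + v) - h w| ≤ M * (2 * farProfile ‖v‖ ‖w‖) := h2 ▸ h1
      _ ≤ _ := by gcongr; linarith
  · have h3 : ‖w + v‖ ≤ 3 * ‖v‖ := (norm_add_le _ _).trans (by linarith)
    have h4 : ‖w‖ ≤ 3 * ‖v‖ := by linarith [norm_nonneg v]
    have e1 : nearProfile ℓ (3 * ‖v‖) ‖w‖ = logProfile ℓ ‖w‖ := indicator_of_mem (mem_Iic.mpr h4) _
    have e2 : nearProfile ℓ (3 * ‖v‖) ‖w + v‖ = logProfile ℓ ‖w + v‖ :=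
      indicator_of_mem (mem_Iic.mpr h3) _
    have h5 := hh.abs_le w hw ℓ hℓ
    have h6 := hh.abs_le (w + v) hwv ℓ hℓ
    have h7 := abs_sub (h (w + v)) (h w)
    rw [e1, e2]
    nlinarith [mul_nonneg hM n3]

end LogSingularity

/-! ### The regularized kernel is bounded and log-Lipschitz -/

section RegKernel

/-- The regularization `K_ε * h` of the smoothed Biot-Savart kernel. -/
def smoothRegKernel (h : Plane → ℝ) (ε : ℝ) (x : Plane) : Plane := ∫ y, h y • smoothKernel ε (x - y)

variable {M : ℝ} {h : Plane → ℝ}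

theorem integrable_smul_smoothKernel (hh : Integrable h) {ε : ℝ} (hε : 0 < ε) (x : Plane) :
    Integrable fun y => h y • smoothKernel ε (x - y) := by
  refine (hh.norm.mul_const (1 / ε)).mono' ?_ (Eventually.of_forall fun y => ?_)
  · exact hh.aestronglyMeasurable.smul
      ((continuous_smoothKernel hε).comp (continuous_sub_left x)).aestronglyMeasurable
  · rw [norm_smul]
    gcongr
    exact norm_smoothKernel_le hε _

theorem isDivFree_smoothRegKernel (hh : Integrable h) {ε : ℝ} (hε : 0 < ε) :
    IsDivFree (3 / ε ^ 2 * ∫ y, |h y|) (smoothRegKernel h ε) :=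
  (isDivFree_smoothKernel hε).average (norm_smoothKernel_le hε) hh aemeasurable_id

theorem norm_smoothRegKernel_le (hh : Integrable h) {ε : ℝ} (hε : 0 < ε) (x : Plane) :
    ‖smoothRegKernel h ε x‖ ≤ (∫ y, |h y|) * (1 / ε) := by
  rw [← integral_mul_const]
  refine norm_integral_le_of_norm_le (hh.norm.mul_const (1 / ε)) (Eventually.of_forall fun y => ?_)
  rw [norm_smul]
  exact mul_le_mul_of_nonneg_left (norm_smoothKernel_le hε _) (abs_nonneg _)

/-- The difference of the singular and the smoothed Biot-Savart kernel. -/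
def singularPart (ε : ℝ) (x : Plane) : Plane := biotSavart x - smoothKernel ε x

theorem measurable_singularPart {ε : ℝ} (hε : 0 < ε) : Measurable (singularPart ε) :=
  measurable_biotSavart.sub (continuous_smoothKernel hε).measurable

theorem integral_kernelProfile_mul_logProfile {ε : ℝ} (hε : 0 < ε) (hε1 : ε ≤ 1) (x : Plane) :
    Integrable (fun w : Plane => kernelProfile ε ‖x - w‖ * logProfile 0 ‖w‖) ∧
      ∫ w : Plane, kernelProfile ε ‖x - w‖ * logProfile 0 ‖w‖ ≤
        2 * circleLength * ∫ ρ in Ioi (0 : ℝ), ρ * (kernelProfile ε ρ * logProfile 0 ρ) := by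
  have hm1 := measurable_kernelProfile ε
  have hm2 := measurable_logProfile 0
  refine integral_antitone_mul_le (antitoneOn_kernelProfile ε) (antitoneOn_logProfile 0)
    (fun ρ h => kernelProfile_nonneg h.le) (fun ρ h => logProfile_nonneg le_rfl h.le)
    hm1 hm2 (integrable_singular_profile.mono' (by fun_prop) ?_) (fun ρ _ => le_rfl) x
  filter_upwards [ae_restrict_mem measurableSet_Ioi] with ρ hρ
  have hρ' : 0 < ρ := hρ
  rw [Real.norm_of_nonneg (mul_nonneg hρ'.le (mul_nonneg (kernelProfile_nonneg hρ'.le)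
      (logProfile_nonneg le_rfl hρ'.le)))]
  exact kernelProfile_mul_logProfile_le hε hε1 hρ'

theorem HasLogSingularity.integrable_smul_singularPart (hh : HasLogSingularity M h) {ε : ℝ}
    (hε : 0 < ε) (hε1 : ε ≤ 1) (x : Plane) :
    Integrable (fun y => h y • singularPart ε (x - y)) ∧
      ‖∫ y, h y • singularPart ε (x - y)‖ ≤ M * (2 * circleLength *
        ∫ ρ in Ioi (0 : ℝ), ρ * (kernelProfile ε ρ * logProfile 0 ρ)) := by
  obtain ⟨h1, h2⟩ := integral_kernelProfile_mul_logProfile hε hε1 x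
  have h3 : ∀ᵐ y : Plane, ‖h y • singularPart ε (x - y)‖ ≤
      M * (kernelProfile ε ‖x - y‖ * logProfile 0 ‖y‖) := by
    have e1 : ∀ᵐ w : Plane, w ≠ 0 := by simp [ae_iff]
    filter_upwards [e1] with y hy
    rw [norm_smul]
    calc ‖h y‖ * ‖singularPart ε (x - y)‖
        ≤ (M * logProfile 0 ‖y‖) * kernelProfile ε ‖x - y‖ := by
          have := hh.nonneg
          have := logProfile_nonneg le_rfl (norm_nonneg y)
          exact mul_le_mul (hh.abs_le y hy 0 le_rfl) (norm_biotSavart_sub_smoothKernel_le hε _)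
            (norm_nonneg _) (by positivity)
      _ = _ := by ring
  refine ⟨(h1.const_mul M).mono' ?_ h3, ?_⟩
  · exact hh.integrable.aestronglyMeasurable.smul
      ((measurable_singularPart hε).comp (measurable_const_sub x)).aestronglyMeasurable
  · refine (norm_integral_le_of_norm_le (h1.const_mul M) h3).trans ?_
    rw [integral_const_mul]
    exact mul_le_mul_of_nonneg_left h2 hh.nonneg

theorem HasLogSingularity.regKernel_eq (hh : HasLogSingularity M h) {ε : ℝ} (hε : 0 < ε)
    (hε1 : ε ≤ 1) (x : Plane) :
    regKernel h x = (∫ y, h y • singularPart ε (x - y)) + smoothRegKernel h ε x := by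
  rw [smoothRegKernel, ← integral_add (hh.integrable_smul_singularPart hε hε1 x).1
    (integrable_smul_smoothKernel hh.integrable hε x), regKernel]
  congr 1
  ext1 y
  rw [← smul_add, singularPart, sub_add_cancel]

theorem HasLogSingularity.norm_smoothRegKernel_sub_le (hh : HasLogSingularity M h) {ε : ℝ}
    (hε : 0 < ε) (hε1 : ε ≤ 1) (x : Plane) :
    ‖smoothRegKernel h ε x - regKernel h x‖ ≤ M * (2 * circleLength *
        ∫ ρ in Ioi (0 : ℝ), ρ * (kernelProfile ε ρ * logProfile 0 ρ)) := by
  rw [hh.regKernel_eq hε hε1, norm_sub_rev, add_sub_cancel_right]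
  exact (hh.integrable_smul_singularPart hε hε1 x).2

theorem HasLogSingularity.exists_norm_regKernel_le (hh : HasLogSingularity M h) :
    ∃ B, ∀ x, ‖regKernel h x‖ ≤ B := by
  refine ⟨M * (2 * circleLength *
    ∫ ρ in Ioi (0 : ℝ), ρ * (kernelProfile 1 ρ * logProfile 0 ρ)) + (∫ y, |h y|) * (1 / 1),
    fun x => ?_⟩
  rw [hh.regKernel_eq one_pos le_rfl]
  exact (norm_add_le _ _).trans (add_le_add (hh.integrable_smul_singularPart one_pos le_rfl x).2
    (norm_smoothRegKernel_le hh.integrable one_pos x))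

/-- A change of variables moves the translation from the singular kernel to `h`, whose increments
split into one far and two near profiles. The constant is `60 = 12 + 24 + 24`. -/
theorem HasLogSingularity.norm_singularPart_sub_le (hh : HasLogSingularity M h) {ℓ : ℝ}
    (hℓ : 1 ≤ ℓ) (x v : Plane) :
    ‖(∫ y, h y • singularPart 1 (x + v - y)) - ∫ y, h y • singularPart 1 (x - y)‖ ≤
      60 * circleLength * M * (ℓ * ‖v‖ + Real.exp (-ℓ)) := by
  have hℓ0 : 0 ≤ ℓ := by linarith
  have h1 : ∫ y, h y • singularPart 1 (x + v - y) = ∫ w, h (w + v) • singularPart 1 (x - w) := by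
    rw [← integral_add_right_eq_self _ v]
    simp only [add_sub_add_right_eq_sub]
  have hi1 : Integrable fun w => h (w + v) • singularPart 1 (x - w) := by
    have := ((hh.integrable_smul_singularPart one_pos le_rfl (x + v)).1).comp_add_right v
    simpa only [add_sub_add_right_eq_sub] using this
  have hi2 := (hh.integrable_smul_singularPart one_pos le_rfl x).1
  obtain ⟨f1, f2⟩ := integral_far (norm_nonneg v) hℓ x
  obtain ⟨g1, g2⟩ := integral_near (R := 3 * ‖v‖) (by positivity) hℓ x
  obtain ⟨k1, k2⟩ := integral_near (R := 3 * ‖v‖) (by positivity) hℓ (x + v)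
  have k1' : Integrable fun w : Plane =>
      kernelProfile 1 ‖x - w‖ * nearProfile ℓ (3 * ‖v‖) ‖w + v‖ := by
    have := k1.comp_add_right v
    simpa only [add_sub_add_right_eq_sub] using this
  have k2' : ∫ w : Plane, kernelProfile 1 ‖x - w‖ * nearProfile ℓ (3 * ‖v‖) ‖w + v‖ ≤
      2 * circleLength * (4 * ℓ * (3 * ‖v‖) + 2 * Real.exp (-ℓ)) := by
    refine le_trans (le_of_eq ?_) k2
    rw [← integral_add_right_eq_self
      (fun w : Plane => kernelProfile 1 ‖x + v - w‖ * nearProfile ℓ (3 * ‖v‖) ‖w‖) v]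
    simp only [add_sub_add_right_eq_sub]
  rw [h1, ← integral_sub hi1 hi2]
  have hbound : ∀ᵐ w : Plane, ‖h (w + v) • singularPart 1 (x - w) - h w • singularPart 1 (x - w)‖ ≤
      M * ((2 * (kernelProfile 1 ‖x - w‖ * farProfile ‖v‖ ‖w‖) +
        kernelProfile 1 ‖x - w‖ * nearProfile ℓ (3 * ‖v‖) ‖w‖) +
        kernelProfile 1 ‖x - w‖ * nearProfile ℓ (3 * ‖v‖) ‖w + v‖) := by
    have e1 : ∀ᵐ w : Plane, w ≠ 0 := by simp [ae_iff]
    have e2 : ∀ᵐ w : Plane, w ≠ -v := by simp [ae_iff]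
    filter_upwards [e1, e2] with w hw1 hw2
    rw [← sub_smul, norm_smul]
    have hk := kernelProfile_nonneg (ε := 1) (norm_nonneg (x - w))
    have h3 := hh.abs_sub_le hℓ0 (v := v) hw1 (fun h => hw2 (eq_neg_of_add_eq_zero_left h))
    calc ‖h (w + v) - h w‖ * ‖singularPart 1 (x - w)‖
        ≤ (M * (2 * farProfile ‖v‖ ‖w‖ + nearProfile ℓ (3 * ‖v‖) ‖w‖ +
          nearProfile ℓ (3 * ‖v‖) ‖w + v‖)) * kernelProfile 1 ‖x - w‖ :=
        mul_le_mul h3 (norm_biotSavart_sub_smoothKernel_le one_pos _) (norm_nonneg _)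
          ((abs_nonneg _).trans h3)
      _ = _ := by ring
  have hs1 : Integrable fun w : Plane => 2 * (kernelProfile 1 ‖x - w‖ * farProfile ‖v‖ ‖w‖) +
        kernelProfile 1 ‖x - w‖ * nearProfile ℓ (3 * ‖v‖) ‖w‖ := (f1.const_mul 2).add g1
  refine (norm_integral_le_of_norm_le ((hs1.add k1').const_mul M) hbound).trans ?_
  rw [integral_const_mul]
  have e3 : ∫ w : Plane, ((fun w : Plane => 2 * (kernelProfile 1 ‖x - w‖ * farProfile ‖v‖ ‖w‖) +
        kernelProfile 1 ‖x - w‖ * nearProfile ℓ (3 * ‖v‖) ‖w‖) + fun w : Plane =>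
      kernelProfile 1 ‖x - w‖ * nearProfile ℓ (3 * ‖v‖) ‖w + v‖) w =
      2 * (∫ w : Plane, kernelProfile 1 ‖x - w‖ * farProfile ‖v‖ ‖w‖) +
        (∫ w : Plane, kernelProfile 1 ‖x - w‖ * nearProfile ℓ (3 * ‖v‖) ‖w‖) +
        ∫ w : Plane, kernelProfile 1 ‖x - w‖ * nearProfile ℓ (3 * ‖v‖) ‖w + v‖ := by
    rw [integral_add' hs1 k1', integral_add (f1.const_mul 2) g1, integral_const_mul]
  calc M * _ ≤ M * (2 * (2 * circleLength * (3 * ℓ * ‖v‖ + Real.exp (-ℓ))) +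
        2 * circleLength * (4 * ℓ * (3 * ‖v‖) + 2 * Real.exp (-ℓ)) +
        2 * circleLength * (4 * ℓ * (3 * ‖v‖) + 2 * Real.exp (-ℓ))) := by
        refine mul_le_mul_of_nonneg_left ?_ hh.nonneg
        refine e3.le.trans ?_
        linarith
    _ = circleLength * M * (60 * (ℓ * ‖v‖) + 12 * Real.exp (-ℓ)) := by ring
    _ ≤ circleLength * M * (60 * (ℓ * ‖v‖) + 60 * Real.exp (-ℓ)) := by
        have := circleLength_nonneg
        have := hh.nonneg
        gcongr
        norm_num
    _ = _ := by ring

/-- The regularized kernel is log-Lipschitz. -/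
theorem HasLogSingularity.exists_logLip_regKernel (hh : HasLogSingularity M h) :
    ∃ A, 0 < A ∧ LogLip A (regKernel h) := by
  have hc := circleLength_nonneg
  have hM := hh.nonneg
  have hI : 0 ≤ ∫ y, |h y| := integral_nonneg fun y => abs_nonneg _
  refine ⟨60 * circleLength * M + 3 * (∫ y, |h y|) + 1, by positivity, fun ℓ hℓ x y => ?_⟩
  have h1 := hh.norm_singularPart_sub_le hℓ y (x - y)
  rw [add_sub_cancel] at h1
  have h2 := (isDivFree_smoothRegKernel hh.integrable one_pos).norm_sub_le x y
  have h3 : ‖x - y‖ ≤ ℓ * ‖x - y‖ + Real.exp (-ℓ) := by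
    nlinarith [norm_nonneg (x - y), Real.exp_pos (-ℓ)]
  rw [hh.regKernel_eq one_pos le_rfl, hh.regKernel_eq one_pos le_rfl, add_sub_add_comm]
  set Z := ℓ * ‖x - y‖ + Real.exp (-ℓ)
  have hZ : 0 ≤ Z := (norm_nonneg _).trans h3
  calc _ ≤ 60 * circleLength * M * Z + 3 / 1 ^ 2 * (∫ y, |h y|) * ‖x - y‖ :=
        (norm_add_le _ _).trans (add_le_add h1 h2)
    _ ≤ 60 * circleLength * M * Z + 3 / 1 ^ 2 * (∫ y, |h y|) * Z := by gcongr
    _ ≤ _ := by nlinarith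

end RegKernel

/-! ### Area distortion of Euler steps and measure preserving limits -/

section EulerStep

theorem det_plane (D : Plane →L[ℝ] Plane) :
    D.det = D (basisVec 0) 0 * D (basisVec 1) 1 - D (basisVec 1) 0 * D (basisVec 0) 1 := by
  rw [ContinuousLinearMap.det, ← LinearMap.det_toMatrix (EuclideanSpace.basisFun (Fin 2) ℝ).toBasis,
    Matrix.det_fin_two]
  simp [LinearMap.toMatrix_apply, basisVec, OrthonormalBasis.coe_toBasis]

theorem norm_basisVec (i : Fin 2) : ‖basisVec i‖ = 1 := by simp [basisVec]

theorem abs_apply_basisVec_le {L : ℝ} {D : Plane →L[ℝ] Plane} (hD : ‖D‖ ≤ L) (i j : Fin 2) :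
    |D (basisVec i) j| ≤ L := by
  calc |D (basisVec i) j| ≤ ‖D (basisVec i)‖ := PiLp.norm_apply_le (D (basisVec i)) j
    _ ≤ ‖D‖ * ‖basisVec i‖ := D.le_opNorm _
    _ ≤ L := by rw [norm_basisVec, mul_one]; exact hD

/-- In dimension two `det (1 + τ D) = 1 + τ tr D + τ² det D`, so zero trace removes the first-order
term. -/
theorem abs_det_id_add_smul_sub_one_le {L τ : ℝ} {D : Plane →L[ℝ] Plane} (hD : ‖D‖ ≤ L)
    (htr : planeTrace D = 0) :
    |(ContinuousLinearMap.id ℝ Plane + τ • D).det - 1| ≤ 2 * (τ * L) ^ 2 := by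
  have e : (ContinuousLinearMap.id ℝ Plane + τ • D).det - 1 =
      τ * planeTrace D + τ ^ 2 * (D (basisVec 0) 0 * D (basisVec 1) 1 -
        D (basisVec 1) 0 * D (basisVec 0) 1) := by
    rw [det_plane]
    simp [basisVec, planeTrace]
    ring
  rw [e, htr, mul_zero, zero_add, abs_mul, abs_of_nonneg (sq_nonneg τ), mul_pow]
  have hL : 0 ≤ L := (norm_nonneg D).trans hD
  have h1 : ∀ i j k l : Fin 2, |D (basisVec i) j * D (basisVec k) l| ≤ L ^ 2 := fun i j k l => by
    rw [abs_mul, sq]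
    exact mul_le_mul (abs_apply_basisVec_le hD i j) (abs_apply_basisVec_le hD k l)
      (abs_nonneg _) hL
  calc τ ^ 2 * |D (basisVec 0) 0 * D (basisVec 1) 1 - D (basisVec 1) 0 * D (basisVec 0) 1|
      ≤ τ ^ 2 * (L ^ 2 + L ^ 2) := by
        refine mul_le_mul_of_nonneg_left ((abs_sub _ _).trans (add_le_add ?_ ?_)) (sq_nonneg τ)
        · exact h1 ..
        · exact h1 ..
    _ = _ := by ring

variable {L τ : ℝ} {k : Plane → Plane}

/-- The step is the identity plus a `1/2`-Lipschitz map; a preimage of `y` is the fixed point of the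
contraction `x ↦ y - τ k(x)`. -/
theorem IsDivFree.bijective_step (hk : IsDivFree L k) (hτ : 0 ≤ τ) (hτL : τ * L ≤ 1 / 2) :
    Function.Bijective fun x => x + τ • k x := by
  have hL : 0 ≤ L := (norm_nonneg _).trans (hk.norm_fderiv_le 0)
  have hlip : ∀ x y, ‖τ • k x - τ • k y‖ ≤ 1 / 2 * ‖x - y‖ := fun x y => by
    rw [← smul_sub, norm_smul, Real.norm_of_nonneg hτ]
    calc τ * ‖k x - k y‖ ≤ τ * (L * ‖x - y‖) := by gcongr; exact hk.norm_sub_le x y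
      _ = τ * L * ‖x - y‖ := by ring
      _ ≤ _ := by gcongr
  constructor
  · intro x y hxy
    have h1 : x - y = -(τ • k x - τ • k y) := by
      have : x + τ • k x = y + τ • k y := hxy
      rw [neg_sub, sub_eq_sub_iff_add_eq_add, this]
      abel
    have h2 : ‖x - y‖ ≤ 1 / 2 * ‖x - y‖ := by
      conv_lhs => rw [h1, norm_neg]
      exact hlip x y
    rw [← sub_eq_zero, ← norm_le_zero_iff]
    linarith
  · intro y
    have hc : ContractingWith (1 / 2 : NNReal) fun x => y - τ • k x := by
      refine ⟨by norm_num [← NNReal.coe_lt_coe], LipschitzWith.of_dist_le_mul fun a b => ?_⟩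
      rw [dist_eq_norm, dist_eq_norm, sub_sub_sub_cancel_left, norm_sub_rev]
      simpa using hlip a b
    refine ⟨hc.fixedPoint, ?_⟩
    have := hc.fixedPoint_isFixedPt
    have h2 : y - τ • k hc.fixedPoint = hc.fixedPoint := this
    change hc.fixedPoint + τ • k hc.fixedPoint = y
    nth_rewrite 1 [← h2]
    abel

/-- An explicit Euler step along a divergence-free field preserves the area up to second order. -/
theorem IsDivFree.lintegral_step (hk : IsDivFree L k) (hτ : 0 ≤ τ) (hτL : τ * L ≤ 1 / 2)
    (f : Plane → ENNReal) :
    ENNReal.ofReal (1 - 2 * (τ * L) ^ 2) * ∫⁻ x, f (x + τ • k x) ≤ ∫⁻ x, f x ∧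
      ∫⁻ x, f x ≤ ENNReal.ofReal (1 + 2 * (τ * L) ^ 2) * ∫⁻ x, f (x + τ • k x) := by
  have hbij := hk.bijective_step hτ hτL
  have hd : ∀ x ∈ univ, HasFDerivWithinAt (fun x => x + τ • k x)
      (ContinuousLinearMap.id ℝ Plane + τ • fderiv ℝ k x) univ x := fun x _ =>
    ((hasFDerivAt_id x).add ((hk.differentiable x).hasFDerivAt.const_smul τ)).hasFDerivWithinAt
  have key := lintegral_image_eq_lintegral_abs_det_fderiv_mul volume MeasurableSet.univ hd
    hbij.injective.injOn f
  rw [image_univ, hbij.surjective.range_eq, setLIntegral_univ, setLIntegral_univ] at key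
  have hdet := fun x => abs_le.mp (abs_det_id_add_smul_sub_one_le (τ := τ) (hk.norm_fderiv_le x)
    (hk.trace_eq_zero x))
  have hL : 0 ≤ L := (norm_nonneg _).trans (hk.norm_fderiv_le 0)
  have hsq : 2 * (τ * L) ^ 2 ≤ 1 := by nlinarith [mul_nonneg hτ hL]
  rw [key]
  constructor
  · rw [← lintegral_const_mul' _ _ ENNReal.ofReal_ne_top]
    refine lintegral_mono fun x => ?_
    gcongr
    exact le_trans (by linarith [(hdet x).1]) (le_abs_self _)
  · rw [← lintegral_const_mul' _ _ ENNReal.ofReal_ne_top]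
    refine lintegral_mono fun x => ?_
    gcongr
    rw [abs_of_nonneg (by linarith [(hdet x).1])]
    linarith [(hdet x).2]

/-- Compositions of Euler steps along divergence-free fields. -/
theorem lintegral_iterated_steps (hτ : 0 ≤ τ) (hτL : τ * L ≤ 1 / 2)
    {u : ℕ → Plane → Plane} (hu : ∀ n, IsDivFree L (u n)) {η : ℕ → Plane → Plane} (h0 : ∀ x, η 0 x = x)
    (hη : ∀ n x, η (n + 1) x = η n x + τ • u n (η n x)) (n : ℕ) (f : Plane → ENNReal) :
    ENNReal.ofReal (1 - 2 * (τ * L) ^ 2) ^ n * ∫⁻ x, f (η n x) ≤ ∫⁻ x, f x ∧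
      ∫⁻ x, f x ≤ ENNReal.ofReal (1 + 2 * (τ * L) ^ 2) ^ n * ∫⁻ x, f (η n x) := by
  induction n generalizing f with
  | zero => simp [h0]
  | succ n ih =>
    -- The newest step is the outermost map, so the induction hypothesis is applied to `f` composed
    -- with that step.
    obtain ⟨h1, h2⟩ := ih fun x => f (x + τ • u n x)
    obtain ⟨h3, h4⟩ := (hu n).lintegral_step hτ hτL f
    simp only [hη]
    constructor
    · rw [pow_succ', mul_assoc]
      exact (mul_le_mul_right h1 _).trans h3
    · rw [pow_succ', mul_assoc]
      exact h4.trans (mul_le_mul_right h2 _)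

/-- The two-sided bounds pass to the limit for nonnegative `f` in `C_c`: displacements bounded by
`R` keep all `f ∘ g j` supported in one ball, so dominated convergence applies. Integrals of such
`f` determine a measure that is finite on compact sets, and the bound `R` also gives this
finiteness. -/
theorem measurePreserving_of_tendsto {g : ℕ → Plane → Plane} {g' : Plane → Plane}
    (hg : ∀ j, Continuous (g j)) (hg' : Continuous g') (hlim : ∀ x, Tendsto (fun j => g j x) atTop (𝓝 (g' x)))
    {R : ℝ} (hR : ∀ j x, ‖g j x - x‖ ≤ R) {a b : ℕ → ENNReal} (ha : Tendsto a atTop (𝓝 1))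
    (hb : Tendsto b atTop (𝓝 1))
    (hab : ∀ j (f : Plane → ENNReal), a j * ∫⁻ x, f (g j x) ≤ ∫⁻ x, f x ∧
      ∫⁻ x, f x ≤ b j * ∫⁻ x, f (g j x)) :
    MeasurePreserving g' volume volume := by
  have hR' : ∀ x, ‖g' x - x‖ ≤ R := fun x =>
    le_of_tendsto' ((hlim x).sub_const x).norm fun j => hR j x
  refine ⟨hg'.measurable, ?_⟩
  have hfin : IsFiniteMeasureOnCompacts (Measure.map g' volume) := by
    refine ⟨fun K hK => ?_⟩
    rw [Measure.map_apply hg'.measurable hK.measurableSet]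
    obtain ⟨r, hr⟩ := hK.isBounded.subset_closedBall (0 : Plane)
    refine lt_of_le_of_lt (measure_mono (t := Metric.closedBall 0 (r + R)) fun x hx => ?_)
      measure_closedBall_lt_top
    have h1 := hr hx
    rw [mem_closedBall_zero_iff] at h1 ⊢
    have h2 := norm_sub_norm_le x (g' x)
    rw [norm_sub_rev] at h2
    linarith [hR' x]
  refine Measure.ext_of_integral_eq_on_compactlySupported_nnreal fun f => ?_
  have hf : Measurable fun x => ((f x : NNReal) : ENNReal) := by
    have := f.continuous.measurable
    fun_prop
  have hlint : ∫⁻ x, (f x : ENNReal) ∂(Measure.map g' volume) = ∫⁻ x, (f x : ENNReal) := by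
    rw [lintegral_map hf hg'.measurable]
    obtain ⟨r, hr⟩ := f.hasCompactSupport.isCompact.isBounded.subset_closedBall (0 : Plane)
    obtain ⟨C, hC⟩ := (f.hasCompactSupport.isCompact.image f.continuous).bddAbove
    have hfC : ∀ y, f y ≤ C := fun y => by
      by_cases hy : y ∈ tsupport f
      · exact hC (mem_image_of_mem f hy)
      · rw [image_eq_zero_of_notMem_tsupport hy]; exact zero_le
    have hdom : ∀ x y : Plane, ‖y - x‖ ≤ R → (f y : ENNReal) ≤
        (Metric.closedBall (0 : Plane) (r + R)).indicator (fun _ => (C : ENNReal)) x := by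
      intro x y hxy
      by_cases hx : x ∈ Metric.closedBall (0 : Plane) (r + R)
      · rw [indicator_of_mem hx]; exact_mod_cast hfC y
      · have hy : y ∉ tsupport f := fun hy => hx (by
          have h1 := hr hy
          rw [mem_closedBall_zero_iff] at h1 ⊢
          have h2 := norm_sub_norm_le x y
          rw [norm_sub_rev] at h2
          linarith)
        rw [image_eq_zero_of_notMem_tsupport hy]; simp
    have hbfin : ∫⁻ x, (Metric.closedBall (0 : Plane) (r + R)).indicator
        (fun _ => (C : ENNReal)) x ≠ ⊤ := by
      rw [lintegral_indicator measurableSet_closedBall, setLIntegral_const]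
      exact ENNReal.mul_ne_top ENNReal.coe_ne_top measure_closedBall_lt_top.ne
    have hconv : Tendsto (fun j => ∫⁻ x, (f (g j x) : ENNReal)) atTop
        (𝓝 (∫⁻ x, (f (g' x) : ENNReal))) :=
      tendsto_lintegral_of_dominated_convergence _ (fun j => hf.comp (hg j).measurable)
        (fun j => Eventually.of_forall fun x => hdom x _ (hR j x)) hbfin
        (Eventually.of_forall fun x =>
          (ENNReal.continuous_coe.comp f.continuous).continuousAt.tendsto.comp (hlim x))
    apply le_antisymm
    · have := ENNReal.Tendsto.mul ha (Or.inl one_ne_zero) hconv (Or.inr ENNReal.one_ne_top)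
      rw [one_mul] at this
      exact le_of_tendsto' this fun j => (hab j _).1
    · have := ENNReal.Tendsto.mul hb (Or.inl one_ne_zero) hconv (Or.inr ENNReal.one_ne_top)
      rw [one_mul] at this
      exact ge_of_tendsto' this fun j => (hab j fun x => (f x : ENNReal)).2
  have hfr : Measurable fun x => (f x : ℝ) := by
    have := f.continuous.measurable
    fun_prop
  have hI : ∀ μ : Measure Plane, ∫ x, (f x : ℝ) ∂μ = (∫⁻ x, (f x : ENNReal) ∂μ).toReal := fun μ => by
    rw [integral_eq_lintegral_of_nonneg_ae (f := fun x => (f x : ℝ))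
      (Eventually.of_forall fun x => (f x).2) hfr.aestronglyMeasurable]
    simp
  rw [hI, hI, hlint]

/-- A continuous measure preserving injection at bounded distance of the identity is a
homeomorphism. -/
theorem exists_homeomorph_of_measurePreserving {g : Plane → Plane} (hg : Continuous g)
    (hinj : Function.Injective g) (hmp : MeasurePreserving g volume volume) {R : ℝ}
    (hR : ∀ x, ‖g x - x‖ ≤ R) : ∃ e : Plane ≃ₜ Plane, ⇑e = g := by
  have hproper : IsProperMap g := by
    rw [isProperMap_iff_isCompact_preimage]
    refine ⟨hg, fun K hK => ?_⟩
    obtain ⟨r, hr⟩ := hK.isBounded.subset_closedBall (0 : Plane)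
    refine Metric.isCompact_of_isClosed_isBounded (hK.isClosed.preimage hg)
      ((Metric.isBounded_closedBall (x := (0 : Plane)) (r := r + R)).subset fun x hx => ?_)
    have h1 := hr hx
    rw [mem_closedBall_zero_iff] at h1 ⊢
    have h2 := norm_sub_norm_le x (g x)
    rw [norm_sub_rev] at h2
    linarith [hR x]
  have hclosed : IsClosedMap g := hproper.isClosedMap
  -- The range is closed because `g` is proper. Its complement is open with empty preimage, hence
  -- null, hence empty.
  have hsurj : Function.Surjective g := by
    rw [← range_eq_univ]
    have ho : IsOpen (range g)ᶜ := hclosed.isClosed_range.isOpen_compl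
    have h0 : volume (range g)ᶜ = 0 := by
      rw [← hmp.measure_preimage ho.measurableSet.nullMeasurableSet, preimage_compl,
        preimage_range]
      simp
    exact compl_empty_iff.mp ((ho.measure_eq_zero_iff volume).mp h0)
  exact ⟨(Equiv.ofBijective g ⟨hinj, hsurj⟩).toHomeomorphOfContinuousClosed hg hclosed, rfl⟩

end EulerStep

/-! ### Inverse flows by reversal of time -/

section Flow

variable {E : Type*} [NormedAddCommGroup E] [NormedSpace ℝ E]

theorem LogLip.neg_smul {A c : ℝ} (hc : |c| = 1) {F : E → E} (h : LogLip A F) :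
    LogLip A fun z => -(c • F z) := by
  intro ℓ hℓ x y
  have : -(c • F x) - -(c • F y) = -(c • (F x - F y)) := by rw [smul_sub]; abel
  rw [this, norm_neg, norm_smul, Real.norm_eq_abs, hc, one_mul]
  exact h ℓ hℓ x y

/-- With `c = ±1` the sign that makes `t - c |t| = 0`, the curve `s ↦ f (t - c s)` runs from time
`t` back to time `0`. This reduces both signs of `t` to the stability estimates on `[0, T]`. -/
theorem isApproxTrajectory_reverse {u : ℝ → E → E} {f : ℝ → E}
    (hf : ∀ s, HasDerivAt f (u s (f s)) s) (t c T : ℝ) :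
    IsApproxTrajectory (fun s z => -(c • u (t - c * s) z)) 0 T fun s => f (t - c * s) := by
  refine isApproxTrajectory_of_hasDerivAt fun s _ => ?_
  have h1 : HasDerivAt (fun s : ℝ => t - c * s) (-c) s := by
    simpa using ((hasDerivAt_id s).const_mul c).const_sub t
  have h2 := (hf (t - c * s)).scomp s h1
  rw [neg_smul] at h2
  exact h2

theorem exists_sign (t : ℝ) : ∃ c : ℝ, |c| = 1 ∧ t - c * |t| = 0 := by
  rcases le_total 0 t with h | h
  · exact ⟨1, by simp, by simp [abs_of_nonneg h]⟩
  · exact ⟨-1, by simp, by simp [abs_of_nonpos h]⟩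

theorem abs_sub_mul_le {t c T s : ℝ} (ht : |t| ≤ T) (hc : |c| = 1) (h0 : t - c * |t| = 0)
    (hs : s ∈ Icc 0 T) : |t - c * s| ≤ T := by
  have : t - c * s = c * (|t| - s) := by linarith
  rw [this, abs_mul, hc, one_mul, abs_le]
  constructor <;> linarith [hs.1, hs.2, abs_nonneg t]

/-- Hölder continuity of the inverse of the flow of a log-Lipschitz field. -/
theorem exists_holder_inverse_flow {A : ℝ} (hA : 0 < A) (T : ℝ) {u : ℝ → E → E}
    (hu : ∀ s, |s| ≤ T → LogLip A (u s)) {η : ℝ → E → E}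
    (hη : ∀ s x, HasDerivAt (fun s => η s x) (u s (η s x)) s) (h0 : ∀ x, η 0 x = x) :
    ∃ C > 0, ∃ c > 0, ∀ t, |t| ≤ T → ∀ x y (ℓ : ℝ), 1 ≤ ℓ → ‖η t x - η t y‖ ≤ Real.exp (-ℓ) →
      ‖x - y‖ ≤ C * Real.exp (-(c * ℓ)) := by
  obtain ⟨C, hC, c, hc, H⟩ := exists_holder_norm_sub_le (E := E) hA T
  refine ⟨C, hC, c, hc, fun t ht x y ℓ hℓ hxy => ?_⟩
  obtain ⟨b, hb, hbt⟩ := exists_sign t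
  have := H (fun s z => -(b • u (t - b * s) z))
    (fun s hs => (hu _ (abs_sub_mul_le ht hb hbt ⟨hs.1, hs.2.le⟩)).neg_smul hb)
    (fun s => η (t - b * s) x) (fun s => η (t - b * s) y)
    (isApproxTrajectory_reverse (f := fun s => η s x) (fun s => hη s x) t b T)
    (isApproxTrajectory_reverse (f := fun s => η s y) (fun s => hη s y) t b T) ℓ hℓ
    (by simpa using hxy) |t| ⟨abs_nonneg t, ht⟩
  simpa [hbt, h0] using this

theorem injective_flow {A : ℝ} (hA : 0 < A) {t : ℝ} {u : ℝ → E → E}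
    (hu : ∀ s, |s| ≤ |t| → LogLip A (u s)) {η : ℝ → E → E}
    (hη : ∀ s x, HasDerivAt (fun s => η s x) (u s (η s x)) s) (h0 : ∀ x, η 0 x = x) :
    Function.Injective (η t) := by
  intro x y hxy
  obtain ⟨C, hC, c, hc, H⟩ := exists_holder_inverse_flow hA |t| hu hη h0
  have h1 : Tendsto (fun ℓ : ℝ => C * Real.exp (-(c * ℓ))) atTop (𝓝 (C * 0)) :=
    (Real.tendsto_exp_neg_atTop_nhds_zero.comp (tendsto_id.const_mul_atTop hc)).const_mul C
  rw [mul_zero] at h1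
  have h2 : ‖x - y‖ ≤ 0 := by
    refine ge_of_tendsto h1 ?_
    filter_upwards [eventually_ge_atTop 1] with ℓ hℓ
    exact H t le_rfl x y ℓ hℓ (by rw [hxy, sub_self, norm_zero]; exact (Real.exp_pos _).le)
  exact sub_eq_zero.mp (norm_le_zero_iff.mp h2)

/-- Here the substitution starts at time `0` and has sign `-b`, so that it runs towards `t` and the
equal initial values can be used. -/
theorem eq_of_hasDerivAt_autonomous {A : ℝ} (hA : 0 < A) {F : E → E} (hF : LogLip A F)
    {f g : ℝ → E} (hf : ∀ s, HasDerivAt f (F (f s)) s) (hg : ∀ s, HasDerivAt g (F (g s)) s)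
    (h0 : f 0 = g 0) : f = g := by
  ext t
  obtain ⟨b, hb, hbt⟩ := exists_sign t
  have hb2 : b * b = 1 := by rw [← abs_mul_abs_self, hb, one_mul]
  have h1 := isApproxTrajectory_reverse (u := fun _ => F) hf 0 (-b) |t|
  have h2 := isApproxTrajectory_reverse (u := fun _ => F) hg 0 (-b) |t|
  have h3 := eqOn_of_trajectories hA (fun s _ => hF.neg_smul (c := -b) (by rwa [abs_neg])) h1 h2
    (by simpa using h0) (t := |t|) ⟨abs_nonneg t, le_rfl⟩
  have h4 : (0 : ℝ) - -b * |t| = t := by linarith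
  simpa only [h4] using h3

end Flow

/-! ### The vorticity equation as an ordinary differential equation for displacements -/

section VortexField

variable {m : Measure Plane} [IsFiniteMeasure m] {σ : Plane → ℝ}

/-- The velocity `∫ K(x - η(y)) σ(y) dm(y)` of the vorticity `σ m` transported by `η`. -/
def vortexVelocity (m : Measure Plane) (k : Plane → Plane) (σ : Plane → ℝ) (η : Plane → Plane) (x : Plane) : Plane :=
  ∫ y, σ y • k (x - η y) ∂m

theorem integrable_weight (hσ : Measurable σ) (hσ1 : ∀ x, |σ x| ≤ 1) : Integrable σ m :=
  Integrable.of_bound hσ.aestronglyMeasurable 1 (Eventually.of_forall hσ1)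

theorem integrable_vortex (hσ : Measurable σ) (hσ1 : ∀ x, |σ x| ≤ 1)
    {B : ℝ} {k : Plane → Plane} (hk : Continuous k) (hB : ∀ x, ‖k x‖ ≤ B)
    {η : Plane → Plane} (hη : Measurable η) (x : Plane) :
    Integrable (fun y => σ y • k (x - η y)) m := by
  refine Integrable.of_bound (hσ.aestronglyMeasurable.smul
    (hk.measurable.comp (hη.const_sub x)).aestronglyMeasurable) B (Eventually.of_forall fun y => ?_)
  rw [norm_smul]
  exact (mul_le_of_le_one_left (norm_nonneg _) (hσ1 y)).trans (hB _)

theorem norm_vortexVelocity_le (hσ1 : ∀ x, |σ x| ≤ 1) {B : ℝ} {k : Plane → Plane}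
    (hB : ∀ x, ‖k x‖ ≤ B) (η : Plane → Plane) (x : Plane) :
    ‖vortexVelocity m k σ η x‖ ≤ B * m.real univ := by
  refine norm_integral_le_of_norm_le_const (Eventually.of_forall fun y => ?_)
  rw [norm_smul]
  exact (mul_le_of_le_one_left (norm_nonneg _) (hσ1 y)).trans (hB _)

theorem norm_vortexVelocity_sub_le (hσ : Measurable σ) (hσ1 : ∀ x, |σ x| ≤ 1)
    {B δ : ℝ} {k k' : Plane → Plane} (hk : Continuous k)
    (hB : ∀ x, ‖k x‖ ≤ B) (hk' : Continuous k') (hB' : ∀ x, ‖k' x‖ ≤ B)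
    {η η' : Plane → Plane} (hη : Measurable η) (hη' : Measurable η') {x x' : Plane}
    (h : ∀ y, ‖k (x - η y) - k' (x' - η' y)‖ ≤ δ) :
    ‖vortexVelocity m k σ η x - vortexVelocity m k' σ η' x'‖ ≤ δ * m.real univ := by
  rw [vortexVelocity, vortexVelocity, ← integral_sub (integrable_vortex hσ hσ1 hk hB hη x)
    (integrable_vortex hσ hσ1 hk' hB' hη' x')]
  refine norm_integral_le_of_norm_le_const (Eventually.of_forall fun y => ?_)
  rw [← smul_sub, norm_smul]
  exact (mul_le_of_le_one_left (norm_nonneg _) (hσ1 y)).trans (h y)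

theorem continuous_vortexVelocity (hσ : Measurable σ) (hσ1 : ∀ x, |σ x| ≤ 1)
    {B : ℝ} {k : Plane → Plane} (hk : Continuous k)
    (hB : ∀ x, ‖k x‖ ≤ B) {η : Plane → Plane} (hη : Measurable η) :
    Continuous (vortexVelocity m k σ η) := by
  refine continuous_of_dominated (bound := fun _ => B)
    (fun x => (integrable_vortex hσ hσ1 hk hB hη x).aestronglyMeasurable)
    (fun x => Eventually.of_forall fun y => ?_) (integrable_const B)
    (Eventually.of_forall fun y => ?_)
  · rw [norm_smul]
    exact (mul_le_of_le_one_left (norm_nonneg _) (hσ1 y)).trans (hB _)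
  · exact (hk.comp (continuous_sub_right _)).const_smul (σ y)

theorem logLip_vortexVelocity (hσ : Measurable σ) (hσ1 : ∀ x, |σ x| ≤ 1)
    {A B : ℝ} {k : Plane → Plane} (hk : Continuous k)
    (hB : ∀ x, ‖k x‖ ≤ B) (hA : LogLip A k) {η : Plane → Plane} (hη : Measurable η) :
    LogLip (A * m.real univ) (vortexVelocity m k σ η) := by
  intro ℓ hℓ x x'
  rw [mul_right_comm]
  refine norm_vortexVelocity_sub_le hσ hσ1 hk hB hk hB hη hη fun y => ?_
  simpa using hA ℓ hℓ (x - η y) (x' - η y)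

/-- The vector field of the vorticity equation in Lagrangian coordinates, on displacements. -/
def vortexField (m : Measure Plane) [IsFiniteMeasure m] (k : Plane →ᵇ Plane) (hσ : Measurable σ) (hσ1 : ∀ x, |σ x| ≤ 1)
    (ξ : Plane →ᵇ Plane) : Plane →ᵇ Plane :=
  BoundedContinuousFunction.ofNormedAddCommGroup
    (fun x => vortexVelocity m k σ (fun y => y + ξ y) (x + ξ x))
    ((continuous_vortexVelocity hσ hσ1 k.continuous k.norm_coe_le_norm
      (measurable_id.add ξ.continuous.measurable)).comp (continuous_id.add ξ.continuous))
    (‖k‖ * m.real univ)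
    (fun _ => norm_vortexVelocity_le hσ1 k.norm_coe_le_norm _ _)

theorem vortexField_apply (hσ : Measurable σ) (hσ1 : ∀ x, |σ x| ≤ 1) (k ξ : Plane →ᵇ Plane) (x : Plane) :
    vortexField m k hσ hσ1 ξ x = vortexVelocity m k σ (fun y => y + ξ y) (x + ξ x) := rfl

theorem norm_vortexField_le (hσ : Measurable σ) (hσ1 : ∀ x, |σ x| ≤ 1) (k ξ : Plane →ᵇ Plane) :
    ‖vortexField m k hσ hσ1 ξ‖ ≤ ‖k‖ * m.real univ :=
  BoundedContinuousFunction.norm_ofNormedAddCommGroup_le _ (by positivity) _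

theorem norm_vortexField_sub_le (hσ : Measurable σ) (hσ1 : ∀ x, |σ x| ≤ 1) (k k' ξ : Plane →ᵇ Plane) :
    ‖vortexField m k hσ hσ1 ξ - vortexField m k' hσ hσ1 ξ‖ ≤ ‖k - k'‖ * m.real univ := by
  rw [BoundedContinuousFunction.norm_le (by positivity)]
  intro x
  have hm : Measurable fun y => y + ξ y := measurable_id.add ξ.continuous.measurable
  refine norm_vortexVelocity_sub_le hσ hσ1 (B := max ‖k‖ ‖k'‖) k.continuous
    (fun z => (k.norm_coe_le_norm z).trans (le_max_left _ _)) k'.continuous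
    (fun z => (k'.norm_coe_le_norm z).trans (le_max_right _ _)) hm hm fun y => ?_
  exact (k - k').norm_coe_le_norm _

/-- Replacing `ξ` by `ξ'` changes the argument `x + ξ x - (y + ξ y)` of the kernel by at most `2 ‖ξ
- ξ'‖`, uniformly in `x` and `y`. So the log-Lipschitz property of `k` passes to the field on the
space of displacements with the uniform norm. -/
theorem logLip_vortexField (hσ : Measurable σ) (hσ1 : ∀ x, |σ x| ≤ 1)
    {A : ℝ} {k : Plane →ᵇ Plane} (hA0 : 0 ≤ A) (hA : LogLip A k) :
    LogLip (2 * A * m.real univ) (vortexField m k hσ hσ1) := by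
  intro ℓ hℓ ξ ξ'
  have hℓ0 : 0 ≤ ℓ := by linarith
  rw [BoundedContinuousFunction.norm_le (by positivity)]
  intro x
  have hm : ∀ ξ : Plane →ᵇ Plane, Measurable fun y => y + ξ y := fun ξ =>
    measurable_id.add ξ.continuous.measurable
  have := norm_vortexVelocity_sub_le (m := m) hσ hσ1 k.continuous k.norm_coe_le_norm k.continuous
    k.norm_coe_le_norm (hm ξ) (hm ξ') (x := x + ξ x) (x' := x + ξ' x)
    (δ := A * (ℓ * (2 * ‖ξ - ξ'‖) + Real.exp (-ℓ))) fun y => by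
      refine (hA ℓ hℓ _ _).trans ?_
      have e : x + ξ x - (y + ξ y) - (x + ξ' x - (y + ξ' y)) = (ξ - ξ') x - (ξ - ξ') y := by
        simp only [BoundedContinuousFunction.coe_sub, Pi.sub_apply]; abel
      rw [e]
      gcongr
      calc _ ≤ ‖(ξ - ξ') x‖ + ‖(ξ - ξ') y‖ := norm_sub_le _ _
        _ ≤ ‖ξ - ξ'‖ + ‖ξ - ξ'‖ := add_le_add ((ξ - ξ').norm_coe_le_norm x) ((ξ - ξ').norm_coe_le_norm y)
        _ = _ := by ring
  refine le_trans this ?_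
  have hm0 : 0 ≤ m.real univ := by positivity
  have he := (Real.exp_pos (-ℓ)).le
  nlinarith [mul_nonneg (mul_nonneg hA0 hm0) he]

end VortexField

/-! ### Global measure preserving solutions in Lagrangian coordinates -/

section VortexFlow

variable {m : Measure Plane} [IsFiniteMeasure m] {σ : Plane → ℝ}

theorem tendsto_ofReal_one_sub_pow {s : ℕ → ℝ} {n : ℕ → ℕ} (hs : ∀ j, 0 ≤ s j) (hs1 : ∀ j, s j ≤ 1)
    (h : Tendsto (fun j => n j * s j) atTop (𝓝 0)) :
    Tendsto (fun j => ENNReal.ofReal (1 - s j) ^ n j) atTop (𝓝 1) := by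
  have h1 : Tendsto (fun j => (1 - s j) ^ n j) atTop (𝓝 1) := by
    have h2 : Tendsto (fun j => 1 - n j * s j) atTop (𝓝 1) := by simpa using h.const_sub 1
    refine tendsto_of_tendsto_of_tendsto_of_le_of_le h2 tendsto_const_nhds (fun j => ?_) fun j => ?_
    · have := one_add_mul_le_pow (a := -s j) (by linarith [hs1 j]) (n j)
      simpa [sub_eq_add_neg] using this
    · exact pow_le_one₀ (by linarith [hs1 j]) (by linarith [hs j])
  have h3 := ENNReal.tendsto_ofReal h1
  rw [ENNReal.ofReal_one] at h3
  exact h3.congr fun j => ENNReal.ofReal_pow (by linarith [hs1 j]) _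

theorem tendsto_ofReal_one_add_pow {s : ℕ → ℝ} {n : ℕ → ℕ} (hs : ∀ j, 0 ≤ s j)
    (h : Tendsto (fun j => n j * s j) atTop (𝓝 0)) :
    Tendsto (fun j => ENNReal.ofReal (1 + s j) ^ n j) atTop (𝓝 1) := by
  have h1 : Tendsto (fun j => (1 + s j) ^ n j) atTop (𝓝 1) := by
    have h2 : Tendsto (fun j => Real.exp (n j * s j)) atTop (𝓝 1) := by
      have h3 := (Real.continuous_exp.tendsto 0).comp h
      rw [Real.exp_zero] at h3
      exact h3
    refine tendsto_of_tendsto_of_tendsto_of_le_of_le tendsto_const_nhds h2 (fun j => ?_) fun j => ?_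
    · exact one_le_pow₀ (by linarith [hs j])
    · change (1 + s j) ^ n j ≤ Real.exp (n j * s j)
      rw [Real.exp_nat_mul]
      exact pow_le_pow_left₀ (by linarith [hs j]) (by linarith [Real.add_one_le_exp (s j)]) _
  have h3 := ENNReal.tendsto_ofReal h1
  rw [ENNReal.ofReal_one] at h3
  exact h3.congr fun j => ENNReal.ofReal_pow (by linarith [hs j]) _

/-- The Euler scheme is run with the divergence-free kernels `κ j`, so each step distorts area by a
factor within `2 (τ j * L' j)²` of `1`. There are at most `t / τ j` steps, and the total distortion
vanishes if `τ j` tends to `0` fast enough compared with the constants `L' j`, which may be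
unbounded. -/
theorem exists_forward_vortex_flow (hσ : Measurable σ) (hσ1 : ∀ x, |σ x| ≤ 1) {k : Plane →ᵇ Plane}
    {A : ℝ} (hA : 0 ≤ A) (hk : LogLip A k) {κ : ℕ → Plane →ᵇ Plane} {L : ℕ → ℝ}
    (hκ : ∀ j, IsDivFree (L j) (κ j)) (hlim : Tendsto κ atTop (𝓝 k)) :
    ∃ p : ℝ → Plane →ᵇ Plane, p 0 = 0 ∧
      (∀ t, 0 ≤ t → HasDerivAt p (vortexField m k hσ hσ1 (p t)) t) ∧
      ∀ t, 0 ≤ t → MeasurePreserving (fun x => x + p t x) volume volume := by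
  have hm0 : 0 ≤ m.real univ := by positivity
  obtain ⟨B, hB⟩ := hlim.norm.bddAbove_range
  have hB' : ∀ j, ‖κ j‖ ≤ B := fun j => hB ⟨j, rfl⟩
  set L' : ℕ → ℝ := fun j => L j * ∫ y, |σ y| ∂m with hL'
  have hL0 : ∀ j, 0 ≤ L' j := fun j => mul_nonneg
    ((norm_nonneg _).trans ((hκ j).norm_fderiv_le 0)) (integral_nonneg fun y => abs_nonneg _)
  -- This choice gives at once `τ ≤ 1 / (j + 1)` for convergence, `τ L'² ≤ 1 / (j + 1)` for the
  -- total area distortion and `τ L' ≤ 1 / 2` for invertible steps.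
  set τ : ℕ → ℝ := fun j => 1 / ((j + 1) * (1 + L' j) ^ 2) with hτd
  have hτ : ∀ j, 0 < τ j := fun j => by have := hL0 j; positivity
  have hτ1 : ∀ j, τ j ≤ 1 / ((j : ℝ) + 1) := fun j => by
    have := hL0 j
    refine one_div_le_one_div_of_le (by positivity) (le_mul_of_one_le_right (by positivity) ?_)
    nlinarith
  have hτ2 : ∀ j, τ j * L' j ^ 2 ≤ 1 / ((j : ℝ) + 1) := fun j => by
    have := hL0 j
    rw [hτd, div_mul_eq_mul_div, div_le_div_iff₀ (by positivity) (by positivity)]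
    have h1 : L' j ^ 2 ≤ (1 + L' j) ^ 2 := by nlinarith
    have h2 : (0 : ℝ) ≤ (j : ℝ) + 1 := by positivity
    nlinarith
  have hτ3 : ∀ j, τ j * L' j ≤ 1 / 2 := fun j => by
    have := hL0 j
    rw [hτd, div_mul_eq_mul_div, div_le_div_iff₀ (by positivity) (by positivity)]
    have h2 : (0 : ℝ) ≤ j := by positivity
    have h3 : 2 * L' j ≤ (1 + L' j) ^ 2 := by nlinarith
    nlinarith [sq_nonneg (1 + L' j)]
  have hinv : Tendsto (fun j : ℕ => 1 / ((j : ℝ) + 1)) atTop (𝓝 0) :=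
    tendsto_one_div_add_atTop_nhds_zero_nat
  have hτ0 : Tendsto τ atTop (𝓝 0) := squeeze_zero (fun j => (hτ j).le) hτ1 hinv
  have hδ : Tendsto (fun j => ‖κ j - k‖ * m.real univ) atTop (𝓝 0) := by
    have := (tendsto_iff_norm_sub_tendsto_zero.mp hlim).mul_const (m.real univ)
    simpa using this
  obtain ⟨p, hp0, hp1, hp2⟩ := exists_tendsto_eulerNode (A := 2 * A * m.real univ + 1)
    (M := B * m.real univ)
    (by positivity)
    ((logLip_vortexField (m := m) hσ hσ1 hA hk).mono (by linarith))
    (G := fun j => vortexField m (κ j) hσ hσ1) (τ := τ)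
    (fun j ξ => (norm_vortexField_le hσ hσ1 (κ j) ξ).trans (by gcongr; exact hB' j)) hτ hτ0
    (fun j ξ => norm_vortexField_sub_le hσ hσ1 (κ j) k ξ) hδ 0
  refine ⟨p, hp0, hp1, fun t ht => ?_⟩
  set n : ℕ → ℕ := fun j => ⌊t / τ j⌋.toNat with hn
  set ξ : ℕ → ℕ → Plane →ᵇ Plane := fun j => eulerNode (vortexField m (κ j) hσ hσ1) (τ j) 0 with hξ
  have hnode : Tendsto (fun j => ξ j (n j)) atTop (𝓝 (p t)) := hp2 t ht
  obtain ⟨R, hR⟩ := hnode.norm.bddAbove_range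
  have hnτ : ∀ j, n j * τ j ≤ t := fun j => by
    have h0 : (0 : ℤ) ≤ ⌊t / τ j⌋ := Int.floor_nonneg.mpr (div_nonneg ht (hτ j).le)
    have h1 : ((n j : ℕ) : ℝ) = (⌊t / τ j⌋ : ℝ) := by exact_mod_cast Int.toNat_of_nonneg h0
    rw [h1, ← le_div_iff₀ (hτ j)]
    exact Int.floor_le _
  have hs : Tendsto (fun j => n j * (2 * (τ j * L' j) ^ 2)) atTop (𝓝 0) := by
    have h1 : Tendsto (fun j : ℕ => 2 * t * (1 / ((j : ℝ) + 1))) atTop (𝓝 0) := by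
      simpa using hinv.const_mul (2 * t)
    refine squeeze_zero (fun j => by positivity) (fun j => ?_) h1
    calc n j * (2 * (τ j * L' j) ^ 2) = 2 * (n j * τ j) * (τ j * L' j ^ 2) := by ring
      _ ≤ 2 * t * (1 / ((j : ℝ) + 1)) := by
        have := (hτ j).le
        have := hnτ j
        have := hτ2 j
        gcongr
  have hs0 : ∀ j, 0 ≤ 2 * (τ j * L' j) ^ 2 := fun j => by positivity
  have hs1 : ∀ j, 2 * (τ j * L' j) ^ 2 ≤ 1 := fun j => by
    have h1 := hτ3 j
    have h2 := mul_nonneg (hτ j).le (hL0 j)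
    nlinarith
  refine measurePreserving_of_tendsto (g := fun j x => x + ξ j (n j) x) (R := R)
    (fun j => continuous_id.add (ξ j (n j)).continuous) (continuous_id.add (p t).continuous)
    (fun x => tendsto_const_nhds.add ?_) (fun j x => ?_)
    (tendsto_ofReal_one_sub_pow hs0 hs1 hs) (tendsto_ofReal_one_add_pow hs0 hs) fun j f => ?_
  · exact ((BoundedContinuousFunction.evalCLM ℝ x).continuous.tendsto _).comp hnode
  · rw [add_sub_cancel_left]
    exact ((ξ j (n j)).norm_coe_le_norm x).trans (hR ⟨j, rfl⟩)
  · refine lintegral_iterated_steps (L := L' j) (hτ j).le (hτ3 j)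
      (u := fun i => vortexVelocity m (κ j) σ fun y => y + ξ j i y)
      (fun i => (hκ j).average (κ j).norm_coe_le_norm (integrable_weight hσ hσ1)
        (measurable_id.add (ξ j i).continuous.measurable).aemeasurable)
      (η := fun i x => x + ξ j i x) (fun x => ?_) (fun i x => ?_) (n j) f
    · simp [hξ, eulerNode]
    · simp only [hξ, eulerNode, BoundedContinuousFunction.coe_add, Pi.add_apply,
        BoundedContinuousFunction.coe_smul, vortexField_apply, add_assoc]

theorem vortexField_neg (hσ : Measurable σ) (hσ1 : ∀ x, |σ x| ≤ 1) (hσ' : Measurable fun x => -σ x)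
    (hσ1' : ∀ x, |-σ x| ≤ 1) (k ξ : Plane →ᵇ Plane) :
    vortexField m k hσ' hσ1' ξ = -vortexField m k hσ hσ1 ξ := by
  ext1 x
  simp only [BoundedContinuousFunction.coe_neg, Pi.neg_apply, vortexField_apply, vortexVelocity,
    neg_smul, integral_neg]

/-- Global existence for the vorticity equation in Lagrangian coordinates. -/
theorem exists_vortex_flow (hσ : Measurable σ) (hσ1 : ∀ x, |σ x| ≤ 1) {k : Plane →ᵇ Plane}
    {A : ℝ} (hA : 0 ≤ A) (hk : LogLip A k) {κ : ℕ → Plane →ᵇ Plane} {L : ℕ → ℝ}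
    (hκ : ∀ j, IsDivFree (L j) (κ j)) (hlim : Tendsto κ atTop (𝓝 k)) :
    ∃ ξ : ℝ → Plane →ᵇ Plane, ξ 0 = 0 ∧
      (∀ t, HasDerivAt ξ (vortexField m k hσ hσ1 (ξ t)) t) ∧
      ∀ t, MeasurePreserving (fun x => x + ξ t x) volume volume := by
  have hσ' : Measurable fun x => -σ x := hσ.neg
  have hσ1' : ∀ x, |-σ x| ≤ 1 := fun x => by rw [abs_neg]; exact hσ1 x
  obtain ⟨p, hp0, hp1, hp2⟩ := exists_forward_vortex_flow (m := m) hσ hσ1 hA hk hκ hlim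
  -- Reversal of time changes the sign of the velocity, which amounts to the opposite vorticity
  -- `-σ`. The backward solution is thus a forward one.
  obtain ⟨q, hq0, hq1, hq2⟩ := exists_forward_vortex_flow (m := m) hσ' hσ1' hA hk hκ hlim
  have hq1' : ∀ t, t ≤ 0 → HasDerivAt (fun s => q (-s)) (vortexField m k hσ hσ1 (q (-t))) t := by
    intro t ht
    have h1 : HasDerivAt (fun s : ℝ => -s) (-1) t := hasDerivAt_neg t
    have h2 := (hq1 (-t) (by linarith)).scomp t h1
    rw [vortexField_neg hσ hσ1 hσ' hσ1', neg_smul, one_smul, neg_neg] at h2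
    exact h2
  set ξ : ℝ → Plane →ᵇ Plane := fun t => if 0 ≤ t then p t else q (-t) with hξ
  have e1 : ∀ t, 0 ≤ t → ξ t = p t := fun t ht => if_pos ht
  have e2 : ∀ t, t ≤ 0 → ξ t = q (-t) := fun t ht => by
    rcases ht.eq_or_lt with h | h
    · simp [hξ, h, hp0, hq0]
    · simp [hξ, not_le.mpr h]
  refine ⟨ξ, by rw [e1 0 le_rfl, hp0], fun t => ?_, fun t => ?_⟩
  · rcases lt_trichotomy t 0 with h | h | h
    · have := hq1' t h.le
      rw [← e2 t h.le] at this
      refine this.congr_of_eventuallyEq ?_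
      filter_upwards [gt_mem_nhds h] with s hs
      exact e2 s (le_of_lt hs)
    · have h1 : HasDerivWithinAt ξ (vortexField m k hσ hσ1 (ξ t)) (Ici 0) t := by
        have := (hp1 t h.ge).hasDerivWithinAt (s := Ici 0)
        rw [← e1 t h.ge] at this
        exact this.congr (fun s hs => e1 s hs) (e1 t h.ge)
      have h2 : HasDerivWithinAt ξ (vortexField m k hσ hσ1 (ξ t)) (Iic 0) t := by
        have := (hq1' t h.le).hasDerivWithinAt (s := Iic 0)
        rw [← e2 t h.le] at this
        exact this.congr (fun s hs => e2 s hs) (e2 t h.le)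
      have h3 := h1.union h2
      rwa [Ici_union_Iic, hasDerivWithinAt_univ] at h3
    · have := hp1 t h.le
      rw [← e1 t h.le] at this
      refine this.congr_of_eventuallyEq ?_
      filter_upwards [lt_mem_nhds h] with s hs
      exact e1 s (le_of_lt hs)
  · rcases le_total 0 t with h | h
    · rw [e1 t h]; exact hp2 t h
    · rw [e2 t h]; exact hq2 (-t) (by linarith)

end VortexFlow

/-! ### Polar decomposition of signed measures -/

section SignedMeasure

variable {X : Type*} [MeasurableSpace X]

/-- The sign of a signed measure with respect to its total variation. -/
def signWeight (q : SignedMeasure X) : X → ℝ := by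
  classical
  exact q.toJordanDecomposition.mutuallySingular.nullSet.piecewise (fun _ => -1) fun _ => 1

theorem measurable_signWeight (q : SignedMeasure X) : Measurable (signWeight q) := by
  classical
  exact Measurable.piecewise q.toJordanDecomposition.mutuallySingular.measurableSet_nullSet
    measurable_const measurable_const

theorem abs_signWeight (q : SignedMeasure X) (x : X) : |signWeight q x| = 1 := by
  classical
  by_cases h : x ∈ q.toJordanDecomposition.mutuallySingular.nullSet <;> simp [signWeight, h]

theorem abs_signWeight_le (q : SignedMeasure X) (x : X) : |signWeight q x| ≤ 1 :=
  (abs_signWeight q x).le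

instance isFiniteMeasure_totalVariation (q : SignedMeasure X) : IsFiniteMeasure q.totalVariation := by
  rw [SignedMeasure.totalVariation]; infer_instance

variable {E : Type*} [NormedAddCommGroup E] [NormedSpace ℝ E]

/-- The weight is `1` almost everywhere for the positive part and `-1` for the negative part. The
signed integral becomes a Bochner integral against the total variation, where dominated convergence
and Fubini are available. -/
theorem signedIntegral_eq_integral (q : SignedMeasure X) {f : X → E}
    (hf : Integrable f q.totalVariation) :
    ∫ᵛ x, f x ∂<•q = ∫ x, signWeight q x • f x ∂q.totalVariation := by
  classical
  set j := q.toJordanDecomposition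
  have hq : q = j.posPart.toSignedMeasure - j.negPart.toSignedMeasure :=
    (SignedMeasure.toSignedMeasure_toJordanDecomposition q).symm
  have htv : q.totalVariation = j.posPart + j.negPart := rfl
  have hp : Integrable f j.posPart := hf.mono_measure (by rw [htv]; exact Measure.le_add_right le_rfl)
  have hn : Integrable f j.negPart := hf.mono_measure (by rw [htv]; exact Measure.le_add_left le_rfl)
  have e1 : (fun x => signWeight q x • f x) =ᵐ[j.posPart] f := by
    have : ∀ᵐ x ∂j.posPart, x ∉ j.mutuallySingular.nullSet :=
      measure_eq_zero_iff_ae_notMem.mp j.mutuallySingular.measure_nullSet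
    filter_upwards [this] with x hx
    simp only [signWeight, piecewise, if_neg hx, one_smul]
  have e2 : (fun x => signWeight q x • f x) =ᵐ[j.negPart] fun x => -f x := by
    have : ∀ᵐ x ∂j.negPart, x ∈ j.mutuallySingular.nullSet := by
      rw [ae_iff]; exact j.mutuallySingular.measure_compl_nullSet
    filter_upwards [this] with x hx
    simp only [signWeight, piecewise, if_pos hx, neg_smul, one_smul]
  rw [htv, integral_add_measure (hp.congr e1.symm) (hn.neg.congr e2.symm), integral_congr_ae e1,
    integral_congr_ae e2, integral_neg]
  conv_lhs => rw [hq]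
  rw [VectorMeasure.integral_sub_vectorMeasure, VectorMeasure.integral_toSignedMeasure,
    VectorMeasure.integral_toSignedMeasure, sub_eq_add_neg]
  · rw [VectorMeasure.Integrable, Measure.variation_toSignedMeasure]; exact hp
  · rw [VectorMeasure.Integrable, Measure.variation_toSignedMeasure]; exact hn

theorem norm_signedIntegral_le (q : SignedMeasure X) {f : X → E} {C : ℝ} (hC : ∀ x, ‖f x‖ ≤ C) :
    ‖∫ᵛ x, f x ∂<•q‖ ≤ C * q.totalVariation.real univ := by
  by_cases hf : Integrable f q.totalVariation
  · rw [signedIntegral_eq_integral q hf]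
    refine norm_integral_le_of_norm_le_const (Eventually.of_forall fun x => ?_)
    rw [norm_smul, Real.norm_eq_abs, abs_signWeight, one_mul]
    exact hC x
  -- A non-integrable `f` has integral `0` by convention. Any point of `X` shows `C ≥ 0`; if `X` is
  -- empty the total mass vanishes.
  · rw [VectorMeasure.integral_undef, norm_zero]
    · rcases isEmpty_or_nonempty X with h | ⟨⟨x⟩⟩
      · simp [univ_eq_empty_iff.mpr h]
      · exact mul_nonneg ((norm_nonneg _).trans (hC x)) (by positivity)
    · rwa [VectorMeasure.Integrable, ← SignedMeasure.totalVariation_eq_variation]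

theorem signedIntegral_sub (q : SignedMeasure X) {f g : X → E}
    (hf : Integrable f q.totalVariation) (hg : Integrable g q.totalVariation) :
    ∫ᵛ x, (f x - g x) ∂<•q = ∫ᵛ x, f x ∂<•q - ∫ᵛ x, g x ∂<•q := by
  apply VectorMeasure.integral_fun_sub <;>
    rwa [VectorMeasure.Integrable, ← SignedMeasure.totalVariation_eq_variation]

theorem signedIntegral_map (q : SignedMeasure X) {Y : Type*} [MeasurableSpace Y] {φ : X → Y} (hφ : Measurable φ)
    {f : Y → E} (hf : StronglyMeasurable f) {C : ℝ} (hC : ∀ y, ‖f y‖ ≤ C) :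
    ∫ᵛ y, f y ∂<•(q.map φ) = ∫ᵛ x, f (φ x) ∂<•q := by
  refine VectorMeasure.integral_map hφ hf.aestronglyMeasurable ?_
  rw [VectorMeasure.Integrable, ← SignedMeasure.totalVariation_eq_variation]
  exact Integrable.of_bound (hf.comp_measurable hφ).aestronglyMeasurable C
    (Eventually.of_forall fun x => hC _)

end SignedMeasure

/-! ### Duality with test functions and weak-* continuous curves of measures -/

section Plane

theorem integrable_of_bounded {q : SignedMeasure Plane} {E : Type*} [NormedAddCommGroup E]
    [SecondCountableTopology E] {f : Plane → E} (hf : Continuous f) {C : ℝ} (hC : ∀ x, ‖f x‖ ≤ C) :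
    Integrable f q.totalVariation :=
  Integrable.of_bound hf.aestronglyMeasurable C (Eventually.of_forall hC)

theorem exists_contDiff_integral_abs_sub_le (q : SignedMeasure Plane) {δ : ℝ} (hδ : 0 < δ) :
    ∃ g : Plane → ℝ, HasCompactSupport g ∧ ContDiff ℝ ∞ g ∧ Integrable g q.totalVariation ∧
      ∫ x, |signWeight q x - g x| ∂q.totalVariation ≤ δ := by
  have hσ : Integrable (signWeight q) q.totalVariation :=
    integrable_weight (measurable_signWeight q) (abs_signWeight_le q)
  obtain ⟨g, hg1, hg2, hg3⟩ := MemLp.exist_eLpNorm_sub_le ENNReal.one_ne_top le_rfl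
    (memLp_one_iff_integrable.mpr hσ) hδ
  have hg : Integrable g q.totalVariation := hg2.continuous.integrable_of_hasCompactSupport hg1
  refine ⟨g, hg1, hg2, hg, ?_⟩
  have h2 : ∫ x, |signWeight q x - g x| ∂q.totalVariation
      = (eLpNorm (signWeight q - g) 1 q.totalVariation).toReal := by
    rw [eLpNorm_one_eq_lintegral_enorm, ← integral_norm_eq_lintegral_enorm
      (hσ.sub hg).aestronglyMeasurable]
    rfl
  rw [h2]
  exact ENNReal.toReal_le_of_le_ofReal hδ.le hg3

/-- With `σ` the sign weight, `1 = σ² = σ g + σ (σ - g) ≤ σ g + |σ - g|` pointwise. A test function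
close to `σ` in `L¹` therefore nearly realises the total variation. -/
theorem totalVariation_le_integral_add (q : SignedMeasure Plane) {g : Plane → ℝ}
    (hg : Integrable g q.totalVariation) :
    q.totalVariation.real univ ≤
      ∫ᵛ x, g x ∂<•q + ∫ x, |signWeight q x - g x| ∂q.totalVariation := by
  have hσ : Integrable (signWeight q) q.totalVariation :=
    integrable_weight (measurable_signWeight q) (abs_signWeight_le q)
  have hσg : Integrable (fun x => signWeight q x • g x) q.totalVariation :=
    hg.bdd_mul (c := 1) hσ.aestronglyMeasurable (Eventually.of_forall (abs_signWeight_le q))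
  rw [signedIntegral_eq_integral q hg, ← integral_add (g := fun x => |signWeight q x - g x|) hσg (hσ.sub hg).abs]
  calc q.totalVariation.real univ = ∫ _, (1 : ℝ) ∂q.totalVariation := by simp
    _ ≤ _ := by
      refine integral_mono (integrable_const _) (hσg.add (hσ.sub hg).abs) fun x => ?_
      have h1 : signWeight q x * signWeight q x = 1 := by
        rw [← abs_mul_abs_self, abs_signWeight, one_mul]
      have h2 := le_abs_self (signWeight q x * (signWeight q x - g x))
      rw [abs_mul, abs_signWeight, one_mul, mul_sub, h1] at h2
      simp only [smul_eq_mul]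
      linarith

/-- The difference pairs to `0` with a test function approximating its own sign, so its total
variation is arbitrarily small. -/
theorem signedMeasure_ext_of_contDiff {q₁ q₂ : SignedMeasure Plane}
    (h : ∀ f : Plane → ℝ, ContDiff ℝ ∞ f → HasCompactSupport f →
      ∫ᵛ x, f x ∂<•q₁ = ∫ᵛ x, f x ∂<•q₂) : q₁ = q₂ := by
  rw [← sub_eq_zero]
  set q := q₁ - q₂ with hq
  have h0 : q.totalVariation.real univ ≤ 0 := by
    refine le_of_forall_pos_le_add fun δ hδ => ?_
    obtain ⟨g, hg1, hg2, hg3, hg4⟩ := exists_contDiff_integral_abs_sub_le q hδ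
    have := totalVariation_le_integral_add q hg3
    have e : ∫ᵛ x, g x ∂<•q = 0 := by
      have hi : ∀ p : SignedMeasure Plane, p.Integrable g := fun p => by
        rw [VectorMeasure.Integrable, ← SignedMeasure.totalVariation_eq_variation]
        exact hg2.continuous.integrable_of_hasCompactSupport hg1
      rw [hq, VectorMeasure.integral_sub_vectorMeasure (hi _) (hi _), h g hg2 hg1, sub_self]
    linarith
  ext s hs
  have h1 : q.totalVariation univ = 0 := by
    have := le_antisymm h0 measureReal_nonneg
    rwa [measureReal_eq_zero_iff] at this
  exact q.null_of_totalVariation_zero (measure_mono_null (subset_univ s) h1)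

/-- The functional on `C₀` defined by a signed measure. -/
def signedFunctional (q : SignedMeasure Plane) : C₀(Plane, ℝ) →L[ℝ] ℝ :=
  LinearMap.mkContinuous
    { toFun := fun f => ∫ᵛ x, f x ∂<•q
      map_add' := fun f g => by
        have hi : ∀ f : C₀(Plane, ℝ), q.Integrable f := fun f => by
          rw [VectorMeasure.Integrable, ← SignedMeasure.totalVariation_eq_variation]
          exact integrable_of_bounded f.continuous fun x => f.toBCF.norm_coe_le_norm x
        exact VectorMeasure.integral_add (hi f) (hi g)
      map_smul' := fun c f => VectorMeasure.integral_smul (⇑f) q _ c }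
    (q.totalVariation.real univ) fun f => by
      rw [mul_comm]
      exact norm_signedIntegral_le q fun x => f.toBCF.norm_coe_le_norm x

/-- A smooth approximation of the sign is truncated to `[-1, 1]`. This makes its norm at most `1`,
and brings it no farther from the sign, whose values are `±1`. -/
theorem totalVariation_le_of_functional_le (q : SignedMeasure Plane) {C : ℝ}
    (hC : ‖signedFunctional q‖ ≤ C) : q.totalVariation.real univ ≤ C := by
  refine le_of_forall_pos_le_add fun δ hδ => ?_
  obtain ⟨g, hg1, hg2, hg3, hg4⟩ := exists_contDiff_integral_abs_sub_le q hδ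
  set f : Plane → ℝ := fun x => max (-1) (min (g x) 1) with hf
  have hfc : Continuous f := continuous_const.max (hg2.continuous.min continuous_const)
  have hfs : HasCompactSupport f :=
    hg1.comp_left (g := fun r : ℝ => max (-1) (min r 1)) (by norm_num)
  have hf1 : ∀ x, ‖f x‖ ≤ 1 := fun x => by
    rw [Real.norm_eq_abs, abs_le]
    exact ⟨le_max_left _ _, max_le (by norm_num) (min_le_right _ _)⟩
  let F : C₀(Plane, ℝ) := ⟨⟨f, hfc⟩, by
    have := (hasCompactSupport_iff_eventuallyEq.mp hfs).tendsto
    rw [coclosedCompact_eq_cocompact] at this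
    exact this⟩
  have hF : ‖F‖ ≤ 1 := by
    rw [← ZeroAtInftyContinuousMap.norm_toBCF_eq_norm]
    exact (BoundedContinuousFunction.norm_le zero_le_one).mpr hf1
  have hfi : Integrable f q.totalVariation := integrable_of_bounded hfc hf1
  have h1 := totalVariation_le_integral_add q hfi
  have h2 : ∫ᵛ x, f x ∂<•q ≤ C := by
    have := (signedFunctional q).le_opNorm F
    have h3 : signedFunctional q F = ∫ᵛ x, f x ∂<•q := rfl
    rw [h3] at this
    refine (le_abs_self _).trans (this.trans ?_)
    exact (mul_le_of_le_one_right (norm_nonneg _) hF).trans hC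
  have hσ : Integrable (signWeight q) q.totalVariation :=
    integrable_weight (measurable_signWeight q) (abs_signWeight_le q)
  have h3 : ∫ x, |signWeight q x - f x| ∂q.totalVariation ≤
      ∫ x, |signWeight q x - g x| ∂q.totalVariation := by
    refine integral_mono (hσ.sub hfi).abs (hσ.sub hg3).abs fun x => ?_
    have := abs_signWeight_le q x
    simp only [hf]
    rw [abs_le] at this
    rcases le_total (g x) 1 with h | h <;> rcases le_total (-1) (g x) with h' | h'
    · simp [min_eq_left h, max_eq_right h']
    · rw [min_eq_left h, max_eq_left h', abs_of_nonneg (by linarith), abs_of_nonneg (by linarith)]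
      linarith
    · rw [min_eq_right h, max_eq_right (by norm_num), abs_of_nonpos (by linarith),
        abs_of_nonpos (by linarith)]
      linarith
    · linarith
  linarith

/-- Each pairing is continuous, hence bounded on a compact time interval; the uniform boundedness
principle then bounds the masses. -/
theorem exists_totalVariation_le {q : ℝ → SignedMeasure Plane}
    (hq : ∀ f : C₀(Plane, ℝ), Continuous fun t => ∫ᵛ x, f x ∂<•(q t)) (T : ℝ) :
    ∃ M, 0 ≤ M ∧ ∀ t, |t| ≤ T → (q t).totalVariation.real univ ≤ M := by
  obtain ⟨C, hC⟩ := banach_steinhaus (g := fun t : Icc (-T) T => signedFunctional (q t)) fun f => by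
    obtain ⟨C, hC⟩ := (isCompact_Icc (a := -T) (b := T)).exists_bound_of_continuousOn
      (hq f).continuousOn
    exact ⟨C, fun t => hC t t.2⟩
  refine ⟨max C 0, le_max_right _ _, fun t ht => ?_⟩
  exact (totalVariation_le_of_functional_le _ (hC ⟨t, abs_le.mp ht⟩)).trans (le_max_left _ _)

/-- Pairings of weak-* continuous curves of measures with continuous functions of compact
support. -/
theorem continuous_signedIntegral {q : ℝ → SignedMeasure Plane}
    (hq : ∀ f : C₀(Plane, ℝ), Continuous fun t => ∫ᵛ x, f x ∂<•(q t)) {F : ℝ → Plane → ℝ}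
    (hF : Continuous fun p : ℝ × Plane => F p.1 p.2)
    (hK : ∀ T, ∃ R, ∀ t, |t| ≤ T → ∀ x, R < ‖x‖ → F t x = 0) :
    Continuous fun t => ∫ᵛ x, F t x ∂<•(q t) := by
  rw [continuous_iff_continuousAt]
  intro t₀
  obtain ⟨R, hR⟩ := hK (|t₀| + 1)
  obtain ⟨M, hM0, hM⟩ := exists_totalVariation_le hq (|t₀| + 1)
  have hFt : ∀ t, Continuous (F t) := fun t => hF.comp (Continuous.prodMk_right t)
  have hs : HasCompactSupport (F t₀) :=
    HasCompactSupport.intro (isCompact_closedBall 0 R) fun x hx =>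
      hR t₀ (by linarith [abs_nonneg t₀]) x (by simpa using hx)
  let G : C₀(Plane, ℝ) := ⟨⟨F t₀, hFt t₀⟩, by
    have := (hasCompactSupport_iff_eventuallyEq.mp hs).tendsto
    rw [coclosedCompact_eq_cocompact] at this
    exact this⟩
  have hG : Tendsto (fun t => ∫ᵛ x, F t₀ x ∂<•(q t)) (𝓝 t₀) (𝓝 (∫ᵛ x, F t₀ x ∂<•(q t₀))) :=
    (hq G).tendsto t₀
  -- On a fixed ball `F t` converges uniformly to `F t₀`, and the masses are bounded near `t₀`; the
  -- fixed test function `F t₀` is covered by weak-* continuity.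
  have hdiff : Tendsto (fun t => ∫ᵛ x, F t x ∂<•(q t) - ∫ᵛ x, F t₀ x ∂<•(q t)) (𝓝 t₀) (𝓝 0) := by
    rw [Metric.tendsto_nhds]
    intro ε hε
    have h1 : ∀ᶠ t in 𝓝 t₀, ∀ x ∈ Metric.closedBall (0 : Plane) R,
        ‖F t x - F t₀ x‖ ≤ ε / (2 * (M + 1)) := by
      refine (isCompact_closedBall (0 : Plane) R).eventually_forall_of_forall_eventually fun x _ => ?_
      have hc : Continuous fun p : ℝ × Plane => ‖F p.1 p.2 - F t₀ p.2‖ :=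
        (hF.sub ((hFt t₀).comp continuous_snd)).norm
      have := hc.tendsto (t₀, x)
      simp only [sub_self, norm_zero] at this
      exact (this.eventually_lt_const (u := ε / (2 * (M + 1))) (by positivity)).mono
        fun p hp => le_of_lt hp
    have h2 : ∀ᶠ t in 𝓝 t₀, |t| ≤ |t₀| + 1 :=
      (continuous_abs.tendsto t₀).eventually_le_const (by linarith)
    filter_upwards [h1, h2] with t ht1 ht2
    have hb : ∀ x, ‖F t x - F t₀ x‖ ≤ ε / (2 * (M + 1)) := fun x => by
      by_cases hx : ‖x‖ ≤ R
      · exact ht1 x (by simpa using hx)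
      · rw [hR t ht2 x (not_le.mp hx), hR t₀ (by linarith) x (not_le.mp hx), sub_self, norm_zero]
        positivity
    have hi : ∀ s, |s| ≤ |t₀| + 1 → Integrable (F s) (q t).totalVariation := fun s hs =>
      (hFt s).integrable_of_hasCompactSupport
        (HasCompactSupport.intro (isCompact_closedBall 0 R) fun x hx =>
          hR s hs x (by simpa using hx))
    rw [dist_zero_right, ← signedIntegral_sub _ (hi t ht2) (hi t₀ (by linarith))]
    calc _ ≤ ε / (2 * (M + 1)) * (q t).totalVariation.real univ := norm_signedIntegral_le _ hb
      _ ≤ ε / (2 * (M + 1)) * (M + 1) := by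
        refine mul_le_mul_of_nonneg_left ?_ (by positivity)
        linarith [hM t ht2]
      _ = ε / 2 := by field_simp
      _ < ε := by linarith
  have := hdiff.add hG
  simp only [sub_add_cancel, zero_add] at this
  exact this

end Plane

/-! ### Transported vorticity is a weak solution -/

section Existence

theorem norm_one_prod_le {C : ℝ} (hC : 0 ≤ C) {v : Plane} (hv : ‖v‖ ≤ C) :
    ‖((1 : ℝ), v)‖ ≤ 1 + C := by
  rw [Prod.norm_def]
  exact max_le (by simpa using hC) (hv.trans (by linarith))

theorem continuous_clm_apply_one {α : Type*} [TopologicalSpace α]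
    {L : α → ℝ × Plane →L[ℝ] ℝ} (hL : Continuous L) {v : α → Plane} (hv : Continuous v) :
    Continuous fun a => L a (1, v a) :=
  hL.clm_apply (continuous_const.prodMk hv)

/-- The transport equation for the image of a measure under a flow, tested against `ψ`. -/
theorem integral_integral_deriv_along_flow {m : Measure Plane} [IsFiniteMeasure m] {σ : Plane → ℝ}
    (hσ : Measurable σ) (hσ1 : ∀ x, |σ x| ≤ 1) {η v : ℝ → Plane → Plane}
    (hη : Continuous fun p : ℝ × Plane => η p.1 p.2)
    (hv : Continuous fun p : ℝ × Plane => v p.1 p.2) {C : ℝ} (hC0 : 0 ≤ C)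
    (hC : ∀ t x, ‖v t x‖ ≤ C)
    (hd : ∀ t x, HasDerivAt (fun s => η s x) (v t x) t) {ψ : ℝ × Plane → ℝ}
    (hψ : ContDiff ℝ ∞ ψ) (hψc : HasCompactSupport ψ) :
    ∫ t, ∫ y, σ y * fderiv ℝ ψ (t, η t y) (1, v t y) ∂m = 0 := by
  set Θ : ℝ → Plane → ℝ := fun t y => fderiv ℝ ψ (t, η t y) (1, v t y) with hΘ
  have hfd : Continuous (fderiv ℝ ψ) := hψ.continuous_fderiv (by simp)
  have hpair : Continuous fun p : ℝ × Plane => (p.1, η p.1 p.2) := continuous_fst.prodMk hη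
  have hΘc : Continuous fun p : ℝ × Plane => Θ p.1 p.2 :=
    continuous_clm_apply_one (hfd.comp hpair) hv
  obtain ⟨D, hD⟩ := (hψc.fderiv (𝕜 := ℝ)).exists_bound_of_continuous hfd
  have hD0 : 0 ≤ D := (norm_nonneg _).trans (hD 0)
  obtain ⟨T, hT⟩ := hψc.isCompact.isBounded.exists_norm_le
  have hout : ∀ t x, T < |t| → (t, x) ∉ tsupport ψ := fun t x ht h => by
    have := (norm_fst_le _).trans (hT _ h)
    exact absurd this (not_le.mpr ht)
  have hΘ0 : ∀ t y, T < |t| → Θ t y = 0 := fun t y ht => by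
    have : fderiv ℝ ψ (t, η t y) = 0 :=
      image_eq_zero_of_notMem_tsupport fun h => hout t _ ht (tsupport_fderiv_subset ℝ h)
    simp [hΘ, this]
  have hΘb : ∀ t y, ‖Θ t y‖ ≤ D * (1 + C) := fun t y =>
    (ContinuousLinearMap.le_opNorm _ _).trans
      (mul_le_mul (hD _) (norm_one_prod_le hC0 (hC t y)) (norm_nonneg _) hD0)
  have hint : Integrable (fun p : ℝ × Plane => σ p.2 * Θ p.1 p.2) (volume.prod m) := by
    have hm : AEStronglyMeasurable (fun p : ℝ × Plane => σ p.2 * Θ p.1 p.2) (volume.prod m) :=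
      ((hσ.comp measurable_snd).mul hΘc.measurable).aestronglyMeasurable
    rw [← integrableOn_iff_integrable_of_support_subset (s := Icc (-T) T ×ˢ univ)]
    · refine Measure.integrableOn_of_bounded (M := D * (1 + C)) ?_ hm
        (Eventually.of_forall fun p => ?_)
      · rw [Measure.prod_prod]
        exact ENNReal.mul_ne_top (by simp) (by simp)
      · rw [norm_mul]
        exact (mul_le_of_le_one_left (norm_nonneg _) (hσ1 _)).trans (hΘb _ _)
    · intro p hp
      refine ⟨?_, mem_univ _⟩
      rw [mem_Icc, ← abs_le]
      by_contra h
      exact hp (by simp [hΘ0 p.1 p.2 (not_le.mp h)])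
  -- For a fixed particle `y` the time integrand is the derivative of the compactly supported
  -- function `t ↦ ψ (t, η t y)`.
  rw [integral_integral_swap hint]
  refine integral_eq_zero_of_ae (Eventually.of_forall fun y => ?_)
  have hder : ∀ t, HasDerivAt (fun t => ψ (t, η t y)) (Θ t y) t := fun t => by
    have h1 : HasFDerivAt ψ (fderiv ℝ ψ (t, η t y)) (t, η t y) :=
      (hψ.differentiable (by simp) _).hasFDerivAt
    exact h1.comp_hasDerivAt t ((hasDerivAt_id t).prodMk (hd t y))
  have hcs : ∀ f : ℝ → ℝ, Continuous f → (∀ t, T < |t| → f t = 0) → Integrable f := fun f hf h =>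
    hf.integrable_of_hasCompactSupport (HasCompactSupport.intro (isCompact_closedBall 0 T)
      fun t ht => h t (by simpa using ht))
  have h0 : ∫ t, Θ t y = 0 := by
    refine integral_eq_zero_of_hasDerivAt_of_integrable hder (hcs _ ?_ fun t ht => hΘ0 t y ht)
      (hcs _ ?_ fun t ht => image_eq_zero_of_notMem_tsupport (hout t _ ht))
    · exact hΘc.comp (Continuous.prodMk_left y)
    · exact hψ.continuous.comp (hpair.comp (Continuous.prodMk_left y))
  simp only [integral_const_mul, Pi.zero_apply]
  exact mul_eq_zero_of_right _ h0

variable {q₀ : SignedMeasure Plane} {k : Plane →ᵇ Plane} {ξ : ℝ → Plane →ᵇ Plane}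
  {η : ℝ → Plane ≃ₜ Plane}

theorem continuous_flow (hξ : Continuous ξ) (hη : ∀ t x, η t x = x + ξ t x) :
    Continuous fun p : ℝ × Plane => η p.1 p.2 := by
  simp only [hη]
  exact continuous_snd.add
    ((hξ.comp continuous_fst).eval continuous_snd)

theorem continuous_transportVelocity (hη : Continuous fun p : ℝ × Plane => η p.1 p.2) :
    Continuous fun p : ℝ × Plane =>
      vortexVelocity q₀.totalVariation k (signWeight q₀) (η p.1) p.2 := by
  refine continuous_of_dominated (bound := fun _ => ‖k‖)
    (fun p => (integrable_vortex (measurable_signWeight q₀) (abs_signWeight_le q₀) k.continuous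
      k.norm_coe_le_norm (η p.1).continuous.measurable p.2).aestronglyMeasurable)
    (fun p => Eventually.of_forall fun y => ?_) (integrable_const _)
    (Eventually.of_forall fun y => ?_)
  · rw [norm_smul]
    exact (mul_le_of_le_one_left (norm_nonneg _) (abs_signWeight_le _ _)).trans
      (k.norm_coe_le_norm _)
  · have : Continuous fun p : ℝ × Plane => k (p.2 - η p.1 y) :=
      k.continuous.comp (continuous_snd.sub (hη.comp (continuous_fst.prodMk continuous_const)))
    exact this.const_smul (signWeight q₀ y)

theorem signedIntegral_map_homeomorph (q₀ : SignedMeasure Plane) (e : Plane ≃ₜ Plane)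
    {E : Type*} [NormedAddCommGroup E] [NormedSpace ℝ E] [SecondCountableTopology E]
    {f : Plane → E} (hf : Continuous f) {C : ℝ} (hC : ∀ x, ‖f x‖ ≤ C) :
    ∫ᵛ x, f x ∂<•(q₀.map e) = ∫ y, signWeight q₀ y • f (e y) ∂q₀.totalVariation := by
  rw [signedIntegral_map q₀ e.continuous.measurable hf.stronglyMeasurable hC,
    signedIntegral_eq_integral q₀ (f := fun y => f (e y))
      (integrable_of_bounded (hf.comp e.continuous) fun x => hC (e x))]

theorem velocity_eq_of_map (q₀ : SignedMeasure Plane) (e : Plane ≃ₜ Plane) (x : Plane) :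
    ∫ᵛ y, k (x - y) ∂<•(q₀.map e)
      = vortexVelocity q₀.totalVariation k (signWeight q₀) e x := by
  rw [signedIntegral_map_homeomorph q₀ e (f := fun y => k (x - y)) (k.continuous.comp (continuous_sub_left x))
    fun y => k.norm_coe_le_norm _]
  rfl

/-- Integrals against the image of `q₀` are integrals over particle labels against the fixed measure
`|q₀|`. Continuity in time then follows by dominated convergence, and the weak equation from the
chain rule along particle paths. -/
theorem isGlobalWeakSolution_of_flow {h : Plane → ℝ} (hk : ∀ x, k x = regKernel h x)
    (hξ0 : ξ 0 = 0)
    (hξ : ∀ t, HasDerivAt ξ (vortexField q₀.totalVariation k (measurable_signWeight q₀)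
      (abs_signWeight_le q₀) (ξ t)) t)
    (hη : ∀ t x, η t x = x + ξ t x) (hmp : ∀ t, MeasurePreserving (η t) volume volume) :
    IsGlobalWeakSolution h q₀ η
      (fun t => vortexVelocity q₀.totalVariation k (signWeight q₀) (η t))
      (fun t => q₀.map (η t)) := by
  have hηc : Continuous fun p : ℝ × Plane => η p.1 p.2 :=
    continuous_flow (continuous_iff_continuousAt.mpr fun t => (hξ t).continuousAt) hη
  have huc := continuous_transportVelocity (q₀ := q₀) (k := k) hηc
  have hηfun : ∀ t, (η t : Plane → Plane) = fun y => y + ξ t y := fun t => funext (hη t)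
  have hη0 : ∀ x, η 0 x = x := fun x => by simp [hη, hξ0]
  have hd : ∀ t x, HasDerivAt (fun s => η s x)
      (vortexVelocity q₀.totalVariation k (signWeight q₀) (η t) (η t x)) t := fun t x => by
    have h1 := (BoundedContinuousFunction.evalCLM ℝ x).hasFDerivAt.comp_hasDerivAt t (hξ t)
    have h2 := h1.const_add x
    simp only [hηfun]
    exact h2
  have hb : ∀ t x, ‖vortexVelocity q₀.totalVariation k (signWeight q₀) (η t) x‖
      ≤ ‖k‖ * q₀.totalVariation.real univ := fun t x =>
    norm_vortexVelocity_le (abs_signWeight_le q₀) k.norm_coe_le_norm _ _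
  refine ⟨fun f => ?_, fun t x => ?_, huc, hmp, hηc, hd, hη0, ?_, fun ψ hψ hψc => ?_⟩
  · have : ∀ t, ∫ᵛ x, f x ∂<•(q₀.map (η t))
        = ∫ y, signWeight q₀ y • f (η t y) ∂q₀.totalVariation := fun t =>
      signedIntegral_map_homeomorph q₀ (η t) f.continuous fun x => f.toBCF.norm_coe_le_norm x
    simp only [this]
    refine continuous_of_dominated (bound := fun _ => ‖f.toBCF‖)
      (fun t => ((measurable_signWeight q₀).aestronglyMeasurable.smul
        (f.continuous.comp (η t).continuous).aestronglyMeasurable))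
      (fun t => Eventually.of_forall fun y => ?_) (integrable_const _)
      (Eventually.of_forall fun y => ?_)
    · rw [norm_smul]
      exact (mul_le_of_le_one_left (norm_nonneg _) (abs_signWeight_le _ _)).trans
        (f.toBCF.norm_coe_le_norm _)
    · have : Continuous fun t => f (η t y) :=
        f.continuous.comp (hηc.comp (Continuous.prodMk_left y))
      exact this.const_smul (signWeight q₀ y)
  · rw [← velocity_eq_of_map]
    simp only [hk]
  · ext s hs
    rw [VectorMeasure.map_apply _ (η 0).continuous.measurable hs]
    congr 1
    ext x
    simp [hη0]
  · have hfd : Continuous (fderiv ℝ ψ) := hψ.continuous_fderiv (by simp)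
    obtain ⟨D, hD⟩ := (hψc.fderiv (𝕜 := ℝ)).exists_bound_of_continuous hfd
    have hD0 : 0 ≤ D := (norm_nonneg _).trans (hD 0)
    have e : ∀ t, ∫ᵛ x, fderiv ℝ ψ (t, x)
        (1, vortexVelocity q₀.totalVariation k (signWeight q₀) (η t) x) ∂<•(q₀.map (η t))
        = ∫ y, signWeight q₀ y * fderiv ℝ ψ (t, η t y)
          (1, vortexVelocity q₀.totalVariation k (signWeight q₀) (η t) (η t y))
            ∂q₀.totalVariation := fun t => by
      refine signedIntegral_map_homeomorph q₀ (η t) (C := D * (1 + ‖k‖ * q₀.totalVariation.real univ))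
        (continuous_clm_apply_one (hfd.comp (Continuous.prodMk_right t))
          (huc.comp (Continuous.prodMk_right t))) fun x => ?_
      exact (ContinuousLinearMap.le_opNorm _ _).trans
        (mul_le_mul (hD _) (norm_one_prod_le (by positivity) (hb t x)) (norm_nonneg _) hD0)
    simp only [e]
    exact integral_integral_deriv_along_flow (measurable_signWeight q₀) (abs_signWeight_le q₀)
      (v := fun t y => vortexVelocity q₀.totalVariation k (signWeight q₀) (η t) (η t y)) hηc
      (huc.comp (continuous_fst.prodMk hηc)) (by positivity) (fun t x => hb t _) hd hψ hψc

theorem isC1Flow_of_hasDerivAt {v : ℝ → Plane →ᵇ Plane} (hξ : ∀ t, HasDerivAt ξ (v t) t)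
    (hv : Continuous v) (hη : ∀ t x, η t x = x + ξ t x)
    (hmp : ∀ t, MeasurePreserving (η t) volume volume) : IsC1Flow η := by
  refine ⟨hmp, fun t => v t, fun t => (v t).continuous, fun t => ?_, fun t => ?_⟩
  · have := hasDerivAt_iff_tendsto_slope.mp (hξ t)
    rw [BoundedContinuousFunction.tendsto_iff_tendstoUniformly] at this
    have e : (fun s x => (s - t)⁻¹ • (η s x - η t x)) = fun s x => slope ξ t s x := by
      ext1 s
      ext1 x
      simp [slope_def_module, hη]
    rw [e]
    exact this
  · exact BoundedContinuousFunction.tendsto_iff_tendstoUniformly.mp (hv.tendsto t)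

theorem tendstoUniformly_transportVelocity {A : ℝ} (hA : 0 < A) (hk : LogLip A k)
    (hξ : Continuous ξ) (hη : ∀ t x, η t x = x + ξ t x) (t : ℝ) :
    TendstoUniformly (fun t => vortexVelocity q₀.totalVariation k (signWeight q₀) (η t))
      (vortexVelocity q₀.totalVariation k (signWeight q₀) (η t)) (𝓝 t) := by
  rw [Metric.tendstoUniformly_iff]
  intro ε hε
  set M := q₀.totalVariation.real univ
  have hM : 0 ≤ M := measureReal_nonneg
  have hκ : 0 < ε / (2 * (M + 1)) := by positivity
  obtain ⟨δ, hδ, H⟩ := LogLip.uniform (E := Plane) (G := Plane) hA hκ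
  have hclose : ∀ᶠ s in 𝓝 t, ‖ξ s - ξ t‖ < δ := by
    have := (hξ.tendsto t).sub_const (ξ t)
    rw [sub_self] at this
    exact (this.norm).eventually_lt_const (by simpa using hδ)
  filter_upwards [hclose] with s hs x
  rw [dist_eq_norm]
  have := norm_vortexVelocity_sub_le (m := q₀.totalVariation) (measurable_signWeight q₀)
    (abs_signWeight_le q₀) k.continuous k.norm_coe_le_norm k.continuous k.norm_coe_le_norm
    (η t).continuous.measurable (η s).continuous.measurable (x := x) (x' := x)
    (δ := ε / (2 * (M + 1))) fun y => by
      refine H k hk _ _ ?_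
      have e : x - η t y - (x - η s y) = (ξ s - ξ t) y := by
        rw [hη, hη]; simp
      rw [e]
      exact ((ξ s - ξ t).norm_coe_le_norm y).trans hs.le
  calc _ ≤ ε / (2 * (M + 1)) * M := this
    _ ≤ ε / (2 * (M + 1)) * (M + 1) := by
      refine mul_le_mul_of_nonneg_left ?_ hκ.le
      linarith
    _ = ε / 2 := by field_simp
    _ < ε := by linarith

end Existence

/-! ### Mollification in time and in space-time -/

section Mollification

open ContinuousLinearMap Convolution

/-- The mollification of `G` has the mollification of `D` as its derivative, to which the mean value
inequality applies; the width then tends to `0`. Mollifiers of width at most `1` explain why `D` is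
bounded up to `T + 1`. -/
theorem norm_sub_le_of_weak_deriv {G D : ℝ → ℝ} (hG : Continuous G) (hD : Continuous D) {δ T : ℝ}
    (hδ : 0 ≤ δ) (hT : 0 ≤ T) (hDδ : ∀ s, |s| ≤ T + 1 → |D s| ≤ δ)
    (hw : ∀ θ : ℝ → ℝ, ContDiff ℝ 1 θ → HasCompactSupport θ →
      ∫ s, (deriv θ s * G s + θ s * D s) = 0) {t : ℝ} (ht : |t| ≤ T) :
    |G t - G 0| ≤ δ * |t| := by
  let b : ℕ → ContDiffBump (0 : ℝ) := fun n =>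
    ⟨1 / (n + 1) / 2, 1 / (n + 1), by positivity, half_lt_self (by positivity)⟩
  have hb0 : Tendsto (fun n => (b n).rOut) atTop (𝓝 0) := tendsto_one_div_add_atTop_nhds_zero_nat
  have hb1 : ∀ n, (b n).rOut ≤ 1 := fun n => by
    change 1 / ((n : ℝ) + 1) ≤ 1
    rw [div_le_one (by positivity)]
    linarith [(Nat.cast_nonneg n : (0 : ℝ) ≤ n)]
  have hlim : ∀ s, Tendsto (fun n => ((b n).normed volume ⋆[lsmul ℝ ℝ, volume] G) s) atTop (𝓝 (G s)) :=
    fun s => ContDiffBump.convolution_tendsto_right_of_continuous hb0 hG s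
  have hmain : ∀ n, |((b n).normed volume ⋆[lsmul ℝ ℝ, volume] G) t
      - ((b n).normed volume ⋆[lsmul ℝ ℝ, volume] G) 0| ≤ δ * |t| := fun n => by
    set f : ℝ → ℝ := (b n).normed volume with hf
    have hfc : ContDiff ℝ 1 f := (b n).contDiff_normed (n := 1)
    have hfs : HasCompactSupport f := (b n).hasCompactSupport_normed
    have hder : ∀ s, HasDerivAt (f ⋆[lsmul ℝ ℝ, volume] G) ((f ⋆[lsmul ℝ ℝ, volume] D) s) s := by
      intro s
      have h1 := hfs.hasDerivAt_convolution_left (lsmul ℝ ℝ) hfc (hG.locallyIntegrable (μ := volume)) s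
      suffices e : (f ⋆[lsmul ℝ ℝ, volume] D) s = (deriv f ⋆[lsmul ℝ ℝ, volume] G) s by
        rw [e]; exact h1
      -- The reflected and translated mollifier is the test function that equates the two
      -- convolutions at `s`.
      set θ : ℝ → ℝ := fun r => f (s - r) with hθ
      have hθd : ∀ r, deriv θ r = -deriv f (s - r) := fun r => by
        exact deriv_comp_const_sub f s r
      have hθc : ContDiff ℝ 1 θ := hfc.comp (contDiff_const.sub contDiff_id)
      have hθs : HasCompactSupport θ := hfs.comp_homeomorph (Homeomorph.subLeft s)
      have h2 := hw θ hθc hθs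
      have i1 : Integrable fun r => deriv θ r * G r :=
        ((hθc.continuous_deriv le_rfl).mul hG).integrable_of_hasCompactSupport hθs.deriv.mul_right
      have i2 : Integrable fun r => θ r * D r :=
        (hθc.continuous.mul hD).integrable_of_hasCompactSupport hθs.mul_right
      rw [integral_add i1 i2] at h2
      rw [convolution_eq_swap, convolution_eq_swap]
      simp only [lsmul_apply, smul_eq_mul]
      simp only [hθd, neg_mul, integral_neg] at h2
      linarith
    have hbd : ∀ s ∈ Icc (-T) T, ‖(f ⋆[lsmul ℝ ℝ, volume] D) s‖ ≤ δ := by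
      intro s hs
      rw [← dist_zero_right]
      refine dist_convolution_le hδ (R := 1) ?_ (b n).nonneg_normed (b n).integral_normed
        hD.aestronglyMeasurable fun x hx => ?_
      · rw [hf, (b n).support_normed_eq]
        exact Metric.ball_subset_ball (hb1 n)
      · rw [dist_zero_right]
        refine hDδ x ?_
        rw [Metric.mem_ball, Real.dist_eq] at hx
        have := abs_le.mpr hs
        calc |x| = |(x - s) + s| := by ring_nf
          _ ≤ |x - s| + |s| := abs_add_le _ _
          _ ≤ T + 1 := by linarith
    have := (convex_Icc (-T) T).norm_image_sub_le_of_norm_hasDerivWithin_le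
      (fun s _ => (hder s).hasDerivWithinAt) hbd (x := 0) (y := t) ⟨by linarith, hT⟩ (abs_le.mp ht)
    simpa using this
  exact le_of_tendsto (((hlim t).sub (hlim 0)).abs) (Eventually.of_forall hmain)

/-- Convolution with a smooth bump commutes with the derivative, which is uniformly continuous. A
bump of radius at most `1` enlarges the support by at most `1`. -/
theorem exists_contDiff_fderiv_near {ψ : ℝ × Plane → ℝ} (hψ : ContDiff ℝ 1 ψ) {R : ℝ}
    (hR : ∀ p, R < ‖p‖ → ψ p = 0) {ε : ℝ} (hε : 0 < ε) :
    ∃ ψ' : ℝ × Plane → ℝ, ContDiff ℝ ∞ ψ' ∧ HasCompactSupport ψ' ∧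
      (∀ p, ‖fderiv ℝ ψ' p - fderiv ℝ ψ p‖ ≤ ε) ∧ ∀ p, R + 1 < ‖p‖ → fderiv ℝ ψ' p = 0 := by
  have hc : HasCompactSupport ψ := HasCompactSupport.intro (isCompact_closedBall 0 R) fun p hp =>
    hR p (by simpa using hp)
  have hfc : Continuous (fderiv ℝ ψ) := hψ.continuous_fderiv one_ne_zero
  have huc : UniformContinuous (fderiv ℝ ψ) := (hc.fderiv (𝕜 := ℝ)).uniformContinuous_of_continuous hfc
  obtain ⟨δ, hδ, H⟩ := Metric.uniformContinuous_iff.mp huc ε hε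
  let b : ContDiffBump (0 : ℝ × Plane) :=
    ⟨min δ 1 / 2, min δ 1, by positivity, half_lt_self (by positivity)⟩
  set f : ℝ × Plane → ℝ := b.normed volume with hf
  have : (volume : Measure (ℝ × Plane)).IsAddHaarMeasure :=
    Measure.prod.instIsAddHaarMeasure volume volume
  have hfi : LocallyIntegrable f volume := b.continuous_normed.locallyIntegrable
  have hder : ∀ p, fderiv ℝ (f ⋆[lsmul ℝ ℝ, volume] ψ) p
      = (f ⋆[lsmul ℝ ℝ, volume] fderiv ℝ ψ) p := fun p =>
    (hc.hasFDerivAt_convolution_right (lsmul ℝ ℝ) hfi hψ p).fderiv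
  have hvan : ∀ p, R < ‖p‖ → fderiv ℝ ψ p = 0 := fun p hp => by
    have : ψ =ᶠ[𝓝 p] fun _ => 0 := by
      filter_upwards [continuous_norm.isOpen_preimage _ isOpen_Ioi |>.mem_nhds hp] with y hy
      exact hR y hy
    rw [this.fderiv_eq, fderiv_fun_const]
    rfl
  refine ⟨f ⋆[lsmul ℝ ℝ, volume] ψ, ?_, ?_, fun p => ?_, fun p hp => ?_⟩
  · exact b.hasCompactSupport_normed.contDiff_convolution_left _ (b.contDiff_normed (n := ⊤))
      hψ.continuous.locallyIntegrable
  · exact b.hasCompactSupport_normed.convolution _ hc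
  · rw [hder, ← dist_eq_norm]
    refine b.dist_normed_convolution_le hfc.aestronglyMeasurable fun x hx => ?_
    exact (H (lt_of_lt_of_le hx (min_le_left _ _))).le
  · rw [hder, ← norm_le_zero_iff]
    have h0 := hvan p (by linarith)
    have := b.dist_normed_convolution_le (μ := volume) (x₀ := p) (ε := 0) hfc.aestronglyMeasurable fun x hx => by
      have hx1 : dist x p < 1 := lt_of_lt_of_le hx (min_le_right _ _)
      have : R < ‖x‖ := by
        have := norm_sub_norm_le p x
        rw [← dist_eq_norm, dist_comm] at this
        linarith
      rw [hvan x this, h0, dist_self]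
    rwa [h0, dist_zero_right] at this

end Mollification

/-! ### The weak equation with moving test functions -/

section WeakEquation

variable {q : ℝ → SignedMeasure Plane} {u : ℝ → Plane → Plane}

theorem continuous_pairing
    (hq : ∀ f : C₀(Plane, ℝ), Continuous fun t => ∫ᵛ x, f x ∂<•(q t))
    (hu : Continuous fun p : ℝ × Plane => u p.1 p.2) {L : ℝ × Plane → ℝ × Plane →L[ℝ] ℝ}
    (hL : Continuous L) (hK : ∀ T, ∃ R, ∀ t, |t| ≤ T → ∀ x, R < ‖x‖ → L (t, x) = 0) :
    Continuous fun t => ∫ᵛ x, L (t, x) (1, u t x) ∂<•(q t) := by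
  refine continuous_signedIntegral hq (F := fun t x => L (t, x) (1, u t x))
    (continuous_clm_apply_one hL hu) fun T => ?_
  obtain ⟨R, hR⟩ := hK T
  exact ⟨R, fun t ht x hx => by simp [hR t ht x hx]⟩

/-- The weak equation extends to test functions of class `C¹`. -/
theorem weak_equation_of_contDiff_one
    (hq : ∀ f : C₀(Plane, ℝ), Continuous fun t => ∫ᵛ x, f x ∂<•(q t))
    (hu : Continuous fun p : ℝ × Plane => u p.1 p.2)
    (hw : ∀ ψ : ℝ × Plane → ℝ, ContDiff ℝ ∞ ψ → HasCompactSupport ψ →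
      ∫ t, (∫ᵛ x, fderiv ℝ ψ (t, x) (1, u t x) ∂<•(q t)) = 0)
    {ψ : ℝ × Plane → ℝ} (hψ : ContDiff ℝ 1 ψ) (hψc : HasCompactSupport ψ) :
    ∫ t, (∫ᵛ x, fderiv ℝ ψ (t, x) (1, u t x) ∂<•(q t)) = 0 := by
  obtain ⟨R, hR⟩ := hψc.isCompact.isBounded.exists_norm_le
  have hR' : ∀ p, R < ‖p‖ → ψ p = 0 := fun p hp =>
    image_eq_zero_of_notMem_tsupport fun h => absurd (hR p h) (not_le.mpr hp)
  have hDR : ∀ p, R + 1 < ‖p‖ → fderiv ℝ ψ p = 0 := fun p hp =>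
    image_eq_zero_of_notMem_tsupport fun h =>
      absurd (hR p (tsupport_fderiv_subset ℝ h)) (not_le.mpr (by linarith))
  obtain ⟨C, hC⟩ := (isCompact_closedBall (0 : ℝ × Plane) (R + 1)).exists_bound_of_continuousOn
    hu.continuousOn
  obtain ⟨M, hM0, hM⟩ := exists_totalVariation_le hq (R + 1)
  have hvan : ∀ L : ℝ × Plane → ℝ × Plane →L[ℝ] ℝ, (∀ p, R + 1 < ‖p‖ → L p = 0) →
      (∀ t x, R + 1 < |t| → L (t, x) = 0) ∧ ∀ t x, R + 1 < ‖x‖ → L (t, x) = 0 := fun L hL =>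
    ⟨fun t x ht => hL _ (lt_of_lt_of_le ht (norm_fst_le (t, x))),
      fun t x hx => hL _ (lt_of_lt_of_le hx (norm_snd_le (t, x)))⟩
  have hint : ∀ L : ℝ × Plane → ℝ × Plane →L[ℝ] ℝ, Continuous L → (∀ p, R + 1 < ‖p‖ → L p = 0) →
      Integrable fun t => ∫ᵛ x, L (t, x) (1, u t x) ∂<•(q t) := fun L hL hL0 => by
    refine (continuous_pairing hq hu hL fun T => ⟨R + 1, fun t _ => (hvan L hL0).2 t⟩
      ).integrable_of_hasCompactSupport
      (HasCompactSupport.intro (isCompact_closedBall 0 (R + 1)) fun t ht => ?_)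
    have ht : R + 1 < |t| := by simpa using ht
    have : ∀ x, L (t, x) (1, u t x) = 0 := fun x => by simp [(hvan L hL0).1 t x ht]
    simp [this]
  have hint' : ∀ L : ℝ × Plane → ℝ × Plane →L[ℝ] ℝ, Continuous L → (∀ p, R + 1 < ‖p‖ → L p = 0) →
      ∀ t, Integrable (fun x => L (t, x) (1, u t x)) (q t).totalVariation := fun L hL hL0 t => by
    refine (continuous_clm_apply_one (hL.comp (Continuous.prodMk_right t))
      (hu.comp (Continuous.prodMk_right t))).integrable_of_hasCompactSupport
      (HasCompactSupport.intro (isCompact_closedBall 0 (R + 1)) fun x hx => ?_)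
    have hx : R + 1 < ‖x‖ := by simpa using hx
    change L (t, x) (1, u t x) = 0
    simp [(hvan L hL0).2 t x hx]
  have hfc : Continuous (fderiv ℝ ψ) := hψ.continuous_fderiv one_ne_zero
  have hlen : volume.real (Icc (-(R + 1)) (R + 1)) ≤ 2 * |R + 1| := by
    rw [Real.volume_real_Icc]
    refine max_le ?_ (by positivity)
    linarith [le_abs_self (R + 1)]
  have hest : ∀ ε > 0, ‖∫ t, (∫ᵛ x, fderiv ℝ ψ (t, x) (1, u t x) ∂<•(q t))‖
      ≤ ε * ((1 + max C 0) * M * (2 * |R + 1|)) := fun ε hε => by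
    obtain ⟨ψ', h1, h2, h3, h4⟩ := exists_contDiff_fderiv_near hψ hR' hε
    have hfc' : Continuous (fderiv ℝ ψ') := h1.continuous_fderiv (by simp)
    have e := integral_sub (hint _ hfc hDR) (hint _ hfc' h4)
    rw [hw ψ' h1 h2, sub_zero] at e
    rw [← e]
    have hb : ∀ t, |t| ≤ R + 1 → ‖∫ᵛ x, fderiv ℝ ψ (t, x) (1, u t x) ∂<•(q t)
        - ∫ᵛ x, fderiv ℝ ψ' (t, x) (1, u t x) ∂<•(q t)‖ ≤ ε * (1 + max C 0) * M := fun t ht => by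
      rw [← signedIntegral_sub _ (hint' _ hfc hDR t) (hint' _ hfc' h4 t)]
      refine (norm_signedIntegral_le (C := ε * (1 + max C 0)) _ fun x => ?_).trans
        (mul_le_mul_of_nonneg_left (hM t ht) (by positivity))
      by_cases hx : ‖((t, x) : ℝ × Plane)‖ ≤ R + 1
      · rw [← sub_apply]
        refine (ContinuousLinearMap.le_opNorm _ _).trans (mul_le_mul ?_ ?_ (norm_nonneg _) hε.le)
        · rw [norm_sub_rev]; exact h3 _
        · exact norm_one_prod_le (le_max_right _ _)
            ((hC (t, x) (by simpa using hx)).trans (le_max_left _ _))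
      · rw [hDR _ (not_le.mp hx), h4 _ (not_le.mp hx)]
        simp only [zero_apply, sub_self, norm_zero]
        positivity
    have hset : ∀ t, t ∉ Icc (-(R + 1)) (R + 1) → ∫ᵛ x, fderiv ℝ ψ (t, x) (1, u t x) ∂<•(q t)
        - ∫ᵛ x, fderiv ℝ ψ' (t, x) (1, u t x) ∂<•(q t) = 0 := fun t ht => by
      rw [mem_Icc, ← abs_le, not_le] at ht
      simp [(hvan _ hDR).1 t _ ht, (hvan _ h4).1 t _ ht]
    rw [← setIntegral_eq_integral_of_forall_compl_eq_zero hset]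
    refine (norm_setIntegral_le_of_norm_le_const measure_Icc_lt_top fun t ht =>
      hb t (abs_le.mpr ht)).trans ?_
    calc _ ≤ ε * (1 + max C 0) * M * (2 * |R + 1|) :=
          mul_le_mul_of_nonneg_left hlen (by positivity)
      _ = _ := by ring
  set Z := (1 + max C 0) * M * (2 * |R + 1|) with hZ
  have hZ0 : 0 ≤ Z := by positivity
  rw [← norm_le_zero_iff]
  refine le_of_forall_pos_le_add fun ε hε => ?_
  rw [zero_add]
  refine (hest (ε / (Z + 1)) (by positivity)).trans ?_
  rw [div_mul_eq_mul_div, div_le_iff₀ (by positivity)]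
  nlinarith

/-- Growth of the pairing of a weak solution with a moving test function. -/
theorem abs_pairing_sub_le
    (hq : ∀ f : C₀(Plane, ℝ), Continuous fun t => ∫ᵛ x, f x ∂<•(q t))
    (hu : Continuous fun p : ℝ × Plane => u p.1 p.2)
    (hw : ∀ ψ : ℝ × Plane → ℝ, ContDiff ℝ ∞ ψ → HasCompactSupport ψ →
      ∫ t, (∫ᵛ x, fderiv ℝ ψ (t, x) (1, u t x) ∂<•(q t)) = 0)
    {g : ℝ × Plane → ℝ} (hg : ContDiff ℝ 1 g)
    (hK : ∀ T, ∃ R, ∀ t, |t| ≤ T → ∀ x, R < ‖x‖ → g (t, x) = 0)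
    {T δ M : ℝ} (hT : 0 ≤ T) (hδ : 0 ≤ δ) (hM0 : 0 ≤ M)
    (hM : ∀ t, |t| ≤ T + 1 → (q t).totalVariation.real univ ≤ M)
    (hgδ : ∀ t, |t| ≤ T + 1 → ∀ x, |fderiv ℝ g (t, x) (1, u t x)| ≤ δ) {t : ℝ} (ht : |t| ≤ T) :
    |∫ᵛ x, g (t, x) ∂<•(q t) - ∫ᵛ x, g (0, x) ∂<•(q 0)| ≤ δ * M * |t| := by
  have hgd : Differentiable ℝ g := hg.differentiable one_ne_zero
  have hfc : Continuous (fderiv ℝ g) := hg.continuous_fderiv one_ne_zero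
  have hK' : ∀ T, ∃ R, ∀ t, |t| ≤ T → ∀ x, R < ‖x‖ → fderiv ℝ g (t, x) = 0 := fun T => by
    obtain ⟨R, hR⟩ := hK (T + 1)
    refine ⟨R, fun t ht x hx => ?_⟩
    have : g =ᶠ[𝓝 (t, x)] fun _ => 0 := by
      have h1 : ∀ᶠ p : ℝ × Plane in 𝓝 (t, x), |p.1| < T + 1 :=
        (continuous_abs.comp continuous_fst).continuousAt.eventually_lt continuousAt_const
          (by simpa using lt_of_le_of_lt ht (lt_add_one T))
      have h2 : ∀ᶠ p : ℝ × Plane in 𝓝 (t, x), R < ‖p.2‖ :=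
        continuousAt_const.eventually_lt (continuous_norm.comp continuous_snd).continuousAt hx
      filter_upwards [h1, h2] with p hp1 hp2
      exact hR p.1 hp1.le p.2 hp2
    rw [this.fderiv_eq, fderiv_fun_const]
    rfl
  -- The weak equation tested with `θ(t) g(t, x)` says that the pairing of `q` with `g` has the
  -- pairing with `∂ₜ g + u · ∇g` as its weak time derivative.
  refine norm_sub_le_of_weak_deriv (G := fun t => ∫ᵛ x, g (t, x) ∂<•(q t))
    (D := fun t => ∫ᵛ x, fderiv ℝ g (t, x) (1, u t x) ∂<•(q t))
    (continuous_signedIntegral hq (F := fun t x => g (t, x)) hg.continuous hK)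
    (continuous_pairing hq hu hfc hK') (mul_nonneg hδ hM0) hT (fun s hs => ?_)
    (fun θ hθ hθc => ?_) ht
  · exact (norm_signedIntegral_le (q s)
      (f := fun x => fderiv ℝ g (s, x) (1, u s x)) (hgδ s hs)).trans (mul_le_mul_of_nonneg_left (hM s hs) hδ)
  · obtain ⟨S, hS⟩ := hθc.isCompact.isBounded.exists_norm_le
    obtain ⟨R, hR⟩ := hK S
    have hψ : ContDiff ℝ 1 fun p : ℝ × Plane => θ p.1 * g p := (hθ.comp contDiff_fst).mul hg
    have hψc : HasCompactSupport fun p : ℝ × Plane => θ p.1 * g p := by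
      refine HasCompactSupport.intro ((isCompact_closedBall (0 : ℝ) S).prod
        (isCompact_closedBall (0 : Plane) R)) fun p hp => ?_
      by_cases h1 : |p.1| ≤ S
      · have h2 : R < ‖p.2‖ := by
          by_contra h
          exact hp ⟨by simpa using h1, by simpa using h⟩
        rw [show p = (p.1, p.2) from rfl, hR p.1 h1 p.2 h2, mul_zero]
      · have : θ p.1 = 0 := image_eq_zero_of_notMem_tsupport fun h => h1 (hS _ h)
        rw [this, zero_mul]
    rw [← weak_equation_of_contDiff_one hq hu hw hψ hψc]
    refine integral_congr_ae (Eventually.of_forall fun s => ?_)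
    have hfd : ∀ x, fderiv ℝ (fun p : ℝ × Plane => θ p.1 * g p) (s, x) (1, u s x)
        = deriv θ s * g (s, x) + θ s * fderiv ℝ g (s, x) (1, u s x) := fun x => by
      have h1 : HasFDerivAt (fun p : ℝ × Plane => θ p.1)
          ((fderiv ℝ θ s).comp (ContinuousLinearMap.fst ℝ ℝ Plane)) (s, x) :=
        ((hθ.differentiable one_ne_zero s).hasFDerivAt).comp (s, x) hasFDerivAt_fst
      have h2 : HasFDerivAt (fun p : ℝ × Plane => θ p.1 * g p) _ (s, x) :=
        h1.mul (hgd (s, x)).hasFDerivAt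
      rw [h2.fderiv]
      simp
      ring
    have i1 : Integrable (fun x => g (s, x)) (q s).totalVariation := by
      obtain ⟨R, hR⟩ := hK |s|
      exact (hg.continuous.comp (Continuous.prodMk_right s)).integrable_of_hasCompactSupport
        (HasCompactSupport.intro (isCompact_closedBall 0 R) fun x hx =>
          hR s le_rfl x (by simpa using hx))
    have i2 : Integrable (fun x => fderiv ℝ g (s, x) (1, u s x)) (q s).totalVariation := by
      obtain ⟨R, hR⟩ := hK' |s|
      refine (continuous_clm_apply_one (hfc.comp (Continuous.prodMk_right s))
        (hu.comp (Continuous.prodMk_right s))).integrable_of_hasCompactSupport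
        (HasCompactSupport.intro (isCompact_closedBall 0 R) fun x hx => ?_)
      change fderiv ℝ g (s, x) (1, u s x) = 0
      rw [hR s le_rfl x (by simpa using hx)]
      rfl
    simp only [hfd]
    rw [signedIntegral_eq_integral _ i1, signedIntegral_eq_integral _ i2, signedIntegral_eq_integral _
      (f := fun x => deriv θ s * g (s, x) + θ s * fderiv ℝ g (s, x) (1, u s x))
      ((i1.const_mul _).add (i2.const_mul _)), ← integral_const_mul, ← integral_const_mul,
      ← integral_add]
    · refine integral_congr_ae (Eventually.of_forall fun x => ?_)
      simp only [smul_eq_mul]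
      ring
    · exact (i1.bdd_mul (c := 1) (measurable_signWeight _).aestronglyMeasurable
        (Eventually.of_forall (abs_signWeight_le _))).const_mul _
    · exact (i2.bdd_mul (c := 1) (measurable_signWeight _).aestronglyMeasurable
        (Eventually.of_forall (abs_signWeight_le _))).const_mul _

end WeakEquation

/-! ### Averages along a measure preserving flow -/

section FlowAverage

variable {η v : ℝ → Plane → Plane} {ρ φ : Plane → ℝ}

/-- The derivative of `(t, x) ↦ ρ (x - η t z)`. -/
def flowKernelDeriv (ρ : Plane → ℝ) (η v : ℝ → Plane → Plane) (p : ℝ × Plane) (z : Plane) :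
    ℝ × Plane →L[ℝ] ℝ :=
  (fderiv ℝ ρ (p.2 - η p.1 z)).comp
    (ContinuousLinearMap.snd ℝ ℝ Plane - (ContinuousLinearMap.fst ℝ ℝ Plane).smulRight (v p.1 z))

theorem flowKernelDeriv_apply (p : ℝ × Plane) (z w : Plane) :
    flowKernelDeriv ρ η v p z (1, w) = fderiv ℝ ρ (p.2 - η p.1 z) (w - v p.1 z) := by
  simp [flowKernelDeriv]

theorem continuous_flowKernelDeriv (hρ : ContDiff ℝ 1 ρ)
    (hη : Continuous fun p : ℝ × Plane => η p.1 p.2)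
    (hv : Continuous fun p : ℝ × Plane => v p.1 p.2) :
    Continuous fun a : (ℝ × Plane) × Plane => flowKernelDeriv ρ η v a.1 a.2 := by
  have hpair : Continuous fun a : (ℝ × Plane) × Plane => (a.1.1, a.2) :=
    (continuous_fst.comp continuous_fst).prodMk continuous_snd
  have h1 : Continuous fun a : (ℝ × Plane) × Plane => fderiv ℝ ρ (a.1.2 - η a.1.1 a.2) :=
    (hρ.continuous_fderiv one_ne_zero).comp
      ((continuous_snd.comp continuous_fst).sub (hη.comp hpair))
  have h2 : Continuous fun a : (ℝ × Plane) × Plane => v a.1.1 a.2 := hv.comp hpair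
  have h3 : Continuous fun a : (ℝ × Plane) × Plane =>
      (ContinuousLinearMap.fst ℝ ℝ Plane).smulRight (v a.1.1 a.2) :=
    (ContinuousLinearMap.smulRightL ℝ (ℝ × Plane) Plane
      (ContinuousLinearMap.fst ℝ ℝ Plane)).continuous.comp h2
  exact h1.clm_comp (continuous_const.sub h3)

theorem hasFDerivAt_flowKernel (hρ : ContDiff ℝ 1 ρ)
    (hd : ∀ t x, HasDerivAt (fun s => η s x) (v t x) t) (p : ℝ × Plane) (z : Plane) :
    HasFDerivAt (fun p : ℝ × Plane => ρ (p.2 - η p.1 z)) (flowKernelDeriv ρ η v p z) p := by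
  have h1 : HasFDerivAt (fun p : ℝ × Plane => η p.1 z)
      ((ContinuousLinearMap.fst ℝ ℝ Plane).smulRight (v p.1 z)) p := by
    have := (hd p.1 z).hasFDerivAt.comp p hasFDerivAt_fst
    refine this.congr_fderiv ?_
    ext <;> simp
  exact ((hρ.differentiable one_ne_zero _).hasFDerivAt).comp p (hasFDerivAt_snd.sub h1)

theorem fderiv_eq_zero_of_one_lt (hρ0 : ∀ x, 1 ≤ ‖x‖ → ρ x = 0) {x : Plane} (hx : 1 < ‖x‖) :
    fderiv ℝ ρ x = 0 := by
  have : ρ =ᶠ[𝓝 x] fun _ => 0 := by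
    filter_upwards [continuous_norm.continuousAt.eventually (lt_mem_nhds hx)] with y hy
    exact hρ0 y hy.le
  rw [this.fderiv_eq, fderiv_fun_const]
  rfl

theorem exists_radius_flowKernel (hS : ∀ T, ∃ S, ∀ t, |t| ≤ T → ∀ z, ‖η t z - z‖ ≤ S) (T : ℝ) :
    ∃ R, ∀ p : ℝ × Plane, ‖p‖ ≤ T → ∀ z, R < ‖z‖ → 1 < ‖p.2 - η p.1 z‖ := by
  obtain ⟨S, hS⟩ := hS T
  refine ⟨T + S + 1, fun p hp z hz => ?_⟩
  have h1 := hS p.1 ((norm_fst_le p).trans hp) z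
  have h2 := (norm_snd_le p).trans hp
  have h3 : ‖z‖ ≤ ‖p.2 - η p.1 z‖ + ‖η p.1 z - z‖ + ‖p.2‖ := by
    calc ‖z‖ = ‖p.2 - (p.2 - η p.1 z) - (η p.1 z - z)‖ := by congr 1; abel
      _ ≤ ‖p.2 - (p.2 - η p.1 z)‖ + ‖η p.1 z - z‖ := norm_sub_le _ _
      _ ≤ ‖p.2‖ + ‖p.2 - η p.1 z‖ + ‖η p.1 z - z‖ := by gcongr; exact norm_sub_le _ _
      _ = _ := by ring
  linarith

theorem exists_dominating_flowKernelDeriv (hρ : ContDiff ℝ 1 ρ) (hρ0 : ∀ x, 1 ≤ ‖x‖ → ρ x = 0)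
    (hη : Continuous fun p : ℝ × Plane => η p.1 p.2)
    (hv : Continuous fun p : ℝ × Plane => v p.1 p.2)
    (hS : ∀ T, ∃ S, ∀ t, |t| ≤ T → ∀ z, ‖η t z - z‖ ≤ S) (hφ : Continuous φ) (p₀ : ℝ × Plane) :
    ∃ bound : Plane → ℝ, Integrable bound ∧ ∀ z, ∀ p ∈ Metric.ball p₀ 1,
      ‖φ z • flowKernelDeriv ρ η v p z‖ ≤ bound z := by
  obtain ⟨R, hR⟩ := exists_radius_flowKernel hS (‖p₀‖ + 1)
  have hc : Continuous fun a : (ℝ × Plane) × Plane => φ a.2 • flowKernelDeriv ρ η v a.1 a.2 :=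
    (hφ.comp continuous_snd).smul (continuous_flowKernelDeriv hρ hη hv)
  obtain ⟨B, hB⟩ := ((isCompact_closedBall p₀ 1).prod
    (isCompact_closedBall (0 : Plane) R)).exists_bound_of_continuousOn hc.continuousOn
  refine ⟨(Metric.closedBall (0 : Plane) R).indicator fun _ => B, ?_, fun z p hp => ?_⟩
  · exact (integrable_indicator_iff measurableSet_closedBall).mpr
      (integrableOn_const (isCompact_closedBall (0 : Plane) R).measure_lt_top.ne)
  · by_cases hz : z ∈ Metric.closedBall (0 : Plane) R
    · rw [indicator_of_mem hz]
      exact hB (p, z) ⟨Metric.ball_subset_closedBall hp, hz⟩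
    · rw [indicator_of_notMem hz]
      have hp' : ‖p‖ ≤ ‖p₀‖ + 1 := by
        have := norm_sub_norm_le p p₀
        rw [Metric.mem_ball, dist_eq_norm] at hp
        linarith
      have : flowKernelDeriv ρ η v p z = 0 := by
        rw [flowKernelDeriv, fderiv_eq_zero_of_one_lt hρ0 (hR p hp' z (by simpa using hz)),
          ContinuousLinearMap.zero_comp]
      rw [this, smul_zero, norm_zero]

theorem integrable_smul_flowKernelDeriv (hρ : ContDiff ℝ 1 ρ) (hρ0 : ∀ x, 1 ≤ ‖x‖ → ρ x = 0)
    (hη : Continuous fun p : ℝ × Plane => η p.1 p.2)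
    (hv : Continuous fun p : ℝ × Plane => v p.1 p.2)
    (hS : ∀ T, ∃ S, ∀ t, |t| ≤ T → ∀ z, ‖η t z - z‖ ≤ S) (hφ : Continuous φ) (p : ℝ × Plane) :
    Integrable fun z => φ z • flowKernelDeriv ρ η v p z := by
  obtain ⟨b, hb, hbd⟩ := exists_dominating_flowKernelDeriv hρ hρ0 hη hv hS hφ p
  refine hb.mono' (hφ.smul ((continuous_flowKernelDeriv hρ hη hv).comp
    (Continuous.prodMk_right p))).aestronglyMeasurable (Eventually.of_forall fun z => ?_)
  exact hbd z p (Metric.mem_ball_self one_pos)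

theorem hasFDerivAt_flowAverage (hρ : ContDiff ℝ 1 ρ) (hρ0 : ∀ x, 1 ≤ ‖x‖ → ρ x = 0)
    (hη : Continuous fun p : ℝ × Plane => η p.1 p.2)
    (hv : Continuous fun p : ℝ × Plane => v p.1 p.2)
    (hd : ∀ t x, HasDerivAt (fun s => η s x) (v t x) t)
    (hS : ∀ T, ∃ S, ∀ t, |t| ≤ T → ∀ z, ‖η t z - z‖ ≤ S) (hφ : Continuous φ) (p : ℝ × Plane) :
    HasFDerivAt (fun p : ℝ × Plane => ∫ z, φ z * ρ (p.2 - η p.1 z))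
      (∫ z, φ z • flowKernelDeriv ρ η v p z) p := by
  obtain ⟨b, hb, hbd⟩ := exists_dominating_flowKernelDeriv hρ hρ0 hη hv hS hφ p
  have hc : ∀ p : ℝ × Plane, Continuous fun z => φ z * ρ (p.2 - η p.1 z) := fun p =>
    hφ.mul (hρ.continuous.comp (continuous_const.sub (hη.comp (Continuous.prodMk_right p.1))))
  refine hasFDerivAt_integral_of_dominated_of_fderiv_le (Metric.ball_mem_nhds p one_pos)
    (Eventually.of_forall fun p => (hc p).aestronglyMeasurable) ?_
    (integrable_smul_flowKernelDeriv hρ hρ0 hη hv hS hφ p).aestronglyMeasurable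
    (Eventually.of_forall hbd) hb
    (Eventually.of_forall fun z p _ => (hasFDerivAt_flowKernel hρ hd p z).const_smul (φ z))
  obtain ⟨R, hR⟩ := exists_radius_flowKernel hS ‖p‖
  refine (hc p).integrable_of_hasCompactSupport
    (HasCompactSupport.intro (isCompact_closedBall 0 R) fun z hz => ?_)
  rw [hρ0 _ (hR p le_rfl z (by simpa using hz)).le, mul_zero]

/-- All space derivatives fall on `ρ`, so no differentiability of the flow in space is required. In
time the flow is only `C¹`, and so is the average. -/
theorem contDiff_flowAverage (hρ : ContDiff ℝ 1 ρ) (hρ0 : ∀ x, 1 ≤ ‖x‖ → ρ x = 0)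
    (hη : Continuous fun p : ℝ × Plane => η p.1 p.2)
    (hv : Continuous fun p : ℝ × Plane => v p.1 p.2)
    (hd : ∀ t x, HasDerivAt (fun s => η s x) (v t x) t)
    (hS : ∀ T, ∃ S, ∀ t, |t| ≤ T → ∀ z, ‖η t z - z‖ ≤ S) (hφ : Continuous φ) :
    ContDiff ℝ 1 fun p : ℝ × Plane => ∫ z, φ z * ρ (p.2 - η p.1 z) := by
  refine contDiff_one_iff_hasFDerivAt.mpr ⟨fun p => ∫ z, φ z • flowKernelDeriv ρ η v p z, ?_,
    hasFDerivAt_flowAverage hρ hρ0 hη hv hd hS hφ⟩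
  rw [continuous_iff_continuousAt]
  intro p
  obtain ⟨b, hb, hbd⟩ := exists_dominating_flowKernelDeriv hρ hρ0 hη hv hS hφ p
  refine continuousAt_of_dominated (bound := b)
    (Eventually.of_forall fun p =>
      (integrable_smul_flowKernelDeriv hρ hρ0 hη hv hS hφ p).aestronglyMeasurable)
    ?_ hb (Eventually.of_forall fun z => ?_)
  · filter_upwards [Metric.ball_mem_nhds p one_pos] with p' hp'
    exact Eventually.of_forall fun z => hbd z p' hp'
  · exact (((continuous_flowKernelDeriv hρ hη hv).comp
      (Continuous.prodMk_left z)).const_smul (φ z)).continuousAt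

theorem fderiv_flowAverage_apply (hρ : ContDiff ℝ 1 ρ) (hρ0 : ∀ x, 1 ≤ ‖x‖ → ρ x = 0)
    (hη : Continuous fun p : ℝ × Plane => η p.1 p.2)
    (hv : Continuous fun p : ℝ × Plane => v p.1 p.2)
    (hd : ∀ t x, HasDerivAt (fun s => η s x) (v t x) t)
    (hS : ∀ T, ∃ S, ∀ t, |t| ≤ T → ∀ z, ‖η t z - z‖ ≤ S) (hφ : Continuous φ) (t : ℝ) (x w : Plane) :
    fderiv ℝ (fun p : ℝ × Plane => ∫ z, φ z * ρ (p.2 - η p.1 z)) (t, x) (1, w)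
      = ∫ z, φ z * fderiv ℝ ρ (x - η t z) (w - v t z) := by
  rw [(hasFDerivAt_flowAverage hρ hρ0 hη hv hd hS hφ (t, x)).fderiv,
    ContinuousLinearMap.integral_apply (integrable_smul_flowKernelDeriv hρ hρ0 hη hv hS hφ (t, x))]
  refine integral_congr_ae (Eventually.of_forall fun z => ?_)
  simp only [smul_apply, flowKernelDeriv_apply, smul_eq_mul]

theorem integral_flow_eq {e : Plane → Plane} (he : MeasurableEmbedding e)
    (hmp : MeasurePreserving e volume volume) (f : Plane → ℝ) (x : Plane) :
    ∫ z, f (x - e z) = ∫ w, f w := by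
  rw [hmp.integral_comp he fun w => f (x - w)]
  exact integral_sub_left_eq_self f volume x

/-- Cancellation in the derivative of an average along a measure preserving flow. -/
theorem abs_fderiv_flowAverage_le (hρ : ContDiff ℝ 1 ρ) {ε : ℝ} (hε1 : ε ≤ 1)
    (hρ0 : ∀ x, ε ≤ ‖x‖ → ρ x = 0) (hη : Continuous fun p : ℝ × Plane => η p.1 p.2)
    (hv : Continuous fun p : ℝ × Plane => v p.1 p.2)
    (hd : ∀ t x, HasDerivAt (fun s => η s x) (v t x) t)
    (hS : ∀ T, ∃ S, ∀ t, |t| ≤ T → ∀ z, ‖η t z - z‖ ≤ S) (hφ : Continuous φ)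
    (he : ∀ t, MeasurableEmbedding (η t)) (hmp : ∀ t, MeasurePreserving (η t) volume volume)
    {t : ℝ} {x w : Plane} {z₀ : Plane} {B : ℝ}
    (hB : ∀ z, ‖x - η t z‖ ≤ ε → |φ z - φ z₀| * ‖w - v t z‖ ≤ B) :
    |fderiv ℝ (fun p : ℝ × Plane => ∫ z, φ z * ρ (p.2 - η p.1 z)) (t, x) (1, w)|
      ≤ B * ∫ y, ‖fderiv ℝ ρ y‖ := by
  have hρ1 : ∀ x, 1 ≤ ‖x‖ → ρ x = 0 := fun x hx => hρ0 x (hε1.trans hx)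
  have hfd0 : ∀ x, ε < ‖x‖ → fderiv ℝ ρ x = 0 := fun x hx => by
    have : ρ =ᶠ[𝓝 x] fun _ => 0 := by
      filter_upwards [continuous_norm.continuousAt.eventually (lt_mem_nhds hx)] with y hy
      exact hρ0 y hy.le
    rw [this.fderiv_eq, fderiv_fun_const]
    rfl
  have hint : ∀ φ : Plane → ℝ, Continuous φ →
      Integrable fun z => φ z * fderiv ℝ ρ (x - η t z) (w - v t z) := fun φ hφ => by
    have := (integrable_smul_flowKernelDeriv hρ hρ1 hη hv hS hφ (t, x)).apply_continuousLinearMap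
      ((1 : ℝ), w)
    refine this.congr (Eventually.of_forall fun z => ?_)
    simp only [smul_apply, flowKernelDeriv_apply, smul_eq_mul]
  -- For the constant function `φ z₀` the average is `φ z₀ ∫ ρ` at every `(t, x)`, since `η t`
  -- preserves area. Its derivative vanishes, so `φ` may be replaced by `φ - φ z₀`.
  have hone : ∫ z, φ z₀ * fderiv ℝ ρ (x - η t z) (w - v t z) = 0 := by
    rw [← fderiv_flowAverage_apply hρ hρ1 hη hv hd hS (continuous_const (y := φ z₀))]
    have : (fun p : ℝ × Plane => ∫ z, φ z₀ * ρ (p.2 - η p.1 z))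
        = fun _ => φ z₀ * ∫ y, ρ y := by
      ext p
      rw [integral_const_mul, integral_flow_eq (he _) (hmp _)]
    rw [this, fderiv_fun_const]
    rfl
  rw [fderiv_flowAverage_apply hρ hρ1 hη hv hd hS hφ, ← sub_zero (∫ z, _), ← hone,
    ← integral_sub (hint φ hφ) (hint _ continuous_const), ← Real.norm_eq_abs]
  have hDi : Integrable fun z => ‖fderiv ℝ ρ (x - η t z)‖ := by
    have h1 : Integrable (fderiv ℝ ρ) := (hρ.continuous_fderiv one_ne_zero
      ).integrable_of_hasCompactSupport (HasCompactSupport.intro (isCompact_closedBall 0 ε)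
        fun y hy => hfd0 y (by simpa using hy))
    exact (((hmp t).integrable_comp_emb (he t)).mpr (h1.comp_sub_left x)).norm
  calc _ ≤ ∫ z, B * ‖fderiv ℝ ρ (x - η t z)‖ := by
        refine norm_integral_le_of_norm_le (hDi.const_mul B) (Eventually.of_forall fun z => ?_)
        rw [← sub_mul, norm_mul, Real.norm_eq_abs]
        by_cases hz : ‖x - η t z‖ ≤ ε
        · calc _ ≤ |φ z - φ z₀| * (‖fderiv ℝ ρ (x - η t z)‖ * ‖w - v t z‖) :=
                mul_le_mul_of_nonneg_left (ContinuousLinearMap.le_opNorm _ _) (abs_nonneg _)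
            _ = |φ z - φ z₀| * ‖w - v t z‖ * ‖fderiv ℝ ρ (x - η t z)‖ := by ring
            _ ≤ _ := mul_le_mul_of_nonneg_right (hB z hz) (norm_nonneg _)
        · rw [hfd0 _ (not_le.mp hz)]
          simp
    _ = B * ∫ y, ‖fderiv ℝ ρ y‖ := by
        rw [integral_const_mul, integral_flow_eq (he t) (hmp t) fun y => ‖fderiv ℝ ρ y‖]

/-- The weight `z ↦ ρ (x - e z)` has total mass `1` because `e` preserves area, so the integral is a
mean of `φ` over the points that `e` sends within `ε` of `x`. -/
theorem abs_flowAverage_sub_le {ε : ℝ} (hρn : ∀ x, 0 ≤ ρ x)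
    (hρ0 : ∀ x, ε ≤ ‖x‖ → ρ x = 0) (hρi : ∫ x, ρ x = 1)
    {e : Plane → Plane} (he : MeasurableEmbedding e)
    (hmp : MeasurePreserving e volume volume) (hφ : Continuous φ) {C : ℝ} (hC : ∀ x, |φ x| ≤ C)
    {x z₀ : Plane} {B : ℝ} (hB : ∀ z, ‖x - e z‖ ≤ ε → |φ z - φ z₀| ≤ B) :
    |(∫ z, φ z * ρ (x - e z)) - φ z₀| ≤ B := by
  have h1 : Integrable fun z => ρ (x - e z) := by
    have h1 : Integrable ρ := integrable_of_integral_eq_one hρi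
    exact (hmp.integrable_comp_emb he).mpr (h1.comp_sub_left x)
  have h2 : φ z₀ = ∫ z, φ z₀ * ρ (x - e z) := by
    rw [integral_const_mul, integral_flow_eq he hmp, hρi, mul_one]
  have h3 : Integrable fun z => φ z * ρ (x - e z) :=
    h1.bdd_mul (c := C) hφ.aestronglyMeasurable (Eventually.of_forall hC)
  have h4 : B = ∫ z, B * ρ (x - e z) := by
    rw [integral_const_mul, integral_flow_eq he hmp, hρi, mul_one]
  rw [h2, ← integral_sub h3 (h1.const_mul _), ← Real.norm_eq_abs, h4]
  refine norm_integral_le_of_norm_le (h1.const_mul _) (Eventually.of_forall fun z => ?_)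
  rw [← sub_mul, norm_mul, Real.norm_eq_abs, Real.norm_eq_abs, abs_of_nonneg (hρn _)]
  by_cases hz : ‖x - e z‖ ≤ ε
  · exact mul_le_mul_of_nonneg_right (hB z hz) (hρn _)
  · rw [hρ0 _ (not_le.mp hz).le]
    simp

end FlowAverage

/-! ### Mollifiers on the plane -/

section Mollifier

/-- Mollifiers of every width, with the natural bound for their gradients. -/
theorem exists_mollifier : ∃ C > 0, ∀ ε > 0, ∃ ρ : Plane → ℝ, ContDiff ℝ 1 ρ ∧ (∀ x, 0 ≤ ρ x) ∧
    (∀ x, ε ≤ ‖x‖ → ρ x = 0) ∧ ∫ x, ρ x = 1 ∧ ∫ x, ‖fderiv ℝ ρ x‖ ≤ C / ε := by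
  let b : ContDiffBump (0 : Plane) := ⟨1 / 2, 1, by norm_num, by norm_num⟩
  set β : Plane → ℝ := b.normed volume with hβ
  have hβc : ContDiff ℝ 1 β := b.contDiff_normed (n := 1)
  have hβ0 : ∀ x, 1 ≤ ‖x‖ → β x = 0 := fun x hx => by
    rw [← Function.notMem_support, hβ, b.support_normed_eq]
    simpa using hx
  have hI : 0 ≤ ∫ x, ‖fderiv ℝ β x‖ := integral_nonneg fun x => norm_nonneg _
  refine ⟨(∫ x, ‖fderiv ℝ β x‖) + 1, by positivity, fun ε hε => ?_⟩
  refine ⟨fun x => (ε ^ 2)⁻¹ * β (ε⁻¹ • x), ?_, fun x => ?_, fun x hx => ?_, ?_, ?_⟩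
  · exact contDiff_const.mul (hβc.comp (contDiff_const_smul _))
  · exact mul_nonneg (by positivity) (b.nonneg_normed _)
  · refine mul_eq_zero_of_right _ (hβ0 _ ?_)
    rw [norm_smul, norm_inv, Real.norm_eq_abs, abs_of_pos hε, inv_mul_eq_div, le_div_iff₀ hε]
    linarith
  · rw [integral_const_mul, Measure.integral_comp_smul, b.integral_normed]
    simp
    field_simp
  · have hfd : ∀ x, fderiv ℝ (fun x => (ε ^ 2)⁻¹ * β (ε⁻¹ • x)) x
        = (ε ^ 2)⁻¹ • ε⁻¹ • fderiv ℝ β (ε⁻¹ • x) := fun x => by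
      have h1 : HasFDerivAt (fun x => β (ε⁻¹ • x)) (ε⁻¹ • fderiv ℝ β (ε⁻¹ • x)) x := by
        have := ((hβc.differentiable one_ne_zero (ε⁻¹ • x)).hasFDerivAt).comp x
          ((hasFDerivAt_id x).const_smul ε⁻¹)
        refine this.congr_fderiv ?_
        ext w
        simp
      have h2 : HasFDerivAt (fun x => (ε ^ 2)⁻¹ * β (ε⁻¹ • x)) _ x := h1.const_smul (ε ^ 2)⁻¹
      exact h2.fderiv
    simp only [hfd, norm_smul]
    rw [integral_const_mul, integral_const_mul,
      Measure.integral_comp_smul volume (fun x => ‖fderiv ℝ β x‖)]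
    have e2 : |((ε⁻¹ : ℝ) ^ Module.finrank ℝ Plane)⁻¹| = ε ^ 2 := by simp
    rw [e2, smul_eq_mul, norm_inv, norm_inv, norm_pow, Real.norm_eq_abs, abs_of_pos hε,
      le_div_iff₀ hε]
    calc _ = ∫ x, ‖fderiv ℝ β x‖ := by field_simp
      _ ≤ _ := by linarith

end Mollifier

/-! ### Uniqueness of weak solutions -/

section Uniqueness

theorem tendsto_add_one_mul_exp_neg {c : ℝ} (hc : 0 < c) :
    Tendsto (fun ℓ : ℝ => (ℓ + 1) * Real.exp (-(c * ℓ))) atTop (𝓝 0) := by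
  have h1 : Tendsto (fun ℓ : ℝ => Real.exp (-(c * ℓ))) atTop (𝓝 0) :=
    Real.tendsto_exp_neg_atTop_nhds_zero.comp (tendsto_id.const_mul_atTop hc)
  have h2 : Tendsto (fun x : ℝ => x ^ 1 * Real.exp (-x)) atTop (𝓝 0) :=
    Real.tendsto_pow_mul_exp_neg_atTop_nhds_zero 1
  have h3 := (h2.comp (tendsto_id.const_mul_atTop hc)).const_mul c⁻¹
  have h4 := h3.add h1
  rw [mul_zero, zero_add] at h4
  refine h4.congr fun ℓ => ?_
  simp only [Function.comp_apply, id, pow_one]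
  field_simp

/-- A weak solution is transported by a measure preserving flow of its velocity. -/
theorem map_eq_of_weak_equation {q : ℝ → SignedMeasure Plane} {u : ℝ → Plane → Plane}
    {η : ℝ → Plane ≃ₜ Plane}
    (hq : ∀ f : C₀(Plane, ℝ), Continuous fun t => ∫ᵛ x, f x ∂<•(q t))
    (hu : Continuous fun p : ℝ × Plane => u p.1 p.2)
    (hw : ∀ ψ : ℝ × Plane → ℝ, ContDiff ℝ ∞ ψ → HasCompactSupport ψ →
      ∫ t, (∫ᵛ x, fderiv ℝ ψ (t, x) (1, u t x) ∂<•(q t)) = 0)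
    (hη : Continuous fun p : ℝ × Plane => η p.1 p.2)
    (hd : ∀ t x, HasDerivAt (fun s => η s x) (u t (η t x)) t) (h0 : ∀ x, η 0 x = x)
    (hmp : ∀ t, MeasurePreserving (η t) volume volume)
    (hS : ∀ T, ∃ S, ∀ t, |t| ≤ T → ∀ z, ‖η t z - z‖ ≤ S)
    (hL : ∀ T, ∃ A > 0, ∀ t, |t| ≤ T → LogLip A (u t)) (t : ℝ) : q t = (q 0).map (η t) := by
  have hv : Continuous fun p : ℝ × Plane => u p.1 (η p.1 p.2) :=
    hu.comp (continuous_fst.prodMk hη)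
  have he : ∀ t, MeasurableEmbedding (η t) := fun t => (η t).measurableEmbedding
  obtain ⟨A, hA, hAu⟩ := hL (|t| + 1)
  obtain ⟨C, hC, c, hc, hH⟩ := exists_holder_inverse_flow hA (|t| + 1) hAu hd h0
  obtain ⟨M, hM0, hM⟩ := exists_totalVariation_le hq (|t| + 1)
  obtain ⟨C₁, hC₁, hmol⟩ := exists_mollifier
  -- Pulling back to time `0` lets a fixed smooth `f` be used for the comparison.
  suffices h : (q t).map (η t).symm = q 0 by
    rw [← h]
    ext s hs
    rw [VectorMeasure.map_apply _ (η t).continuous.measurable hs,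
      VectorMeasure.map_apply _ (η t).symm.continuous.measurable
        ((η t).continuous.measurable hs), ← preimage_comp]
    simp
  refine signedMeasure_ext_of_contDiff fun f hf hfc => ?_
  have hfcont := hf.continuous
  obtain ⟨Q, hQ⟩ := hfc.exists_bound_of_continuous hfcont
  obtain ⟨K, hK⟩ := (hf.of_le (by simp : (1 : WithTop ℕ∞) ≤ ∞)).lipschitzWith_of_hasCompactSupport hfc
    one_ne_zero
  rw [signedIntegral_map _ (η t).symm.continuous.measurable hfcont.stronglyMeasurable hQ]
  have hest : ∀ ℓ : ℝ, 1 ≤ ℓ →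
      |∫ᵛ x, f ((η t).symm x) ∂<•(q t) - ∫ᵛ x, f x ∂<•(q 0)|
        ≤ (C₁ * A * |t| + 2) * (K * C * M) * ((ℓ + 1) * Real.exp (-(c * ℓ))) := by
    intro ℓ hℓ
    set ε := Real.exp (-ℓ) with hε
    have hε0 : 0 < ε := Real.exp_pos _
    have hε1 : ε ≤ 1 := by rw [hε]; exact Real.exp_le_one_iff.mpr (by linarith)
    obtain ⟨ρ, hρ, hρn, hρ0, hρi, hρd⟩ := hmol ε hε0
    have hρ1 : ∀ x, 1 ≤ ‖x‖ → ρ x = 0 := fun x hx => hρ0 x (hε1.trans hx)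
    -- Lipschitz constant of `f` times the Hölder bound for the inverse flow at scale `ε`: the
    -- oscillation of `f` over the preimage of a disc of radius `ε`.
    set β := K * (C * Real.exp (-(c * ℓ))) with hβ
    have hβ0 : 0 ≤ β := by positivity
    have hclose : ∀ s, |s| ≤ |t| + 1 → ∀ x z, ‖x - η s z‖ ≤ ε →
        |f z - f ((η s).symm x)| ≤ β := fun s hs x z hz => by
      rw [← Real.dist_eq]
      refine (hK.dist_le_mul _ _).trans (mul_le_mul_of_nonneg_left ?_ K.2)
      rw [dist_comm, dist_eq_norm]
      refine hH s hs _ _ ℓ hℓ ?_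
      rwa [Homeomorph.apply_symm_apply]
    set g : ℝ × Plane → ℝ := fun p => ∫ z, f z * ρ (p.2 - η p.1 z) with hg
    have hgc : ContDiff ℝ 1 g := contDiff_flowAverage hρ hρ1 hη hv hd hS hfcont
    have hgs : ∀ T, ∃ R, ∀ t, |t| ≤ T → ∀ x, R < ‖x‖ → g (t, x) = 0 := fun T => by
      obtain ⟨S, hS⟩ := hS T
      obtain ⟨R, hR⟩ := hfc.isCompact.isBounded.exists_norm_le
      refine ⟨R + S + 1, fun t ht x hx => ?_⟩
      refine integral_eq_zero_of_ae (Eventually.of_forall fun z => ?_)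
      by_cases hz : z ∈ tsupport f
      · refine mul_eq_zero_of_right _ (hρ1 _ ?_)
        have h1 := hR z hz
        have h2 := hS t ht z
        have h3 : ‖x‖ ≤ ‖x - η t z‖ + ‖η t z - z‖ + ‖z‖ := by
          calc ‖x‖ = ‖(x - η t z) + (η t z - z) + z‖ := by congr 1; abel
            _ ≤ _ := norm_add₃_le
        change 1 ≤ ‖x - η t z‖
        linarith
      · exact mul_eq_zero_of_left (image_eq_zero_of_notMem_tsupport hz) _
    have hmain : |∫ᵛ x, g (t, x) ∂<•(q t) - ∫ᵛ x, g (0, x) ∂<•(q 0)|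
        ≤ (β * (A * (ℓ * ε + ε)) * (C₁ / ε)) * M * |t| := by
      refine abs_pairing_sub_le hq hu hw hgc hgs (T := |t|) (abs_nonneg t) (by positivity) hM0 hM
        (fun s hs x => ?_) le_rfl
      refine (abs_fderiv_flowAverage_le hρ hε1 hρ0 hη hv hd hS hfcont he hmp
        (z₀ := (η s).symm x) (B := β * (A * (ℓ * ε + ε))) fun z hz => ?_).trans
        (mul_le_mul_of_nonneg_left hρd (by positivity))
      refine mul_le_mul (hclose s hs x z hz) ?_ (norm_nonneg _) hβ0
      refine (hAu s hs ℓ hℓ x (η s z)).trans ?_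
      gcongr
    have happ : ∀ s, |s| ≤ |t| + 1 →
        |∫ᵛ x, f ((η s).symm x) ∂<•(q s) - ∫ᵛ x, g (s, x) ∂<•(q s)| ≤ β * M := fun s hs => by
      have i1 : Integrable (fun x => f ((η s).symm x)) (q s).totalVariation :=
        integrable_of_bounded (hfcont.comp (η s).symm.continuous) fun x => hQ _
      have i2 : Integrable (fun x => g (s, x)) (q s).totalVariation := by
        obtain ⟨R, hR⟩ := hgs |s|
        exact (hgc.continuous.comp (Continuous.prodMk_right s)).integrable_of_hasCompactSupport
          (HasCompactSupport.intro (isCompact_closedBall 0 R) fun x hx =>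
            hR s le_rfl x (by simpa using hx))
      rw [← signedIntegral_sub _ i1 i2]
      refine (norm_signedIntegral_le (q s) (f := fun x => f ((η s).symm x) - g (s, x)) (C := β)
        fun x => ?_).trans (mul_le_mul_of_nonneg_left (hM s hs) hβ0)
      rw [norm_sub_rev]
      exact abs_flowAverage_sub_le hρn hρ0 hρi (he s) (hmp s) hfcont hQ (hclose s hs x)
    have h1 := happ t (by linarith)
    have h2 := happ 0 (by rw [abs_zero]; positivity)
    have h0' : ∀ x, (η 0).symm x = x := fun x => by
      rw [Homeomorph.symm_apply_eq, h0]
    simp only [h0'] at h2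
    -- The width `ε` in the increment of `u` cancels the `1 / ε` from the mollifier gradient. The
    -- Hölder gain in `β` beats the remaining factor `ℓ + 1`.
    have e : (β * (A * (ℓ * ε + ε)) * (C₁ / ε)) * M * |t|
        = C₁ * A * |t| * (K * C * M) * ((ℓ + 1) * Real.exp (-(c * ℓ))) := by
      rw [hβ]
      field_simp
    have e2 : 2 * (β * M) ≤ 2 * (K * C * M) * ((ℓ + 1) * Real.exp (-(c * ℓ))) := by
      have : 2 * (β * M) = 2 * (K * C * M) * (1 * Real.exp (-(c * ℓ))) := by rw [hβ]; ring
      rw [this]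
      gcongr
      linarith
    rw [e] at hmain
    have h3 := abs_sub_le (∫ᵛ x, f ((η t).symm x) ∂<•(q t)) (∫ᵛ x, g (t, x) ∂<•(q t))
      (∫ᵛ x, f x ∂<•(q 0))
    have h4 := abs_sub_le (∫ᵛ x, g (t, x) ∂<•(q t)) (∫ᵛ x, g (0, x) ∂<•(q 0))
      (∫ᵛ x, f x ∂<•(q 0))
    rw [abs_sub_comm] at h2
    linarith
  have hlim := (tendsto_add_one_mul_exp_neg hc).const_mul ((C₁ * A * |t| + 2) * (K * C * M))
  rw [mul_zero] at hlim
  have := ge_of_tendsto hlim ((eventually_ge_atTop 1).mono hest)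
  exact sub_eq_zero.mp (abs_nonpos_iff.mp this)

variable {h : Plane → ℝ} {q₀ : SignedMeasure Plane} {k : Plane →ᵇ Plane} {η : ℝ → Plane ≃ₜ Plane}
  {u : ℝ → Plane → Plane} {q : ℝ → SignedMeasure Plane}

theorem IsGlobalWeakSolution.velocity_eq_vortexVelocity (hs : IsGlobalWeakSolution h q₀ η u q)
    (hk : ∀ x, k x = regKernel h x) (t : ℝ) :
    u t = vortexVelocity (q t).totalVariation k (signWeight (q t)) id := by
  ext1 x
  rw [hs.velocity_eq, vortexVelocity]
  simp only [← hk, id]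
  exact signedIntegral_eq_integral _ (f := fun y => k (x - y))
    (integrable_of_bounded (k.continuous.comp (continuous_sub_left x)) fun y => k.norm_coe_le_norm _)

/-- The mass of `q t` is bounded on compact time intervals, so `u` is bounded along the flow and
log-Lipschitz there with uniform constants; these are the conditions for transport. -/
theorem IsGlobalWeakSolution.eq_map (hs : IsGlobalWeakSolution h q₀ η u q)
    (hk : ∀ x, k x = regKernel h x) {A : ℝ} (hA : 0 < A) (hkA : LogLip A k) (t : ℝ) :
    q t = q₀.map (η t) := by
  rw [← hs.initial]
  have hb : ∀ T, ∃ M, 0 ≤ M ∧ ∀ t, |t| ≤ T → (q t).totalVariation.real univ ≤ M :=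
    exists_totalVariation_le hs.vorticity_continuous
  refine map_eq_of_weak_equation hs.vorticity_continuous hs.velocity_continuous hs.weak_equation
    hs.flow_continuous hs.flow_hasDerivAt hs.flow_zero hs.flow_measurePreserving (fun T => ?_)
    (fun T => ?_) t
  · obtain ⟨M, hM0, hM⟩ := hb T
    refine ⟨‖k‖ * M * |T|, fun t ht z => ?_⟩
    have hbd : ∀ s ∈ Icc (-T) T, ‖u s (η s z)‖ ≤ ‖k‖ * M := fun s hs' => by
      rw [hs.velocity_eq_vortexVelocity hk]
      exact (norm_vortexVelocity_le (abs_signWeight_le _) k.norm_coe_le_norm _ _).trans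
        (mul_le_mul_of_nonneg_left (hM s (abs_le.mpr hs')) (norm_nonneg _))
    have hT : 0 ≤ T := (abs_nonneg t).trans ht
    have := (convex_Icc (-T) T).norm_image_sub_le_of_norm_hasDerivWithin_le
      (fun s _ => (hs.flow_hasDerivAt s z).hasDerivWithinAt) hbd (x := 0) (y := t)
      ⟨by linarith, hT⟩ (abs_le.mp ht)
    rw [hs.flow_zero, sub_zero, Real.norm_eq_abs] at this
    exact this.trans (mul_le_mul_of_nonneg_left (ht.trans (le_abs_self T)) (by positivity))
  · obtain ⟨M, hM0, hM⟩ := hb T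
    refine ⟨A * (M + 1), by positivity, fun t ht => ?_⟩
    rw [hs.velocity_eq_vortexVelocity hk]
    refine (logLip_vortexVelocity (measurable_signWeight _) (abs_signWeight_le _) k.continuous
      k.norm_coe_le_norm hkA measurable_id).mono ?_
    exact mul_le_mul_of_nonneg_left (by linarith [hM t ht]) hA.le

theorem IsGlobalWeakSolution.velocity_eq_transport (hs : IsGlobalWeakSolution h q₀ η u q)
    (hk : ∀ x, k x = regKernel h x) {A : ℝ} (hA : 0 < A) (hkA : LogLip A k) (t : ℝ) :
    u t = vortexVelocity q₀.totalVariation k (signWeight q₀) (η t) := by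
  ext1 x
  rw [hs.velocity_eq, hs.eq_map hk hA hkA]
  simp only [← hk]
  exact velocity_eq_of_map q₀ (η t) x

/-- In Lagrangian coordinates, a weak solution solves an autonomous differential equation. -/
theorem IsGlobalWeakSolution.exists_displacement (hs : IsGlobalWeakSolution h q₀ η u q)
    (hk : ∀ x, k x = regKernel h x) {A : ℝ} (hA : 0 < A) (hkA : LogLip A k) :
    ∃ ξ : ℝ → Plane →ᵇ Plane, ξ 0 = 0 ∧ (∀ t x, η t x = x + ξ t x) ∧
      ∀ t, HasDerivAt ξ (vortexField q₀.totalVariation k (measurable_signWeight q₀)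
        (abs_signWeight_le q₀) (ξ t)) t := by
  set V := ‖k‖ * q₀.totalVariation.real univ with hV
  have hV0 : 0 ≤ V := by positivity
  have hu : ∀ t x, ‖u t x‖ ≤ V := fun t x => by
    rw [hs.velocity_eq_transport hk hA hkA]
    exact norm_vortexVelocity_le (abs_signWeight_le _) k.norm_coe_le_norm _ _
  have hlip : ∀ s t x, ‖η s x - η t x‖ ≤ V * |s - t| := fun s t x =>
    convex_univ.norm_image_sub_le_of_norm_hasDerivWithin_le (f := fun s => η s x)
      (fun r _ => (hs.flow_hasDerivAt r x).hasDerivWithinAt) (fun r _ => hu r _)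
      (mem_univ t) (mem_univ s)
  let ξ : ℝ → Plane →ᵇ Plane := fun t =>
    BoundedContinuousFunction.ofNormedAddCommGroup (fun x => η t x - x)
      ((η t).continuous.sub continuous_id) (V * |t|) fun x => by
        have := hlip t 0 x
        rwa [hs.flow_zero, sub_zero] at this
  have hξ : ∀ t x, ξ t x = η t x - x := fun t x => rfl
  have hηξ : ∀ t x, η t x = x + ξ t x := fun t x => by rw [hξ]; abel
  have hξc : Continuous ξ := by
    refine (LipschitzWith.of_dist_le_mul (K := ⟨V, hV0⟩) fun s t => ?_).continuous
    rw [dist_eq_norm, BoundedContinuousFunction.norm_le (by positivity)]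
    intro x
    have e : (ξ s - ξ t) x = η s x - η t x := by
      rw [BoundedContinuousFunction.coe_sub, Pi.sub_apply, hξ, hξ]; abel
    rw [e, Real.dist_eq]
    exact hlip s t x
  set F := vortexField q₀.totalVariation k (measurable_signWeight q₀) (abs_signWeight_le q₀) with hF
  have hFlog : LogLip (2 * A * q₀.totalVariation.real univ + 1) F :=
    (logLip_vortexField (measurable_signWeight q₀) (abs_signWeight_le q₀) hA.le hkA).mono
      (by linarith)
  have hFc : Continuous fun t => F (ξ t) :=
    (hFlog.uniformContinuous (by positivity)).continuous.comp hξc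
  have hI : ∀ t, HasDerivAt (fun t => ∫ s in (0 : ℝ)..t, F (ξ s)) (F (ξ t)) t := fun t =>
    intervalIntegral.integral_hasDerivAt_right (hFc.intervalIntegrable _ _)
      (hFc.stronglyMeasurableAtFilter _ _) hFc.continuousAt
  have hev : ∀ t x, HasDerivAt (fun t => ξ t x) (F (ξ t) x) t := fun t x => by
    have h1 := (hs.flow_hasDerivAt t x).sub_const x
    have e : u t (η t x) = F (ξ t) x := by
      rw [hs.velocity_eq_transport hk hA hkA, hF, vortexField_apply, ← hηξ]
      congr 1
      ext1 y
      exact hηξ t y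
    rw [e] at h1
    exact h1
  have hξ0 : ξ 0 = 0 := by
    ext1 x
    rw [hξ, hs.flow_zero, sub_self]
    rfl
  -- The equation is known only at each fixed `x`. Comparison with the Banach space valued integral
  -- of `F (ξ s)`, which has the same derivative at every `x`, upgrades it to differentiability in
  -- the uniform norm.
  have heq : ξ = fun t => ∫ s in (0 : ℝ)..t, F (ξ s) := by
    ext1 t
    ext1 x
    have h1 : ∀ t, HasDerivAt (fun t => (∫ s in (0 : ℝ)..t, F (ξ s) : Plane →ᵇ Plane) x)
        (F (ξ t) x) t := fun t => by
      have := (BoundedContinuousFunction.evalCLM ℝ x : (Plane →ᵇ Plane) →L[ℝ] Plane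
        ).hasFDerivAt.comp_hasDerivAt t (hI t)
      exact this
    have h2 : ∀ t, HasDerivAt (fun t => ξ t x - (∫ s in (0 : ℝ)..t, F (ξ s) : Plane →ᵇ Plane) x) 0 t :=
      fun t => by
        have := (hev t x).sub (h1 t)
        rw [sub_self] at this
        exact this
    have h3 := is_const_of_deriv_eq_zero (fun t => (h2 t).differentiableAt) (fun t => (h2 t).deriv) t 0
    rw [hξ0, intervalIntegral.integral_same, sub_self] at h3
    exact sub_eq_zero.mp h3
  refine ⟨ξ, hξ0, hηξ, fun t => ?_⟩
  have := hI t
  rw [← heq] at this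
  exact this

end Uniqueness

/-! ### The kernels as bounded continuous maps -/

section Bundled

variable {h : Plane → ℝ}

/-- `K_h` and its smooth approximations, as bounded continuous maps. -/
theorem HasLogSingularity.exists_kernels {M : ℝ} (hh : HasLogSingularity M h) :
    ∃ (k : Plane →ᵇ Plane) (A : ℝ) (L : ℕ → ℝ) (κ : ℕ → Plane →ᵇ Plane),
      (∀ x, k x = regKernel h x) ∧ 0 < A ∧ LogLip A k ∧ (∀ j, IsDivFree (L j) (κ j)) ∧
        Tendsto κ atTop (𝓝 k) := by
  obtain ⟨B, hB⟩ := hh.exists_norm_regKernel_le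
  obtain ⟨A, hA, hAk⟩ := hh.exists_logLip_regKernel
  let k : Plane →ᵇ Plane := BoundedContinuousFunction.ofNormedAddCommGroup (regKernel h)
    (hAk.uniformContinuous hA).continuous B hB
  let ε : ℕ → ℝ := fun j => 1 / ((j : ℝ) + 1)
  have hε : ∀ j, 0 < ε j := fun j => by positivity
  have hε1 : ∀ j, ε j ≤ 1 := fun j => by
    change 1 / ((j : ℝ) + 1) ≤ 1
    rw [div_le_one (by positivity)]
    linarith [(Nat.cast_nonneg j : (0 : ℝ) ≤ j)]
  have hdf : ∀ j, IsDivFree (3 / ε j ^ 2 * ∫ x, |h x|) (smoothRegKernel h (ε j)) := fun j =>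
    isDivFree_smoothRegKernel hh.integrable (hε j)
  set D : ℕ → ℝ := fun j => M * (2 * circleLength *
    ∫ ρ in Ioi 0, ρ * (kernelProfile (ε j) ρ * logProfile 0 ρ)) with hD
  have hsub : ∀ j x, ‖smoothRegKernel h (ε j) x - regKernel h x‖ ≤ D j := fun j x =>
    hh.norm_smoothRegKernel_sub_le (hε j) (hε1 j) x
  have hD0 : Tendsto D atTop (𝓝 0) := by
    have := ((tendsto_integral_kernelProfile_mul_logProfile hε hε1
      tendsto_one_div_add_atTop_nhds_zero_nat).const_mul (2 * circleLength)).const_mul M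
    rw [mul_zero, mul_zero] at this
    exact this
  let κ : ℕ → Plane →ᵇ Plane := fun j => BoundedContinuousFunction.ofNormedAddCommGroup
    (smoothRegKernel h (ε j)) ((hdf j).differentiable.continuous) (D j + B) fun x => by
      have := norm_add_le (smoothRegKernel h (ε j) x - regKernel h x) (regKernel h x)
      rw [sub_add_cancel] at this
      exact this.trans (add_le_add (hsub j x) (hB x))
  refine ⟨k, A, _, κ, fun x => rfl, hA, hAk, hdf, ?_⟩
  rw [tendsto_iff_norm_sub_tendsto_zero]
  refine squeeze_zero (fun j => norm_nonneg _) (fun j => ?_) hD0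
  exact (BoundedContinuousFunction.norm_le ((norm_nonneg _).trans (hsub j 0))).mpr (hsub j)

end Bundled

/-- Particle paths of a log-Lipschitz velocity cannot meet, which gives injectivity; preservation of
area and boundedness of `ξ t` supply the rest. -/
theorem exists_homeomorph_flow {q₀ : SignedMeasure Plane} {k : Plane →ᵇ Plane} {A : ℝ} (hA : 0 < A)
    (hk : LogLip A k) {ξ : ℝ → Plane →ᵇ Plane} (hξ0 : ξ 0 = 0)
    (hξ : ∀ t, HasDerivAt ξ (vortexField q₀.totalVariation k (measurable_signWeight q₀)
      (abs_signWeight_le q₀) (ξ t)) t)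
    (hmp : ∀ t, MeasurePreserving (fun x => x + ξ t x) volume volume) :
    ∃ η : ℝ → Plane ≃ₜ Plane, ∀ t x, η t x = x + ξ t x := by
  have hc : ∀ t, Continuous fun x => x + ξ t x := fun t => continuous_id.add (ξ t).continuous
  have hinj : ∀ t, Function.Injective fun x => x + ξ t x := fun t => by
    refine injective_flow (A := A * q₀.totalVariation.real univ + 1) (by positivity)
      (u := fun s => vortexVelocity q₀.totalVariation k (signWeight q₀) fun y => y + ξ s y)
      (η := fun s x => x + ξ s x) (fun s _ => ?_) (fun s x => ?_) fun x => ?_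
    · exact (logLip_vortexVelocity (measurable_signWeight _) (abs_signWeight_le _) k.continuous
        k.norm_coe_le_norm hk (hc s).measurable).mono (by linarith)
    · have h1 := (BoundedContinuousFunction.evalCLM ℝ x : (Plane →ᵇ Plane) →L[ℝ] Plane
        ).hasFDerivAt.comp_hasDerivAt s (hξ s)
      exact h1.const_add x
    · simp [hξ0]
  choose η hη using fun t => exists_homeomorph_of_measurePreserving (hc t) (hinj t) (hmp t)
    (R := ‖ξ t‖) fun x => by
      rw [add_sub_cancel_left]; exact (ξ t).norm_coe_le_norm x
  exact ⟨η, fun t x => congrFun (hη t) x⟩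

end

end EulerPoincare

/-! ### The main theorem -/

open EulerPoincare in
theorem theorem1 (h : Plane → ℝ) (hh : IsSmoothingFunction h) (q₀ : SignedMeasure Plane) :
    ∃ (η : ℝ → Plane ≃ₜ Plane) (u : ℝ → Plane → Plane) (q : ℝ → SignedMeasure Plane),
      IsGlobalWeakSolution h q₀ η u q ∧
      IsC1Flow η ∧
      (∀ t, TendstoUniformly u (u t) (𝓝 t)) ∧
      (∀ t, q t = q₀.map (η t)) ∧
      ∀ (η' : ℝ → Plane ≃ₜ Plane) (u' : ℝ → Plane → Plane) (q' : ℝ → SignedMeasure Plane),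
        IsGlobalWeakSolution h q₀ η' u' q' → η' = η ∧ u' = u ∧ q' = q := by
  obtain ⟨M, hM⟩ := hh.exists_hasLogSingularity
  obtain ⟨k, A, L, κ, hk, hA, hkA, hκ, hlim⟩ := hM.exists_kernels
  obtain ⟨ξ, hξ0, hξ, hmp⟩ := exists_vortex_flow (m := q₀.totalVariation) (measurable_signWeight q₀)
    (abs_signWeight_le q₀) hA.le hkA hκ hlim
  obtain ⟨η, hη⟩ := exists_homeomorph_flow hA hkA hξ0 hξ hmp
  have hmp' : ∀ t, MeasurePreserving (η t) volume volume := fun t => by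
    rw [show (η t : Plane → Plane) = fun x => x + ξ t x from funext (hη t)]
    exact hmp t
  -- The summand `1` keeps the constant positive when `q₀ = 0`.
  have hF : LogLip (2 * A * q₀.totalVariation.real Set.univ + 1)
      (vortexField q₀.totalVariation k (measurable_signWeight q₀) (abs_signWeight_le q₀)) :=
    (logLip_vortexField (measurable_signWeight q₀) (abs_signWeight_le q₀) hA.le hkA).mono
      (by linarith)
  have hpos : 0 < 2 * A * q₀.totalVariation.real Set.univ + 1 := by positivity
  have hξc : Continuous ξ := continuous_iff_continuousAt.mpr fun t => (hξ t).continuousAt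
  refine ⟨η, fun t => vortexVelocity q₀.totalVariation k (signWeight q₀) (η t),
    fun t => q₀.map (η t), isGlobalWeakSolution_of_flow hk hξ0 hξ hη hmp',
    isC1Flow_of_hasDerivAt hξ ((hF.uniformContinuous hpos).continuous.comp hξc) hη hmp',
    tendstoUniformly_transportVelocity hA hkA hξc hη, fun t => rfl, fun η' u' q' hs => ?_⟩
  -- The competing solution has a displacement for the same autonomous field and the same initial
  -- value. Once the flows coincide, `u'` and `q'` are determined by them.
  obtain ⟨ξ', hξ0', hη', hξ'⟩ := hs.exists_displacement hk hA hkA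
  have hξξ : ξ' = ξ := eq_of_hasDerivAt_autonomous hpos hF hξ' hξ (by rw [hξ0, hξ0'])
  have hηη : η' = η := by
    ext1 t
    ext1 x
    rw [hη', hη, hξξ]
  refine ⟨hηη, funext fun t => ?_, funext fun t => ?_⟩
  · rw [hs.velocity_eq_transport hk hA hkA, hηη]
  · rw [hs.eq_map hk hA hkA, hηη]
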